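/- Let $T=[0,2\pi]$. For a sequence $\Lambda=\{\lambda_n\}_{n\ge1}$ of positive numbers, a real function $f(x,y)$ that is $2\pi$-periodic in each variable belongs to $P\Lambda BV$ (bounded partial $\Lambda$-variation) if $$\sup_{y\in T}\ \sup_{\{I_i\}}\sum_i\frac{|f(b_i,y)-f(a_i,y)|}{\lambda_i}+\sup_{x\in T}\ \sup_{\{I_i\}}\sum_i\frac{|f(x,b_i)-f(x,a_i)|}{\lambda_i}<\infty ,$$ where $\{I_i\}=\{(a_i,b_i)\}_{i\ge1}$ runs over all collections of nonoverlapping intervals of $T$, ordered in an arbitrary way. For $f\in L^1(T^2)$ let $$\widehat f(k,l)=\frac1{4\pi^2}\int_{T^2} f(x,y)e^{-ikx}e^{-ily}\,dx\,dy,\qquad S_{M,N}[f,(x,y)]=\sum_{k=-M}^{M}\sum_{l=-N}^{N}\widehat f(k,l)e^{ikx}e^{ily},$$ and for $a,b>-1$ let the Cesàro $(C;a,b)$ means of the double Fourier series of $f$ be $$\sigma^{a,b}_{n,m}f(x,y)=\frac1{A^{a}_nA^{b}_m}\sum_{i=0}^n\sum_{j=0}^m A^{a-1}_{n-i}A^{b-1}_{m-j}\,S_{i,j}[f,(x,y)],\qquad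 A^{a}_0=1,\quad A^{a}_k=\frac{(a+1)\cdots(a+k)}{k!}.$$ Denote by $f(x\pm0,y\pm0)$ the four limits of $f$ at $(x,y)$ along the open coordinate quadrants, and by $\sum f(x\pm0,y\pm0)$ their sum. Let $\alpha,\beta\in(0,1)$ with $\alpha+\beta<1$. (a) Let $f\in L^1(T^2)$ be $2\pi$-periodic in each variable and let $f\in P\left\{\frac{n^{1-(\alpha+\beta)}}{\log^{1+\varepsilon}(n+1)}\right\}BV$ for some $\varepsilon>0$. Then at every point $(x,y)$ where the four quadrant limits exist, $$\lim_{n,m\to\infty}\sigma^{-\alpha,-\beta}_{n,m}f(x,y)=\tfrac14\sum f(x\pm0,y\pm0)$$ ($n$ and $m$ tending to infinity independently). Moreover, $\sigma^{-\alpha,-\beta}_{n,m}f\to f$ as $n,m\to\infty$ uniformly on every compact set $K\subset\mathbb R^2$ such that $f$ is continuous at every point of $K$. (b) There exists a continuous function $f$ on $\mathbb R^2$, $2\pi$-periodic in each variable, with $f\in P\left\{\frac{n^{1-(\alpha+\beta)}}{\log(n+1)}\right\}BV$, such that the $(C;-\alpha,-\beta)$ means of its double Fourier series diverge over cubes at $(0,0)$,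 i.e. the sequence $\sigma^{-\alpha,-\beta}_{N,N}f(0,0)$, $N=1,2,\dots$, does not converge. -/

import Mathlib

open Set Filter Topology MeasureTheory
open scoped Nat ENNReal

noncomputable section

namespace CesaroNeg

/-- `f` is `2π`-periodic with respect to each of its two variables. -/
def IsBiperiodic (f : ℝ × ℝ → ℝ) : Prop :=
  ∀ x y : ℝ, f (x + 2 * Real.pi, y) = f (x, y) ∧ f (x, y + 2 * Real.pi) = f (x, y)

/-- The square `T² = [0, 2π] × [0, 2π]`. -/
def square : Set (ℝ × ℝ) := Icc 0 (2 * Real.pi) ×ˢ Icc 0 (2 * Real.pi)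

/-- A finite ordered collection of pairwise nonoverlapping (nondegenerate) intervals
`(a i, b i)`, `i < n`, contained in `T = [0, 2π]`; the order is arbitrary. -/
structure IntervalCollection where
  n : ℕ
  a : Fin n → ℝ
  b : Fin n → ℝ
  zero_le : ∀ i, 0 ≤ a i
  lt : ∀ i, a i < b i
  le_two_pi : ∀ i, b i ≤ 2 * Real.pi
  nonoverlapping : ∀ i j, i ≠ j → Disjoint (Ioo (a i) (b i)) (Ioo (a j) (b j))

/-- The `Λ`-variation on `T` of a function `g` of one variable, `Λ = {lam 1, lam 2, …}`: the supremum of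
`∑ i, |g (b i) - g (a i)| / lam i` over all ordered collections of nonoverlapping intervals.
The first interval of a collection gets the weight `1 / lam 1`, and so on; `lam 0` is not used.
(Infinite sequences of intervals give the same supremum, as the terms are nonnegative.) -/
def lambdaVar (lam : ℕ → ℝ) (g : ℝ → ℝ) : ℝ≥0∞ :=
  ⨆ E : IntervalCollection,
    ∑ i : Fin E.n, ENNReal.ofReal (|g (E.b i) - g (E.a i)| / lam ((i : ℕ) + 1))

/-- `ΛV₁(f)`: the supremum over `y ∈ T` of the `Λ`-variation in the first variable. -/
def lambdaVar₁ (lam : ℕ → ℝ) (f : ℝ × ℝ → ℝ) : ℝ≥0∞ :=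
  ⨆ y ∈ Icc (0 : ℝ) (2 * Real.pi), lambdaVar lam (fun x => f (x, y))

/-- `ΛV₂(f)`: the supremum over `x ∈ T` of the `Λ`-variation in the second variable. -/
def lambdaVar₂ (lam : ℕ → ℝ) (f : ℝ × ℝ → ℝ) : ℝ≥0∞ :=
  ⨆ x ∈ Icc (0 : ℝ) (2 * Real.pi), lambdaVar lam (fun y => f (x, y))

/-- `f ∈ PΛBV`: the function `f` has bounded partial `Λ`-variation. -/
def MemPLambdaBV (lam : ℕ → ℝ) (f : ℝ × ℝ → ℝ) : Prop :=
  lambdaVar₁ lam f + lambdaVar₂ lam f < ∞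

/-- The Fourier coefficient
`(1 / 4π²) ∫_{T²} f(x, y) e^{-imx} e^{-iny} dx dy`. -/
def fourierCoeff₂ (f : ℝ × ℝ → ℝ) (m n : ℤ) : ℂ :=
  (1 / (4 * (Real.pi : ℂ) ^ 2)) *
    ∫ p in square, (f p : ℂ) * Complex.exp (-(Complex.I * m * p.1)) *
      Complex.exp (-(Complex.I * n * p.2))

/-- The rectangular partial sum `S_{M,N}[f, (x, y)]` of the double Fourier series. -/
def rectPartialSum (f : ℝ × ℝ → ℝ) (M N : ℕ) (p : ℝ × ℝ) : ℂ :=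
  ∑ m ∈ Finset.Icc (-(M : ℤ)) M, ∑ n ∈ Finset.Icc (-(N : ℤ)) N,
    fourierCoeff₂ f m n * Complex.exp (Complex.I * m * p.1) *
      Complex.exp (Complex.I * n * p.2)

/-- The Cesàro number `A_k^a = (a + 1) ⋯ (a + k) / k!`, with `A_0^a = 1`. -/
def cesaroNumber (a : ℝ) (k : ℕ) : ℝ :=
  (∏ j ∈ Finset.range k, (a + ((j : ℝ) + 1))) / (k ! : ℝ)

/-- The Cesàro `(C; a, b)` mean `σ_{n,m}^{a,b} f(x, y)` of the double Fourier series of `f`. -/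
def cesaroMean (a b : ℝ) (f : ℝ × ℝ → ℝ) (n m : ℕ) (p : ℝ × ℝ) : ℂ :=
  (1 / (cesaroNumber a n : ℂ)) * (1 / (cesaroNumber b m : ℂ)) *
    ∑ i ∈ Finset.range (n + 1), ∑ j ∈ Finset.range (m + 1),
      (cesaroNumber (a - 1) (n - i) : ℂ) * (cesaroNumber (b - 1) (m - j) : ℂ) *
        rectPartialSum f i j p

/-- The four open coordinate quadrant limits `f(x+0, y+0)`, `f(x+0, y-0)`, `f(x-0, y+0)`,
`f(x-0, y-0)` exist (as finite numbers) and equal `pp`, `pm`, `mp`, `mm` respectively. -/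
def HasQuadrantLimits (f : ℝ × ℝ → ℝ) (x y pp pm mp mm : ℝ) : Prop :=
  Tendsto f (𝓝[>] x ×ˢ 𝓝[>] y) (𝓝 pp) ∧ Tendsto f (𝓝[>] x ×ˢ 𝓝[<] y) (𝓝 pm) ∧
    Tendsto f (𝓝[<] x ×ˢ 𝓝[>] y) (𝓝 mp) ∧ Tendsto f (𝓝[<] x ×ˢ 𝓝[<] y) (𝓝 mm)

end CesaroNeg

end

noncomputable section

namespace CesaroNeg

/-! ### Cesàro numbers -/

/-! The kernel. Up to the factor `A_n^{-α}`, the one-dimensional kernel `K_n` times `2 sin (t/2)` is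
the imaginary part of `e^{i(n+1/2)t} P(t)`, where `P` is the Taylor polynomial of `(1 - z)^α` at `z
= e^{-it}`. Dividing `P` by `(1 - z)^α` leaves a function whose derivative is a single boundary term
(`hasDerivAt_kernelModulation`), so it stays close to its value at `π` once `nt` is large. Hence
`K_n` is a pure oscillation with linear phase and a slowly varying amplitude of exact order `n
(nt)^{α-1}` (`cesaroKernel_eq_im`, `re_kernelAmplitude_ge`), and its primitive from `t` to `π` is
`O((nt)^{α-1})` (`exists_cesaroKernel_bounds`).

Convergence. Cutting `[0, π]` into cells of length `π/n` and summing by parts writes `∫ ϕ K_n` as an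
average of functionals made of one point value and increments of `ϕ` with weights `O((i+1)^{α-1})`
(`integral_mul_cesaroKernel_eq`). In two variables this gives double sums of mixed differences with
weights `(i+1)^{α-1} (j+1)^{β-1}`. A mixed difference is a difference of two partial increments in
whichever variable is preferred, so partial variation is enough: sum first over the larger index.
With `λ_n = n^{1-(α+β)} / log^p (n+1)`, bounded `Λ`-variation makes the tail over `i ≥ k` at most a
constant times `(k+1)^{-β} / log^p (k+2)` (`exists_weight_mul_powLogSeq_le`), and the remaining sum
over the smaller index is dominated by `∑ 1 / (j log^p j)`, convergent for `p = 1 + ε`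
(`sum_sum_weight_le`). Indices above a cut-off `R` thus contribute little, uniformly in `f`, the
point and the orders; indices below `R` only see `f` near the point, where it is close to its
quadrant limit. The resulting estimate `exists_cesaroMean_estimate` gives both the pointwise and the
uniform statement.

Divergence. For `p = 1` that series is harmonic, and this is exploited. On each dyadic square of
side `2^k / 2^m` put a product of bumps oscillating in phase with the two kernels, with coefficient
`1 / (k 2^{k(α+β)})`. A line parallel to an axis meets at most one square, so the partial variations
are bounded uniformly in `m` (`exists_sum_wave_le`), while each square adds about `1/k` to the mean
of order `2^m` at the origin (`exists_integral_wave_ge`), so the means are unbounded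
(`exists_waveSum_cesaroMean_gt`). The uniform boundedness principle on `ℓ¹` turns the family into
one continuous function (`exists_superposition_divergent`). -/

lemma cesaroNumber_zero (a : ℝ) : cesaroNumber a 0 = 1 := by simp [cesaroNumber]

lemma cesaroNumber_succ (a : ℝ) (k : ℕ) :
    ((k : ℝ) + 1) * cesaroNumber a (k + 1) = (a + k + 1) * cesaroNumber a k := by
  have h1 : (k ! : ℝ) ≠ 0 := by positivity
  have h2 : (k : ℝ) + 1 ≠ 0 := by positivity
  simp only [cesaroNumber, Finset.prod_range_succ, Nat.factorial_succ]
  push_cast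
  field_simp
  ring

lemma cesaroNumber_succ_eq (a : ℝ) (k : ℕ) :
    cesaroNumber a (k + 1) = (a + k + 1) / (k + 1) * cesaroNumber a k := by
  have h2 : (k : ℝ) + 1 ≠ 0 := by positivity
  have := cesaroNumber_succ a k
  field_simp
  linarith

/-- Coefficient form of differentiating the generating function `∑ A_k^{a-1} z^k = (1 - z)^{-a}`. -/
lemma cesaroNumber_sub_one_succ (a : ℝ) (k : ℕ) :
    ((k : ℝ) + 1) * cesaroNumber (a - 1) (k + 1) = a * cesaroNumber a k := by
  induction k with
  | zero =>
    have := cesaroNumber_succ (a - 1) 0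
    simp only [cesaroNumber_zero] at this ⊢
    push_cast at *
    linarith
  | succ k ih =>
    have h2 : (k : ℝ) + 1 ≠ 0 := by positivity
    have h := cesaroNumber_succ (a - 1) (k + 1)
    have h' := cesaroNumber_succ a k
    apply mul_left_cancel₀ h2
    rw [h]
    push_cast at *
    linear_combination (a - 1 + (k + 1) + 1) * ih - a * h'

lemma cesaroNumber_sub_one_succ_eq (a : ℝ) (k : ℕ) :
    cesaroNumber (a - 1) (k + 1) = a / (k + 1) * cesaroNumber a k := by
  have h2 : (k : ℝ) + 1 ≠ 0 := by positivity
  have := cesaroNumber_sub_one_succ a k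
  field_simp
  linarith

lemma cesaroNumber_succ_sub (a : ℝ) (k : ℕ) :
    cesaroNumber a (k + 1) - cesaroNumber a k = cesaroNumber (a - 1) (k + 1) := by
  have h2 : (k : ℝ) + 1 ≠ 0 := by positivity
  have h1 := cesaroNumber_sub_one_succ a k
  have h3 := cesaroNumber_succ a k
  apply mul_left_cancel₀ h2
  linear_combination h3 - h1

lemma sum_cesaroNumber_sub_one (a : ℝ) (n : ℕ) :
    ∑ j ∈ Finset.range (n + 1), cesaroNumber (a - 1) j = cesaroNumber a n := by
  induction n with
  | zero => simp [cesaroNumber_zero]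
  | succ n ih => rw [Finset.sum_range_succ, ih, ← cesaroNumber_succ_sub]; ring

lemma sum_cesaroNumber (a : ℝ) (n : ℕ) :
    (a + 1) * ∑ j ∈ Finset.range n, cesaroNumber a j = n * cesaroNumber a n := by
  induction n with
  | zero => simp
  | succ n ih =>
    rw [Finset.sum_range_succ, mul_add, ih]
    push_cast
    linear_combination -(cesaroNumber_succ a n)

section Neg

variable {α : ℝ} (hα : α ∈ Ioo (0 : ℝ) 1)
include hα

lemma cesaroNumber_neg_pos (n : ℕ) : 0 < cesaroNumber (-α) n := by
  induction n with
  | zero => simp [cesaroNumber_zero]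
  | succ n ih =>
    rw [cesaroNumber_succ_eq]
    have : 0 < -α + n + 1 := by linarith [hα.2, (Nat.cast_nonneg n : (0 : ℝ) ≤ n)]
    positivity

lemma cesaroNumber_neg_le (n : ℕ) : cesaroNumber (-α) n ≤ ((n : ℝ) + 1) ^ (-α) := by
  induction n with
  | zero => simp [cesaroNumber_zero]
  | succ n ih =>
    rw [cesaroNumber_succ_eq]
    have hn : (0 : ℝ) ≤ n := Nat.cast_nonneg n
    have h0 : 0 < -α + n + 1 := by linarith [hα.2]
    have hq : (-α + n + 1) / (n + 1) ≤ (((n : ℝ) + 1 + 1) / (n + 1)) ^ (-α) := by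
      -- Bernoulli for a concave power, `(1 + x)^α ≤ 1 + αx` with `x = 1/(n+1)`; then `(1 - αx)(1 +
      -- αx) ≤ 1` bounds the ratio of consecutive Cesàro numbers.
      have hb := rpow_one_add_le_one_add_mul_self (s := 1 / ((n : ℝ) + 1)) (p := α)
        (by have : 0 < 1 / ((n : ℝ) + 1) := by positivity
            linarith) hα.1.le hα.2.le
      have e1 : ((n : ℝ) + 1 + 1) / (n + 1) = 1 + 1 / ((n : ℝ) + 1) := by field_simp
      rw [e1, Real.rpow_neg (by positivity)]
      rw [← one_div, le_div_iff₀ (by positivity)]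
      have e2 : (-α + n + 1) / (n + 1) = 1 - α * (1 / ((n : ℝ) + 1)) := by field_simp; ring
      have e3 : 0 ≤ (-α + n + 1) / ((n : ℝ) + 1) := by positivity
      rw [e2] at e3 ⊢
      have hα0 := hα.1
      calc _ ≤ (1 - α * (1 / ((n : ℝ) + 1))) * (1 + α * (1 / ((n : ℝ) + 1))) :=
            mul_le_mul_of_nonneg_left hb e3
        _ ≤ 1 := by nlinarith [sq_nonneg (α * (1 / ((n : ℝ) + 1)))]
    calc _ ≤ (((n : ℝ) + 1 + 1) / (n + 1)) ^ (-α) * ((n : ℝ) + 1) ^ (-α) := by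
          apply mul_le_mul hq ih (cesaroNumber_neg_pos hα n).le (by positivity)
      _ = _ := by
          rw [← Real.mul_rpow (by positivity) (by positivity)]
          push_cast
          congr 1
          field_simp

lemma le_cesaroNumber_neg (n : ℕ) :
    (1 - α) * ((n : ℝ) + 1) ^ (-α) ≤ cesaroNumber (-α) (n + 1) := by
  induction n with
  | zero => simp [cesaroNumber_succ_eq, cesaroNumber_zero]
  | succ n ih =>
    rw [cesaroNumber_succ_eq]
    have hn : (0 : ℝ) ≤ n := Nat.cast_nonneg n
    have h0 : 0 < -α + n + 1 := by linarith [hα.2]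
    have hq : (((n : ℝ) + 1 + 1) / (n + 1)) ^ (-α) ≤ (-α + (n + 1 : ℕ) + 1) / ((n + 1 : ℕ) + 1) := by
      have hb := rpow_one_add_le_one_add_mul_self (s := -(1 / ((n : ℝ) + 2))) (p := α)
        (by have : 1 / ((n : ℝ) + 2) ≤ 1 := by
              rw [div_le_one (by positivity)]; linarith
            linarith) hα.1.le hα.2.le
      rw [Real.rpow_neg (by positivity), ← Real.inv_rpow (by positivity)]
      push_cast
      convert hb using 2
      · field_simp; ring
      · field_simp; ring
    calc _ = (((n : ℝ) + 1 + 1) / (n + 1)) ^ (-α) * ((1 - α) * ((n : ℝ) + 1) ^ (-α)) := by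
          rw [mul_left_comm, ← Real.mul_rpow (by positivity) (by positivity)]
          push_cast
          congr 2
          field_simp
      _ ≤ _ := by
          apply mul_le_mul hq ih
          · have := hα.2
            have : 0 ≤ 1 - α := by linarith
            positivity
          · exact (Real.rpow_nonneg (by positivity) _).trans hq

lemma cesaroNumber_neg_sub_one_succ_neg (j : ℕ) : cesaroNumber (-α - 1) (j + 1) < 0 := by
  rw [cesaroNumber_sub_one_succ_eq]
  have := cesaroNumber_neg_pos hα j
  have h : 0 < α / (j + 1) * cesaroNumber (-α) j := by
    have := hα.1
    positivity
  rw [neg_div]; linarith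

/-- Only the term `j = 0` is positive, so the sum of absolute values telescopes to `2 - A_n^{-α}`.
-/
lemma sum_abs_cesaroNumber_neg_sub_one (n : ℕ) :
    ∑ j ∈ Finset.range (n + 1), |cesaroNumber (-α - 1) j| ≤ 2 := by
  have h : ∑ j ∈ Finset.range (n + 1), |cesaroNumber (-α - 1) j| = 2 - cesaroNumber (-α) n := by
    induction n with
    | zero => simp [cesaroNumber_zero]; norm_num
    | succ n ih =>
      rw [Finset.sum_range_succ, ih, abs_of_neg (cesaroNumber_neg_sub_one_succ_neg hα n),
        ← cesaroNumber_succ_sub]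
      ring
  rw [h]; linarith [cesaroNumber_neg_pos hα n]

/-- After the leading `1` the coefficients are negative and increasing, so each odd-even pair
contributes a nonnegative amount. This keeps the amplitude of the kernel away from zero at `π`. -/
lemma one_le_alternating_sum (n : ℕ) :
    1 ≤ ∑ j ∈ Finset.range (n + 1), cesaroNumber (-α - 1) j * (-1) ^ j := by
  have step (k : ℕ) : cesaroNumber (-α - 1) (k + 1) ≤ cesaroNumber (-α - 1) (k + 2) := by
    have h := cesaroNumber_neg_sub_one_succ_neg hα k
    rw [cesaroNumber_succ_eq _ (k + 1)]
    have h1 : (-α - 1 + ((k + 1 : ℕ) : ℝ) + 1) / ((k + 1 : ℕ) + 1) ≤ 1 := by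
      push_cast
      rw [div_le_one (by positivity)]; linarith [hα.1]
    nlinarith
  have key (k : ℕ) : 1 ≤ ∑ j ∈ Finset.range (2 * k + 1), cesaroNumber (-α - 1) j * (-1) ^ j := by
    induction k with
    | zero => simp [cesaroNumber_zero]
    | succ k ih =>
      rw [show 2 * (k + 1) + 1 = (2 * k + 1) + 1 + 1 by ring, Finset.sum_range_succ,
        Finset.sum_range_succ]
      have := step (2 * k)
      have e1 : (-1 : ℝ) ^ (2 * k + 1) = -1 := by rw [pow_succ, pow_mul]; simp
      have e2 : (-1 : ℝ) ^ (2 * k + 1 + 1) = 1 := by rw [pow_succ, e1]; simp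
      rw [e1, e2]
      linarith
  rcases Nat.even_or_odd' n with ⟨k, rfl | rfl⟩
  · exact key k
  · rw [Finset.sum_range_succ]
    have e1 : (-1 : ℝ) ^ (2 * k + 1) = -1 := by rw [pow_succ, pow_mul]; simp
    have := key k
    have := cesaroNumber_neg_sub_one_succ_neg hα (2 * k)
    rw [e1]
    linarith

end Neg

/-! ### The one-dimensional Cesàro kernel -/

/-- The Dirichlet kernel `1 / 2 + ∑_{k = 1}^n cos kt`. -/
def dirichletKernel (n : ℕ) (t : ℝ) : ℝ :=
  1 / 2 + ∑ k ∈ Finset.range n, Real.cos ((k + 1) * t)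

/-- The kernel of the `(C; a)` means. -/
def cesaroKernel (a : ℝ) (n : ℕ) (t : ℝ) : ℝ :=
  (∑ i ∈ Finset.range (n + 1), cesaroNumber (a - 1) (n - i) * dirichletKernel i t) /
    cesaroNumber a n

lemma dirichletKernel_neg (n : ℕ) (t : ℝ) : dirichletKernel n (-t) = dirichletKernel n t := by
  simp [dirichletKernel, Real.cos_neg]

lemma cesaroKernel_neg (a : ℝ) (n : ℕ) (t : ℝ) : cesaroKernel a n (-t) = cesaroKernel a n t := by
  simp [cesaroKernel, dirichletKernel_neg]

lemma dirichletKernel_periodic (n : ℕ) : Function.Periodic (dirichletKernel n) (2 * Real.pi) := by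
  intro t
  simp only [dirichletKernel]
  congr 1
  refine Finset.sum_congr rfl fun k _ => ?_
  have := Real.cos_add_nat_mul_two_pi ((k + 1) * t) (k + 1)
  rw [← this]; push_cast; ring_nf

lemma cesaroKernel_periodic (a : ℝ) (n : ℕ) :
    Function.Periodic (cesaroKernel a n) (2 * Real.pi) := by
  intro t
  simp only [cesaroKernel, dirichletKernel_periodic _ t]

@[fun_prop]
lemma continuous_dirichletKernel (n : ℕ) : Continuous (dirichletKernel n) := by
  unfold dirichletKernel; fun_prop

@[fun_prop]
lemma continuous_cesaroKernel (a : ℝ) (n : ℕ) : Continuous (cesaroKernel a n) := by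
  unfold cesaroKernel; fun_prop

lemma integral_dirichletKernel (n : ℕ) : ∫ t in (0 : ℝ)..Real.pi, dirichletKernel n t = Real.pi / 2 := by
  simp only [dirichletKernel]
  rw [intervalIntegral.integral_add (by simp) (by apply Continuous.intervalIntegrable; fun_prop),
    intervalIntegral.integral_finsetSum
      (fun i _ => by apply Continuous.intervalIntegrable; fun_prop)]
  rw [Finset.sum_eq_zero]
  · simp; ring
  · intro k _
    have hk : (k : ℝ) + 1 ≠ 0 := by positivity
    rw [intervalIntegral.integral_comp_mul_left (fun t => Real.cos t) hk, integral_cos]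
    have := Real.sin_nat_mul_pi (k + 1)
    push_cast at this
    simp [this]

lemma sum_cesaroNumber_sub_one_reflect (a : ℝ) (n : ℕ) :
    ∑ i ∈ Finset.range (n + 1), cesaroNumber (a - 1) (n - i) = cesaroNumber a n := by
  rw [← sum_cesaroNumber_sub_one]
  exact Finset.sum_range_reflect (fun j => cesaroNumber (a - 1) j) (n + 1)

lemma sum_mul_dirichletKernel (a : ℝ) (n : ℕ) (t : ℝ) :
    ∑ i ∈ Finset.range (n + 1), cesaroNumber (a - 1) (n - i) * dirichletKernel i t =
      cesaroNumber a n / 2 + ∑ k ∈ Finset.range n, cesaroNumber a (n - 1 - k) * Real.cos ((k + 1) * t) := by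
  have h1 := sum_cesaroNumber_sub_one_reflect a
  simp only [dirichletKernel, mul_add, Finset.sum_add_distrib, ← Finset.sum_mul, h1, Finset.mul_sum]
  congr 1
  · ring
  have : ∑ i ∈ Finset.range (n + 1), ∑ k ∈ Finset.range i,
      cesaroNumber (a - 1) (n - i) * Real.cos ((k + 1) * t) =
      ∑ k ∈ Finset.range n, ∑ i ∈ Finset.Ico (k + 1) (n + 1),
        cesaroNumber (a - 1) (n - i) * Real.cos ((k + 1) * t) := by
    refine Finset.sum_comm' fun i k => ?_
    simp only [Finset.mem_range, Finset.mem_Ico]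
    omega
  rw [this]
  refine Finset.sum_congr rfl fun k hk => ?_
  rw [← Finset.sum_mul, ← h1 (n - 1 - k), Finset.sum_Ico_eq_sum_range]
  have hk := Finset.mem_range.1 hk
  congr 1
  refine Finset.sum_congr ?_ fun i hi => ?_
  · congr 1; omega
  · congr 1; omega

lemma integral_cesaroKernel {a : ℝ} {n : ℕ} (h : cesaroNumber a n ≠ 0) :
    ∫ t in (0 : ℝ)..Real.pi, cesaroKernel a n t = Real.pi / 2 := by
  simp only [cesaroKernel]
  rw [intervalIntegral.integral_div, intervalIntegral.integral_finsetSum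
      (fun i _ => by apply Continuous.intervalIntegrable; fun_prop)]
  simp only [intervalIntegral.integral_const_mul, integral_dirichletKernel, ← Finset.sum_mul]
  rw [sum_cesaroNumber_sub_one_reflect]; field_simp

/-- The cosine coefficients are the positive numbers `A_j^{-α}`, so the cosines may be replaced by
`1`; the sum of the coefficients is explicit by `sum_cesaroNumber`. -/
lemma abs_cesaroKernel_le {α : ℝ} (hα : α ∈ Ioo (0 : ℝ) 1) (n : ℕ) (t : ℝ) :
    |cesaroKernel (-α) n t| ≤ (n + 1) / (1 - α) := by
  have hA := cesaroNumber_neg_pos hα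
  have h1α : 0 < 1 - α := by linarith [hα.2]
  rw [cesaroKernel, sum_mul_dirichletKernel, abs_div, abs_of_pos (hA n), div_le_iff₀ (hA n)]
  have hs := sum_cesaroNumber (-α) (n + 1)
  have hs' : (n + 1) / (1 - α) * cesaroNumber (-α) n ≥ ∑ j ∈ Finset.range (n + 1), cesaroNumber (-α) j := by
    rw [div_mul_eq_mul_div, ge_iff_le, le_div_iff₀ h1α, mul_comm, show 1 - α = -α + 1 by ring, hs]
    push_cast
    rw [cesaroNumber_succ]
    nlinarith [hA n, hα.1]
  refine le_trans ?_ hs'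
  rw [Finset.sum_range_succ, add_comm]
  refine (abs_add_le _ _).trans (add_le_add ?_ ?_)
  swap
  · rw [abs_of_pos (by linarith [hA n])]; linarith [hA n]
  rw [← Finset.sum_range_reflect]
  refine (Finset.abs_sum_le_sum_abs _ _).trans (Finset.sum_le_sum fun k hk => ?_)
  have : |Real.cos ((((n - 1 - k : ℕ) : ℝ) + 1) * t)| ≤ 1 := Real.abs_cos_le_one _
  have e : n - 1 - (n - 1 - k) = k := by have := Finset.mem_range.1 hk; omega
  rw [abs_mul, e, abs_of_pos (hA k)]
  nlinarith [hA k]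

lemma two_sin_mul_dirichletKernel (n : ℕ) (t : ℝ) :
    2 * Real.sin (t / 2) * dirichletKernel n t = Real.sin ((n + 1 / 2) * t) := by
  induction n with
  | zero => simp [dirichletKernel]; ring_nf
  | succ n ih =>
    have : dirichletKernel (n + 1) t = dirichletKernel n t + Real.cos ((n + 1) * t) := by
      simp [dirichletKernel, Finset.sum_range_succ]; ring
    rw [this, mul_add, ih]
    have e1 : (((n + 1 : ℕ) : ℝ) + 1 / 2) * t = (n + 1) * t + t / 2 := by push_cast; ring
    have e2 : ((n : ℝ) + 1 / 2) * t = (n + 1) * t - t / 2 := by ring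
    rw [e1, e2, Real.sin_add, Real.sin_sub]
    ring

/-- The trigonometric polynomial `∑_{j ≤ n} A_j^{-α-1} e^{-iju}`. -/
def cesaroPoly (α : ℝ) (n : ℕ) (u : ℝ) : ℂ :=
  ∑ j ∈ Finset.range (n + 1), (cesaroNumber (-α - 1) j : ℂ) * Complex.exp (-(j * u * Complex.I))

lemma two_sin_mul_cesaroKernel (α : ℝ) (n : ℕ) (t : ℝ) :
    2 * Real.sin (t / 2) * cesaroKernel (-α) n t =
      (Complex.exp ((n + 1 / 2 : ℝ) * t * Complex.I) * cesaroPoly α n t).im / cesaroNumber (-α) n := by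
  rw [cesaroKernel, mul_div_assoc']
  congr 1
  rw [cesaroPoly, Finset.mul_sum, Finset.mul_sum, ← Finset.sum_range_reflect, Complex.im_sum]
  refine Finset.sum_congr rfl fun j hj => ?_
  have hj : j ≤ n := by have := Finset.mem_range.1 hj; omega
  rw [show n + 1 - 1 - j = n - j by omega, show n - (n - j) = j by omega, mul_left_comm,
    two_sin_mul_dirichletKernel, mul_left_comm, ← Complex.exp_add, Complex.im_ofReal_mul]
  congr 1
  have e : ((n + 1 / 2 : ℝ) : ℂ) * t * Complex.I + -(j * t * Complex.I) =
      (((((n - j : ℕ) : ℝ) + 1 / 2) * t : ℝ) : ℂ) * Complex.I := by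
    push_cast [Nat.cast_sub hj]; ring
  rw [e, Complex.exp_ofReal_mul_I_im]

lemma norm_cesaroPoly_pi {α : ℝ} (hα : α ∈ Ioo (0 : ℝ) 1) (n : ℕ) :
    ∃ r : ℝ, 1 ≤ r ∧ r ≤ 2 ∧ cesaroPoly α n Real.pi = r := by
  refine ⟨_, one_le_alternating_sum hα n, ?_, ?_⟩
  · refine (le_abs_self _).trans ((Finset.abs_sum_le_sum_abs _ _).trans ?_)
    simpa [abs_mul] using sum_abs_cesaroNumber_neg_sub_one hα n
  · rw [cesaroPoly]
    push_cast
    refine Finset.sum_congr rfl fun j _ => ?_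
    congr 1
    have : -((j : ℂ) * Real.pi * Complex.I) = j * (-(Real.pi * Complex.I)) := by ring
    rw [this, Complex.exp_nat_mul, Complex.exp_neg, Complex.exp_pi_mul_I]
    norm_num

/-- Truncation of `(1 - z) (1 - z)^{α-1} = (1 - z)^α`; the truncation error is the single term
`A_n^{-α} z^n`. -/
lemma one_sub_mul_sum_cesaroNumber (α : ℝ) (n : ℕ) (z : ℂ) :
    (1 - z) * ∑ j ∈ Finset.range n, (cesaroNumber (-α) j : ℂ) * z ^ j =
      ∑ j ∈ Finset.range (n + 1), (cesaroNumber (-α - 1) j : ℂ) * z ^ j - cesaroNumber (-α) n * z ^ n := by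
  induction n with
  | zero => simp [cesaroNumber_zero]
  | succ n ih =>
    rw [Finset.sum_range_succ, mul_add, ih, Finset.sum_range_succ _ (n + 1), ← cesaroNumber_succ_sub]
    push_cast
    ring

lemma exp_neg_mul_I_pow (j : ℕ) (u : ℝ) :
    Complex.exp (-(j * u * Complex.I)) = Complex.exp (-(u * Complex.I)) ^ j := by
  rw [← Complex.exp_nat_mul]; ring_nf

lemma hasDerivAt_cesaroPoly (α : ℝ) (n : ℕ) (u : ℝ) :
    HasDerivAt (cesaroPoly α n) (Complex.I * α * (Complex.exp (-(u * Complex.I)) *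
      ∑ j ∈ Finset.range n, (cesaroNumber (-α) j : ℂ) * Complex.exp (-(u * Complex.I)) ^ j)) u := by
  have h : ∀ j ∈ Finset.range (n + 1), HasDerivAt (fun u : ℝ => (cesaroNumber (-α - 1) j : ℂ) *
      Complex.exp (-(j * u * Complex.I))) ((cesaroNumber (-α - 1) j : ℂ) *
      (Complex.exp (-(j * u * Complex.I)) * (-(j * 1 * Complex.I)))) u := by
    intro j _
    have h1 : HasDerivAt (fun u : ℝ => (u : ℂ)) 1 u := Complex.ofRealCLM.hasDerivAt
    exact (((h1.const_mul (j : ℂ)).mul_const Complex.I).neg.cexp).const_mul _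
  have h2 := HasDerivAt.fun_sum h
  refine h2.congr_deriv ?_
  rw [Finset.sum_range_succ']
  simp only [Nat.cast_zero, zero_mul, neg_zero, mul_zero, add_zero, mul_one]
  rw [Finset.mul_sum, Finset.mul_sum]
  refine Finset.sum_congr rfl fun j _ => ?_
  rw [exp_neg_mul_I_pow (j + 1), cesaroNumber_sub_one_succ_eq]
  have : (j : ℂ) + 1 ≠ 0 := by exact_mod_cast Nat.succ_ne_zero j
  push_cast
  field_simp
  ring

/-! ### Amplitude and phase of the kernel -/

/-- Working with a decreasing majorant `B` avoids any integrability question for `F'`. -/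
lemma norm_sub_le_of_hasDerivAt_bound {F F' : ℝ → ℂ} {B B' : ℝ → ℝ} {t T : ℝ} (htT : t ≤ T)
    (hF : ∀ x ∈ Icc t T, HasDerivAt F (F' x) x) (hB : ∀ x ∈ Icc t T, HasDerivAt B (B' x) x)
    (h : ∀ x ∈ Icc t T, ‖F' x‖ ≤ -B' x) : ‖F T - F t‖ ≤ B t - B T := by
  have := image_norm_le_of_norm_deriv_right_le_deriv_boundary' (a := t) (b := T)
    (f := fun x => F x - F t) (f' := F') (B := fun x => B t - B x) (B' := fun x => - B' x)
    (fun x hx => ((hF x hx).continuousAt.sub continuousAt_const).continuousWithinAt)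
    (fun x hx => ((hF x (Ico_subset_Icc_self hx)).sub_const _).hasDerivWithinAt) (by simp)
    (fun x hx => (continuousAt_const.sub (hB x hx).continuousAt).continuousWithinAt)
    (fun x hx => ((hB x (Ico_subset_Icc_self hx)).const_sub _).hasDerivWithinAt)
    (fun x hx => h x (Ico_subset_Icc_self hx))
  exact this (right_mem_Icc.2 htT)

/-- Integration by parts for an oscillatory integral, with the variation of the amplitude
controlled by a decreasing majorant. -/
lemma norm_integral_exp_mul_le {S S' : ℝ → ℂ} {B B' : ℝ → ℝ} {t T M γ : ℝ} (hM : 0 < M)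
    (htT : t ≤ T) (hS : ∀ x ∈ Icc t T, HasDerivAt S (S' x) x)
    (hB : ∀ x ∈ Icc t T, HasDerivAt B (B' x) x) (h : ∀ x ∈ Icc t T, ‖S' x‖ ≤ -B' x) :
    ‖∫ x in t..T, Complex.exp ((M * x + γ : ℝ) * Complex.I) * S x‖ ≤
      (‖S t‖ + ‖S T‖ + (B t - B T)) / M := by
  set G : ℝ → ℂ := fun x => Complex.exp ((M * x + γ : ℝ) * Complex.I) * S x with hG
  set E : ℝ → ℂ := fun x => Complex.exp ((M * x + γ : ℝ) * Complex.I) / (M * Complex.I) with hE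
  have hMI : (M : ℂ) * Complex.I ≠ 0 := by simp [hM.ne']
  have hEn (x : ℝ) : ‖E x‖ = 1 / M := by
    rw [hE]; simp only [norm_div, Complex.norm_exp_ofReal_mul_I]
    simp [abs_of_pos hM]
  have hEd (x : ℝ) : HasDerivAt E (Complex.exp ((M * x + γ : ℝ) * Complex.I)) x := by
    have h1 : HasDerivAt (fun x : ℝ => ((M * x + γ : ℝ) : ℂ)) (M * 1 : ℝ) x :=
      (((hasDerivAt_id x).const_mul M).add_const γ).ofReal_comp
    have h2 := ((h1.mul_const Complex.I).cexp).div_const (M * Complex.I)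
    refine h2.congr_deriv ?_
    push_cast
    rw [mul_one]
    exact mul_div_cancel_right₀ _ hMI
  have hcS : ContinuousOn S (Icc t T) := fun x hx => (hS x hx).continuousAt.continuousWithinAt
  have hcG : ContinuousOn G (Icc t T) := by
    apply ContinuousOn.mul _ hcS
    apply Continuous.continuousOn; fun_prop
  rcases htT.eq_or_lt with rfl | hlt
  · simp; positivity
  set H : ℝ → ℂ := fun x => (∫ y in t..x, G y) - E x * S x with hH
  have hint : ∀ x ∈ Icc t T, IntervalIntegrable G volume t x := fun x hx =>
    (hcG.mono (by rw [uIcc_of_le hx.1]; exact Icc_subset_Icc_right hx.2)).intervalIntegrable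
  have hcH : ContinuousOn H (Icc t T) := by
    apply ContinuousOn.sub
    · have := intervalIntegral.continuousOn_primitive_interval (μ := volume) (f := G) (a := t) (b := T)
        (by rw [uIcc_of_le htT]; exact hcG.integrableOn_Icc)
      rwa [uIcc_of_le htT] at this
    · exact ContinuousOn.mul (fun x _ => (hEd x).continuousAt.continuousWithinAt) hcS
  have hdH : ∀ x ∈ Ico t T, HasDerivWithinAt H (-(E x * S' x)) (Ici x) x := by
    intro x hx
    have hx' := Ico_subset_Icc_self hx
    have hmem : Icc t T ∈ 𝓝[>] x := by
      filter_upwards [Ioc_mem_nhdsGT hx.2] with y hy using ⟨hx.1.trans hy.1.le, hy.2⟩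
    have h1 : HasDerivWithinAt (fun x => ∫ y in t..x, G y) (G x) (Ici x) x := by
      apply intervalIntegral.integral_hasDerivWithinAt_right (hint x hx') (s := Ici x) (t := Ioi x)
      · exact (hcG.stronglyMeasurableAtFilter_nhdsWithin measurableSet_Icc x).filter_mono
          (by rw [nhdsWithin_le_iff]; exact hmem)
      · exact (hcG x hx').mono_of_mem_nhdsWithin hmem
    have h2 := h1.sub (((hEd x).mul (hS x hx')).hasDerivWithinAt (s := Ici x))
    refine h2.congr_deriv ?_
    simp only [hG]; ring
  have key := image_norm_le_of_norm_deriv_right_le_deriv_boundary' (a := t) (b := T)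
    (f := fun x => H x - H t) (f' := fun x => -(E x * S' x)) (B := fun x => (B t - B x) / M)
    (B' := fun x => (- B' x) / M)
    (hcH.sub continuousOn_const) (fun x hx => (hdH x hx).sub_const _) (by simp)
    (fun x hx => ((continuousAt_const.sub (hB x hx).continuousAt).div_const M).continuousWithinAt)
    (fun x hx => (((hB x (Ico_subset_Icc_self hx)).const_sub _).div_const M).hasDerivWithinAt)
    (fun x hx => by
      rw [norm_neg, norm_mul, hEn, one_div_mul_eq_div]
      exact div_le_div_of_nonneg_right (h x (Ico_subset_Icc_self hx)) hM.le)
    (right_mem_Icc.2 htT)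
  have hval : ∫ y in t..T, G y = (H T - H t) + E T * S T - E t * S t := by
    simp only [hH, intervalIntegral.integral_same]; ring
  rw [hval]
  calc _ ≤ ‖H T - H t‖ + ‖E T * S T‖ + ‖E t * S t‖ :=
        (norm_sub_le _ _).trans (add_le_add (norm_add_le _ _) le_rfl)
    _ ≤ (B t - B T) / M + 1 / M * ‖S T‖ + 1 / M * ‖S t‖ := by
        rw [norm_mul, norm_mul, hEn, hEn]; gcongr
    _ = _ := by ring

lemma two_sin_half_bounds {u : ℝ} (hu : u ∈ Ioc 0 Real.pi) :
    2 / Real.pi * u ≤ 2 * Real.sin (u / 2) ∧ 2 * Real.sin (u / 2) ≤ u ∧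
      0 < 2 * Real.sin (u / 2) := by
  have h1 := Real.mul_le_sin (x := u / 2) (by linarith [hu.1]) (by linarith [hu.2])
  have h2 := Real.sin_le (x := u / 2) (by linarith [hu.1])
  have h3 : 0 < 2 / Real.pi * u := by have := hu.1; positivity
  refine ⟨by linarith, by linarith, by linarith⟩

/-- The chord bound for the sine costs a factor `(π/2)^q ≤ (π/2)^2 < 3`. -/
lemma two_sin_half_rpow_le {u q : ℝ} (hu : u ∈ Ioc 0 Real.pi) (hq0 : 0 ≤ q) (hq2 : q ≤ 2) :
    (2 * Real.sin (u / 2)) ^ (-q) ≤ 3 * u ^ (-q) := by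
  obtain ⟨h1, h2, h3⟩ := two_sin_half_bounds hu
  have hu0 := hu.1
  have hpi := Real.pi_pos
  calc _ ≤ (2 / Real.pi * u) ^ (-q) :=
        Real.rpow_le_rpow_of_nonpos (by positivity) h1 (by linarith)
    _ = (Real.pi / 2) ^ q * u ^ (-q) := by
        rw [Real.mul_rpow (by positivity) hu0.le, Real.rpow_neg (by positivity),
          ← Real.inv_rpow (by positivity), inv_div]
    _ ≤ 3 * u ^ (-q) := by
        gcongr
        calc _ ≤ (Real.pi / 2) ^ (2 : ℝ) :=
              Real.rpow_le_rpow_of_exponent_le (by linarith [Real.pi_gt_three]) hq2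
          _ ≤ 3 := by
              rw [Real.rpow_two]; nlinarith [Real.pi_lt_d2, Real.pi_gt_three]

/-- The modulating factor: `cesaroPoly` divided by the boundary value of `(1 - z)^α`. -/
def kernelModulation (α : ℝ) (n : ℕ) (u : ℝ) : ℂ :=
  cesaroPoly α n u * Complex.exp (-((α * (Real.pi - u) / 2 : ℝ) * Complex.I)) *
    ((2 * Real.sin (u / 2)) ^ (-α) : ℝ)

/-- The amplitude of the Cesàro kernel with respect to the linear phase `kernelPhase`. -/
def kernelAmplitude (α : ℝ) (n : ℕ) (u : ℝ) : ℂ :=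
  kernelModulation α n u * ((2 * Real.sin (u / 2)) ^ (α - 1) : ℝ)

/-- The frequency of the Cesàro kernel. -/
def kernelFreq (α : ℝ) (n : ℕ) : ℝ := n + 1 / 2 - α / 2

/-- The linear phase of the Cesàro kernel. -/
def kernelPhase (α : ℝ) (n : ℕ) (u : ℝ) : ℝ := kernelFreq α n * u + α * Real.pi / 2

/-- The argument `α(π - u)/2` of `(1 - z)^α` is linear in `u`; absorbing it into `e^{i(n+1/2)u}`
shifts the frequency by `-α/2` and adds the constant phase `απ/2`. -/
lemma cesaroKernel_eq_im {α : ℝ} (n : ℕ) {u : ℝ} (hu : u ∈ Ioc 0 Real.pi) :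
    cesaroKernel (-α) n u =
      (Complex.exp (kernelPhase α n u * Complex.I) * kernelAmplitude α n u).im /
        cesaroNumber (-α) n := by
  obtain ⟨h1, h2, h3⟩ := two_sin_half_bounds hu
  have h := two_sin_mul_cesaroKernel α n u
  have hr : (2 * Real.sin (u / 2)) ^ (-α) * (2 * Real.sin (u / 2)) ^ (α - 1) =
      (2 * Real.sin (u / 2))⁻¹ := by
    rw [← Real.rpow_add h3, show -α + (α - 1) = -1 by ring, Real.rpow_neg_one]
  have e : Complex.exp (kernelPhase α n u * Complex.I) * kernelAmplitude α n u =
      ((2 * Real.sin (u / 2))⁻¹ : ℝ) *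
        (Complex.exp ((n + 1 / 2 : ℝ) * u * Complex.I) * cesaroPoly α n u) := by
    rw [← hr, kernelAmplitude, kernelModulation]
    have : Complex.exp ((n + 1 / 2 : ℝ) * u * Complex.I) =
        Complex.exp (kernelPhase α n u * Complex.I) *
          Complex.exp (-((α * (Real.pi - u) / 2 : ℝ) * Complex.I)) := by
      rw [← Complex.exp_add, kernelPhase, kernelFreq]
      push_cast
      ring_nf
    rw [this]
    push_cast
    ring
  rw [e, Complex.im_ofReal_mul, mul_div_assoc, ← h, inv_mul_cancel_left₀ h3.ne']

/-- `cesaroPoly` satisfies the differential equation of `(1 - z)^α` up to the boundary term of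
`one_sub_mul_sum_cesaroNumber`, so in the quotient only that term survives. -/
lemma hasDerivAt_kernelModulation {α : ℝ} (n : ℕ) {u : ℝ} (hu : u ∈ Ioc 0 Real.pi) :
    HasDerivAt (kernelModulation α n) (-(α * cesaroNumber (-α) n *
      (2 * Real.sin (u / 2)) ^ (-α - 1) : ℝ) *
      (Complex.exp (-((α * (Real.pi - u) / 2 : ℝ) * Complex.I)) *
        Complex.exp (-((u / 2 : ℝ) * Complex.I)) * Complex.exp (-(u * Complex.I)) ^ n)) u := by
  obtain ⟨h1, h2, h3⟩ := two_sin_half_bounds hu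
  have hP := hasDerivAt_cesaroPoly α n u
  have hB := one_sub_mul_sum_cesaroNumber α n (Complex.exp (-(u * Complex.I)))
  simp only [← exp_neg_mul_I_pow] at hB
  rw [← cesaroPoly] at hB
  simp only [exp_neg_mul_I_pow] at hB
  set B := ∑ j ∈ Finset.range n, (cesaroNumber (-α) j : ℂ) * Complex.exp (-(u * Complex.I)) ^ j
  have hE : HasDerivAt (fun u : ℝ => Complex.exp (-((α * (Real.pi - u) / 2 : ℝ) * Complex.I)))
      (Complex.exp (-((α * (Real.pi - u) / 2 : ℝ) * Complex.I)) *
        (-((α * (-1) / 2 : ℝ) * Complex.I))) u := by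
    have h1 : HasDerivAt (fun u : ℝ => ((α * (Real.pi - u) / 2 : ℝ) : ℂ)) (α * (-1) / 2 : ℝ) u :=
      ((((hasDerivAt_id u).const_sub Real.pi).const_mul α).div_const 2).ofReal_comp
    exact (h1.mul_const Complex.I).neg.cexp
  have hσ : HasDerivAt (fun u : ℝ => 2 * Real.sin (u / 2)) (Real.cos (u / 2)) u := by
    have h1 : HasDerivAt (fun u : ℝ => u / 2) (1 / 2) u := (hasDerivAt_id u).div_const 2
    refine ((h1.sin).const_mul 2).congr_deriv ?_
    ring
  have hr : HasDerivAt (fun u : ℝ => (((2 * Real.sin (u / 2)) ^ (-α) : ℝ) : ℂ))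
      (Real.cos (u / 2) * (-α) * (2 * Real.sin (u / 2)) ^ (-α - 1) : ℝ) u :=
    (hσ.rpow_const (Or.inl h3.ne')).ofReal_comp
  refine ((hP.mul hE).mul hr).congr_deriv ?_
  simp only [Pi.mul_apply]
  have hrr : (2 * Real.sin (u / 2)) ^ (-α) =
      (2 * Real.sin (u / 2)) * (2 * Real.sin (u / 2)) ^ (-α - 1) := by
    rw [Real.rpow_sub_one h3.ne', mul_div_cancel₀ _ h3.ne']
  rw [hrr]
  have hhalf : Complex.exp (-((u / 2 : ℝ) * Complex.I)) =
      Real.cos (u / 2) - Real.sin (u / 2) * Complex.I := by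
    rw [← neg_mul, ← Complex.ofReal_neg, Complex.exp_mul_I, ← Complex.ofReal_cos, ← Complex.ofReal_sin]
    simp [Real.cos_neg, Real.sin_neg]; ring
  have hz : Complex.exp (-(u * Complex.I)) = Complex.exp (-((u / 2 : ℝ) * Complex.I)) ^ 2 := by
    rw [← Complex.exp_nat_mul]; push_cast; ring_nf
  set z := Complex.exp (-(u * Complex.I))
  set E := Complex.exp (-((α * (Real.pi - u) / 2 : ℝ) * Complex.I))
  set ρ := (2 * Real.sin (u / 2)) ^ (-α - 1)
  set c := Real.cos (u / 2)
  set s := Real.sin (u / 2)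
  have hcs : (c : ℂ) ^ 2 + (s : ℂ) ^ 2 = 1 := by exact_mod_cast Real.cos_sq_add_sin_sq (u / 2)
  have hI := Complex.I_sq
  set P := cesaroPoly α n u
  -- This rests on `1 - z = 2i sin(u/2) e^{-iu/2}`, with `e^{-iu/2} = c - si`.
  have hB' : 2 * s * (z * B) * Complex.I = (c - s * Complex.I) * (P - cesaroNumber (-α) n * z ^ n) := by
    rw [← hB]
    rw [hz, hhalf]
    have e : 1 - (c - s * Complex.I) ^ 2 = 2 * s * Complex.I * (c - s * Complex.I) := by
      linear_combination -hcs + (s : ℂ)^2 * hI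
    rw [e]; ring
  rw [hhalf]
  push_cast
  linear_combination α * E * ρ * hB'

section KernelBounds

variable {α : ℝ} (hα : α ∈ Ioo (0 : ℝ) 1)
include hα

lemma kernelFreq_ge (n : ℕ) : (n : ℝ) ≤ kernelFreq α n := by
  rw [kernelFreq]; linarith [hα.2]

lemma cesaroNumber_neg_mul_rpow_le (n : ℕ) {u : ℝ} (hu : 0 < u) :
    cesaroNumber (-α) n * u ^ (-α) ≤ (((n : ℝ) + 1) * u) ^ (-α) := by
  rw [Real.mul_rpow (by positivity) hu.le]
  exact mul_le_mul_of_nonneg_right (cesaroNumber_neg_le hα n) (by positivity)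

lemma cesaroNumber_neg_mul_rpow_le_one (n : ℕ) {u : ℝ} (hu : 0 < u) (hn : 1 ≤ ((n : ℝ) + 1) * u) :
    cesaroNumber (-α) n * u ^ (-α) ≤ 1 :=
  (cesaroNumber_neg_mul_rpow_le hα n hu).trans
    (Real.rpow_le_one_of_one_le_of_nonpos hn (by linarith [hα.1]))

lemma norm_deriv_kernelModulation_le (n : ℕ) {u : ℝ} (hu : u ∈ Ioc 0 Real.pi) :
    ‖deriv (kernelModulation α n) u‖ ≤ 3 * α * cesaroNumber (-α) n * u ^ (-α - 1) := by
  have h3 := (two_sin_half_bounds hu).2.2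
  have hA := (cesaroNumber_neg_pos hα n).le
  have hα0 := hα.1
  rw [(hasDerivAt_kernelModulation n hu).deriv, norm_mul, norm_mul, norm_mul, norm_pow,
    ← neg_mul, ← neg_mul, ← neg_mul, ← Complex.ofReal_neg, ← Complex.ofReal_neg,
    ← Complex.ofReal_neg, ← Complex.ofReal_neg, Complex.norm_exp_ofReal_mul_I, Complex.norm_exp_ofReal_mul_I,
    Complex.norm_exp_ofReal_mul_I, Complex.norm_real, Real.norm_eq_abs, abs_neg,
    abs_of_nonneg (by positivity)]
  have := two_sin_half_rpow_le (q := α + 1) hu (by linarith) (by linarith [hα.2])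
  rw [show -(α + 1) = -α - 1 by ring] at this
  calc _ = α * cesaroNumber (-α) n * (2 * Real.sin (u / 2)) ^ (-α - 1) := by simp
    _ ≤ α * cesaroNumber (-α) n * (3 * u ^ (-α - 1)) := by gcongr
    _ = _ := by ring

/-- The derivative bound `3 α A_n u^{-α-1}` is minus the derivative of `3 A_n u^{-α}`, and `A_n ≤
(n+1)^{-α}`. -/
lemma norm_kernelModulation_sub_le (n : ℕ) {u : ℝ} (hu : u ∈ Ioc 0 Real.pi) :
    ‖kernelModulation α n Real.pi - kernelModulation α n u‖ ≤
      3 * (((n : ℝ) + 1) * u) ^ (-α) := by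
  have hA := (cesaroNumber_neg_pos hα n).le
  have hsub : ∀ x ∈ Icc u Real.pi, x ∈ Ioc 0 Real.pi := fun x hx => ⟨hu.1.trans_le hx.1, hx.2⟩
  have := norm_sub_le_of_hasDerivAt_bound (F := kernelModulation α n) (t := u) (T := Real.pi)
    (B := fun x => 3 * cesaroNumber (-α) n * x ^ (-α))
    (B' := fun x => 3 * cesaroNumber (-α) n * (-α * x ^ (-α - 1))) hu.2
    (fun x hx => (hasDerivAt_kernelModulation n (hsub x hx)).differentiableAt.hasDerivAt)
    (fun x hx => (Real.hasDerivAt_rpow_const (Or.inl (hsub x hx).1.ne')).const_mul _)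
    (fun x hx => (norm_deriv_kernelModulation_le hα n (hsub x hx)).trans_eq (by ring))
  have h2 := cesaroNumber_neg_mul_rpow_le hα n hu.1
  have h3 : 0 ≤ 3 * cesaroNumber (-α) n * Real.pi ^ (-α) := by positivity
  linarith

lemma kernelModulation_pi (n : ℕ) :
    ∃ r : ℝ, 1 / 2 ≤ r ∧ r ≤ 2 ∧ kernelModulation α n Real.pi = r := by
  obtain ⟨r, h1, h2, h3⟩ := norm_cesaroPoly_pi hα n
  refine ⟨r * 2 ^ (-α), ?_, ?_, ?_⟩
  · have : (2 : ℝ) ^ (-1 : ℝ) ≤ 2 ^ (-α) :=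
      Real.rpow_le_rpow_of_exponent_le (by norm_num) (by linarith [hα.2])
    rw [Real.rpow_neg_one] at this
    nlinarith
  · have : (2 : ℝ) ^ (-α) ≤ 1 :=
      Real.rpow_le_one_of_one_le_of_nonpos (by norm_num) (by linarith [hα.1])
    nlinarith
  · rw [kernelModulation, h3]
    simp

lemma norm_kernelModulation_le (n : ℕ) {u : ℝ} (hu : u ∈ Ioc 0 Real.pi)
    (hn : 1 ≤ ((n : ℝ) + 1) * u) : ‖kernelModulation α n u‖ ≤ 5 := by
  obtain ⟨r, h1, h2, h3⟩ := kernelModulation_pi hα n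
  have h := norm_kernelModulation_sub_le hα n hu
  have h4 : (((n : ℝ) + 1) * u) ^ (-α) ≤ 1 :=
    Real.rpow_le_one_of_one_le_of_nonpos hn (by linarith [hα.1])
  have h5 : ‖kernelModulation α n Real.pi‖ ≤ 2 := by
    rw [h3, Complex.norm_real, Real.norm_eq_abs, abs_of_nonneg (by linarith)]; exact h2
  have h6 := norm_sub_norm_le (kernelModulation α n u) (kernelModulation α n Real.pi)
  rw [norm_sub_rev] at h6
  linarith

lemma norm_kernelAmplitude_le (n : ℕ) {u : ℝ} (hu : u ∈ Ioc 0 Real.pi)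
    (hn : 1 ≤ ((n : ℝ) + 1) * u) : ‖kernelAmplitude α n u‖ ≤ 15 * u ^ (α - 1) := by
  have h3 := (two_sin_half_bounds hu).2.2
  have h := two_sin_half_rpow_le (q := 1 - α) hu (by linarith [hα.2]) (by linarith [hα.1])
  rw [neg_sub] at h
  rw [kernelAmplitude, norm_mul, Complex.norm_real, Real.norm_eq_abs, abs_of_nonneg (by positivity)]
  calc _ ≤ 5 * (3 * u ^ (α - 1)) :=
        mul_le_mul (norm_kernelModulation_le hα n hu hn) h (by positivity) (by norm_num)
    _ = _ := by ring

lemma hasDerivAt_kernelAmplitude (n : ℕ) {u : ℝ} (hu : u ∈ Ioc 0 Real.pi)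
    (hn : 1 ≤ ((n : ℝ) + 1) * u) :
    HasDerivAt (kernelAmplitude α n) (deriv (kernelAmplitude α n) u) u ∧
      ‖deriv (kernelAmplitude α n) u‖ ≤ 24 * u ^ (α - 2) := by
  have h3 := (two_sin_half_bounds hu).2.2
  have hu0 := hu.1
  have hσ : HasDerivAt (fun u : ℝ => 2 * Real.sin (u / 2)) (Real.cos (u / 2)) u := by
    have h1 : HasDerivAt (fun u : ℝ => u / 2) (1 / 2) u := (hasDerivAt_id u).div_const 2
    refine ((h1.sin).const_mul 2).congr_deriv ?_
    ring
  have hr : HasDerivAt (fun u : ℝ => (((2 * Real.sin (u / 2)) ^ (α - 1) : ℝ) : ℂ))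
      (Real.cos (u / 2) * (α - 1) * (2 * Real.sin (u / 2)) ^ (α - 1 - 1) : ℝ) u :=
    (hσ.rpow_const (Or.inl h3.ne')).ofReal_comp
  have hd := ((hasDerivAt_kernelModulation (α := α) n hu).differentiableAt.hasDerivAt).mul hr
  have hd' : HasDerivAt (kernelAmplitude α n) _ u := hd
  refine ⟨hd'.differentiableAt.hasDerivAt, ?_⟩
  rw [hd'.deriv]
  have b1 := norm_deriv_kernelModulation_le hα n hu
  have b2 := norm_kernelModulation_le hα n hu hn
  have b3 := two_sin_half_rpow_le (q := 1 - α) hu (by linarith [hα.2]) (by linarith [hα.1])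
  have b4 := two_sin_half_rpow_le (q := 2 - α) hu (by linarith [hα.2]) (by linarith [hα.1])
  have b5 := cesaroNumber_neg_mul_rpow_le_one hα n hu.1 hn
  have hA := (cesaroNumber_neg_pos hα n).le
  rw [neg_sub] at b3 b4
  have hα0 := hα.1
  have h1α : 0 < 1 - α := by linarith [hα.2]
  calc _ ≤ (3 * α * cesaroNumber (-α) n * u ^ (-α - 1)) * (3 * u ^ (α - 1)) +
        5 * ((1 - α) * (3 * u ^ (α - 2))) := by
        refine (norm_add_le _ _).trans (add_le_add ?_ ?_)
        · rw [norm_mul, Complex.norm_real, Real.norm_eq_abs, abs_of_nonneg (by positivity)]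
          exact mul_le_mul b1 b3 (by positivity) (by positivity)
        · rw [norm_mul, Complex.norm_real, Real.norm_eq_abs, abs_mul, abs_mul,
            abs_of_neg (by linarith : α - 1 < 0), abs_of_nonneg (a := (2 * Real.sin (u / 2)) ^ _) (by positivity)]
          have hc := Real.abs_cos_le_one (u / 2)
          rw [show α - 1 - 1 = α - 2 by ring]
          refine mul_le_mul b2 ?_ (by rw [neg_sub]; positivity) (by norm_num)
          rw [neg_sub]
          refine mul_le_mul ?_ b4 (by positivity) h1α.le
          nlinarith
    _ = 9 * α * (cesaroNumber (-α) n * u ^ (-α)) * u ^ (α - 2) + 15 * (1 - α) * u ^ (α - 2) := by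
        have : u ^ (-α - 1) * u ^ (α - 1) = u ^ (-α) * u ^ (α - 2) := by
          rw [← Real.rpow_add hu0, ← Real.rpow_add hu0]; ring_nf
        linear_combination 9 * α * cesaroNumber (-α) n * this
    _ ≤ 9 * 1 * 1 * u ^ (α - 2) + 15 * 1 * u ^ (α - 2) := by
        have : 0 ≤ u ^ (-α) := by positivity
        gcongr
        · exact hα.2.le
        · linarith
    _ = _ := by ring

/-- The modulation at `π` is a real number at least `1/2`, and the hypothesis limits the deviation
from it to `3/12 = 1/4`. This lower bound serves the divergence part. -/
lemma re_kernelAmplitude_ge (n : ℕ) {u : ℝ} (hu : u ∈ Ioc 0 Real.pi)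
    (hn : 12 * (((n : ℝ) + 1) * u) ^ (-α) ≤ 1) :
    1 / 4 * u ^ (α - 1) ≤ (kernelAmplitude α n u).re := by
  obtain ⟨h1, h2, h3⟩ := two_sin_half_bounds hu
  obtain ⟨r, r1, r2, r3⟩ := kernelModulation_pi hα n
  have h := norm_kernelModulation_sub_le hα n hu
  have hre := (Complex.re_le_norm _).trans h
  rw [r3, Complex.sub_re, Complex.ofReal_re] at hre
  have hφ : 1 / 4 ≤ (kernelModulation α n u).re := by linarith
  rw [kernelAmplitude, Complex.re_mul_ofReal]
  refine mul_le_mul hφ ?_ (by have := hu.1; positivity) (by linarith)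
  exact Real.rpow_le_rpow_of_nonpos h3 h2 (by linarith [hα.2])

lemma one_div_cesaroNumber_neg_le {n : ℕ} (hn : 1 ≤ n) :
    1 / cesaroNumber (-α) n ≤ (n : ℝ) ^ α / (1 - α) := by
  obtain ⟨k, rfl⟩ := Nat.exists_eq_add_of_le' hn
  have h := le_cesaroNumber_neg hα k
  have hA := cesaroNumber_neg_pos hα (k + 1)
  have h1α : 0 < 1 - α := by linarith [hα.2]
  rw [div_le_div_iff₀ hA h1α]
  push_cast
  rw [Real.rpow_neg (by positivity)] at h
  have : 0 < ((k : ℝ) + 1) ^ α := by positivity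
  rw [one_mul]
  calc 1 - α = ((k : ℝ) + 1) ^ α * ((1 - α) * (((k : ℝ) + 1) ^ α)⁻¹) := by field_simp
    _ ≤ _ := by gcongr

/-- The size of the Cesàro kernel of negative order and of its primitive. -/
lemma exists_cesaroKernel_bounds : ∃ C : ℝ, 0 < C ∧ ∀ n : ℕ, 1 ≤ n →
    (∀ t, |cesaroKernel (-α) n t| ≤ C * n) ∧
    (∀ t, t ≤ Real.pi → 1 ≤ n * t → |cesaroKernel (-α) n t| ≤ C * n * (n * t) ^ (α - 1)) ∧
    (∀ t, t ≤ Real.pi → 1 ≤ n * t →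
      |∫ x in t..Real.pi, cesaroKernel (-α) n x| ≤ C * (n * t) ^ (α - 1)) := by
  have h1α : 0 < 1 - α := by linarith [hα.2]
  have hα0 := hα.1
  have hD : 0 < (30 + 24 / (1 - α)) / (1 - α) := by positivity
  -- `30` comes from the two endpoint values of the amplitude (`15` each), `24 / (1 - α)` from its
  -- variation, and the outer `1 / (1 - α)` from `1 / A_n^{-α} ≤ n^α / (1 - α)`.
  refine ⟨(30 + 24 / (1 - α)) / (1 - α), hD, fun n hn => ?_⟩
  have hn0 : (0 : ℝ) < n := by exact_mod_cast hn
  have hn1 : (1 : ℝ) ≤ n := by exact_mod_cast hn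
  have hA := cesaroNumber_neg_pos hα n
  have hinv := one_div_cesaroNumber_neg_le hα hn
  have hpos {t : ℝ} (ht : 1 ≤ n * t) : 0 < t := by
    by_contra h
    nlinarith
  have hq : 0 < 24 / (1 - α) := by positivity
  refine ⟨fun t => ?_, fun t htπ ht => ?_, fun t htπ ht => ?_⟩
  · refine (abs_cesaroKernel_le hα n t).trans ?_
    rw [div_mul_eq_mul_div]
    gcongr
    nlinarith
  · have hu : t ∈ Ioc 0 Real.pi := ⟨hpos ht, htπ⟩
    have ht0 := hu.1
    rw [cesaroKernel_eq_im n hu, abs_div, abs_of_pos hA, div_eq_mul_one_div]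
    calc _ ≤ (15 * t ^ (α - 1)) * ((n : ℝ) ^ α / (1 - α)) := by
          refine mul_le_mul ((Complex.abs_im_le_norm _).trans ?_) hinv (by positivity) (by positivity)
          rw [norm_mul, Complex.norm_exp_ofReal_mul_I, one_mul]
          exact norm_kernelAmplitude_le hα n hu (by nlinarith)
      _ = 15 / (1 - α) * (n * (n * t) ^ (α - 1)) := by
          have : (n : ℝ) ^ α = n * n ^ (α - 1) := by
            rw [Real.rpow_sub_one hn0.ne']; field_simp
          rw [Real.mul_rpow hn0.le ht0.le, this]; ring
      _ ≤ (30 + 24 / (1 - α)) / (1 - α) * (n * (n * t) ^ (α - 1)) := by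
          gcongr; linarith
      _ = _ := by ring
  · have hu : t ∈ Ioc 0 Real.pi := ⟨hpos ht, htπ⟩
    have ht0 := hu.1
    have hsub : ∀ x ∈ Icc t Real.pi, x ∈ Ioc 0 Real.pi := fun x hx => ⟨hu.1.trans_le hx.1, hx.2⟩
    have hsub' : ∀ x ∈ Icc t Real.pi, 1 ≤ ((n : ℝ) + 1) * x := fun x hx => by
      nlinarith [hx.1, (hsub x hx).1]
    have hM : 0 < kernelFreq α n := hn0.trans_le (kernelFreq_ge hα n)
    have key := norm_integral_exp_mul_le (S := kernelAmplitude α n) (γ := α * Real.pi / 2) (t := t)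
      (T := Real.pi) (B := fun x => 24 / (1 - α) * x ^ (α - 1))
      (B' := fun x => 24 / (1 - α) * ((α - 1) * x ^ (α - 1 - 1))) hM htπ
      (fun x hx => (hasDerivAt_kernelAmplitude hα n (hsub x hx) (hsub' x hx)).1)
      (fun x hx => (Real.hasDerivAt_rpow_const (Or.inl (hsub x hx).1.ne')).const_mul _)
      (fun x hx => (hasDerivAt_kernelAmplitude hα n (hsub x hx) (hsub' x hx)).2.trans_eq (by
        rw [show α - 1 - 1 = α - 2 by ring]; field_simp; ring))
    have hci : IntervalIntegrable (fun x : ℝ => Complex.exp ((kernelFreq α n * x + α * Real.pi / 2 : ℝ) * Complex.I) *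
        kernelAmplitude α n x) volume t Real.pi := by
      apply ContinuousOn.intervalIntegrable
      rw [uIcc_of_le htπ]
      refine ContinuousOn.mul (by apply Continuous.continuousOn; fun_prop) fun x hx =>
        (hasDerivAt_kernelAmplitude hα n (hsub x hx) (hsub' x hx)).1.continuousAt.continuousWithinAt
    have hint : ∫ x in t..Real.pi, cesaroKernel (-α) n x =
        (∫ x in t..Real.pi, Complex.exp ((kernelFreq α n * x + α * Real.pi / 2 : ℝ) * Complex.I) *
          kernelAmplitude α n x).im / cesaroNumber (-α) n := by
      rw [← Complex.imCLM_apply, ← ContinuousLinearMap.intervalIntegral_comp_comm _ hci,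
        ← intervalIntegral.integral_div]
      refine intervalIntegral.integral_congr fun x hx => ?_
      rw [uIcc_of_le htπ] at hx
      exact cesaroKernel_eq_im n (hsub x hx)
    rw [hint, abs_div, abs_of_pos hA, div_eq_mul_one_div]
    have hmono : Real.pi ^ (α - 1) ≤ t ^ (α - 1) :=
      Real.rpow_le_rpow_of_nonpos ht0 htπ (by linarith)
    have hSt := norm_kernelAmplitude_le hα n hu (hsub' t ⟨le_rfl, htπ⟩)
    have hSπ := norm_kernelAmplitude_le hα n (hsub _ ⟨htπ, le_rfl⟩) (hsub' _ ⟨htπ, le_rfl⟩)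
    calc _ ≤ ((30 + 24 / (1 - α)) * t ^ (α - 1) / n) * ((n : ℝ) ^ α / (1 - α)) := by
          refine mul_le_mul ((Complex.abs_im_le_norm _).trans (key.trans ?_)) hinv (by positivity) (by positivity)
          refine div_le_div₀ (by positivity) ?_ hn0 (kernelFreq_ge hα n)
          have : 0 ≤ 24 / (1 - α) * Real.pi ^ (α - 1) := by positivity
          nlinarith
      _ = (30 + 24 / (1 - α)) / (1 - α) * (n * t) ^ (α - 1) := by
          rw [Real.mul_rpow hn0.le ht0.le, Real.rpow_sub_one hn0.ne']; field_simp

end KernelBounds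

/-! ### Weights -/

/-- The sequence `n^{1 - s} / log^p (n + 1)`. -/
def powLogSeq (s p : ℝ) (n : ℕ) : ℝ := (n : ℝ) ^ (1 - s) / Real.log ((n : ℝ) + 1) ^ p

/-- The decay rate `(j + 1)^{-β} / log^p (j + 2)` of weighted tails. -/
def tailRate (β p : ℝ) (j : ℕ) : ℝ := ((j : ℝ) + 1) ^ (-β) / Real.log ((j : ℝ) + 2) ^ p

lemma log_add_two_pos (j : ℕ) : 0 < Real.log ((j : ℝ) + 2) :=
  Real.log_pos (by linarith [(Nat.cast_nonneg j : (0 : ℝ) ≤ j)])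

lemma tailRate_pos (β p : ℝ) (j : ℕ) : 0 < tailRate β p j := by
  have := log_add_two_pos j
  unfold tailRate; positivity

lemma powLogSeq_succ_pos (s p : ℝ) (l : ℕ) : 0 < powLogSeq s p (l + 1) := by
  have := log_add_two_pos l
  have h : Real.log (((l + 1 : ℕ) : ℝ) + 1) = Real.log ((l : ℝ) + 2) := by push_cast; ring_nf
  rw [powLogSeq, h]; positivity

/-- `log (y+1) ≤ log (x+1) + log (y/x)`; the last term is at most `(y/x)^δ / δ`, and `log (x+1) ≥
log 2` makes the bound multiplicative. -/
lemma log_add_one_le_mul_rpow {δ x y : ℝ} (hδ : 0 < δ) (hx : 1 ≤ x) (hxy : x ≤ y) :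
    Real.log (y + 1) ≤ (1 + 1 / (δ * Real.log 2)) * (y / x) ^ δ * Real.log (x + 1) := by
  have hx0 : 0 < x := by linarith
  have hy0 : 0 < y := by linarith
  have hl2 : 0 < Real.log 2 := Real.log_pos (by norm_num)
  have hlx : Real.log 2 ≤ Real.log (x + 1) := Real.log_le_log (by norm_num) (by linarith)
  have hq : 1 ≤ y / x := by rw [le_div_iff₀ hx0]; linarith
  have h1 : Real.log (y + 1) ≤ Real.log (x + 1) + Real.log (y / x) := by
    rw [← Real.log_mul (by positivity) (by positivity)]
    apply Real.log_le_log (by positivity)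
    rw [mul_div_assoc', le_div_iff₀ hx0]
    nlinarith
  have h2 : Real.log (y / x) ≤ (y / x) ^ δ / δ := Real.log_le_rpow_div (by positivity) hδ
  have h3 : 1 ≤ (y / x) ^ δ := Real.one_le_rpow hq hδ.le
  have h4 : (y / x) ^ δ / δ ≤ 1 / (δ * Real.log 2) * (y / x) ^ δ * Real.log (x + 1) := by
    rw [div_mul_eq_mul_div, one_mul, div_mul_eq_mul_div, div_le_div_iff₀ hδ (by positivity)]
    have : 0 < (y / x) ^ δ * δ := by positivity
    nlinarith
  nlinarith

/-- `x^κ / log^p (x + 1)` is almost increasing. -/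
lemma exists_rpow_mul_log_le {κ p : ℝ} (hκ : 0 < κ) (hp : 0 < p) : ∃ C : ℝ, 1 ≤ C ∧
    ∀ x y : ℝ, 1 ≤ x → x ≤ y →
      x ^ κ * Real.log (y + 1) ^ p ≤ C * (y ^ κ * Real.log (x + 1) ^ p) := by
  have hl2 : 0 < Real.log 2 := Real.log_pos (by norm_num)
  refine ⟨(1 + 1 / (κ / p * Real.log 2)) ^ p, ?_, fun x y hx hxy => ?_⟩
  · apply Real.one_le_rpow _ hp.le
    have : 0 < 1 / (κ / p * Real.log 2) := by positivity
    linarith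
  have hx0 : 0 < x := by linarith
  have hy0 : 0 < y := by linarith
  -- The exponent `κ/p` is chosen so that the `p`-th power of the bound contains exactly `(y/x)^κ`.
  have h := log_add_one_le_mul_rpow (div_pos hκ hp) hx hxy
  have hlx : 0 < Real.log (x + 1) := Real.log_pos (by linarith)
  have hly : 0 < Real.log (y + 1) := Real.log_pos (by linarith)
  have h' := Real.rpow_le_rpow hly.le h hp.le
  rw [Real.mul_rpow (by positivity) hlx.le, Real.mul_rpow (by positivity) (by positivity),
    ← Real.rpow_mul (by positivity), div_mul_cancel₀ _ hp.ne'] at h'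
  calc _ ≤ x ^ κ * ((1 + 1 / (κ / p * Real.log 2)) ^ p * (y / x) ^ κ * Real.log (x + 1) ^ p) := by
        gcongr
    _ = _ := by
        rw [Real.div_rpow hy0.le hx0.le]
        have : x ^ κ ≠ 0 := by positivity
        field_simp

/-- Here `l + 1` is the rank of an interval inside a tail starting at `j`. If `j ≤ l`, the left side
is at most `tailRate β p l`, which is no larger than `tailRate β p j`; if `l ≤ j`, the sequence `λ`
is almost increasing, so `λ_{l+1}` may be replaced by `λ_{j+1}`. -/
lemma exists_weight_mul_powLogSeq_le {α β p : ℝ} (hα : α ∈ Ioo (0 : ℝ) 1) (hβ : β ∈ Ioo (0 : ℝ) 1)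
    (hαβ : α + β < 1) (hp : 0 < p) : ∃ C : ℝ, 0 < C ∧ ∀ j l : ℕ,
      ((j + l : ℕ) + 1 : ℝ) ^ (α - 1) * powLogSeq (α + β) p (l + 1) ≤ C * tailRate β p j := by
  obtain ⟨C, hC1, hC⟩ := exists_rpow_mul_log_le (κ := 1 - (α + β)) (p := p) (by linarith) hp
  refine ⟨C, by linarith, fun j l => ?_⟩
  have hj0 : (0 : ℝ) ≤ j := Nat.cast_nonneg j
  have hl0 : (0 : ℝ) ≤ l := Nat.cast_nonneg l
  have hlj := log_add_two_pos j
  have hll := log_add_two_pos l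
  have h : Real.log (((l + 1 : ℕ) : ℝ) + 1) = Real.log ((l : ℝ) + 2) := by push_cast; ring_nf
  rw [powLogSeq, tailRate, h, mul_div_assoc', mul_div_assoc',
    div_le_div_iff₀ (by positivity) (by positivity)]
  push_cast
  rcases le_total j l with hjl | hjl
  · have hjl' : (j : ℝ) ≤ l := by exact_mod_cast hjl
    have e1 : ((j : ℝ) + l + 1) ^ (α - 1) ≤ ((l : ℝ) + 1) ^ (α - 1) :=
      Real.rpow_le_rpow_of_nonpos (by positivity) (by linarith) (by linarith [hα.2])
    have e2 : ((l : ℝ) + 1) ^ (α - 1) * ((l : ℝ) + 1) ^ (1 - (α + β)) = ((l : ℝ) + 1) ^ (-β) := by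
      rw [← Real.rpow_add (by positivity)]; ring_nf
    have e3 : ((l : ℝ) + 1) ^ (-β) ≤ ((j : ℝ) + 1) ^ (-β) :=
      Real.rpow_le_rpow_of_nonpos (by positivity) (by linarith) (by linarith [hβ.1])
    have e4 : Real.log ((j : ℝ) + 2) ^ p ≤ Real.log ((l : ℝ) + 2) ^ p :=
      Real.rpow_le_rpow hlj.le (Real.log_le_log (by positivity) (by linarith)) hp.le
    calc _ ≤ ((l : ℝ) + 1) ^ (α - 1) * ((l : ℝ) + 1) ^ (1 - (α + β)) * Real.log ((l : ℝ) + 2) ^ p := by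
          gcongr
      _ ≤ 1 * ((j : ℝ) + 1) ^ (-β) * Real.log ((l : ℝ) + 2) ^ p := by
          rw [e2, one_mul]; gcongr
      _ ≤ _ := by gcongr
  · have hjl' : (l : ℝ) ≤ j := by exact_mod_cast hjl
    have e1 : ((j : ℝ) + l + 1) ^ (α - 1) ≤ ((j : ℝ) + 1) ^ (α - 1) :=
      Real.rpow_le_rpow_of_nonpos (by positivity) (by linarith) (by linarith [hα.2])
    have e2 : ((j : ℝ) + 1) ^ (α - 1) * ((j : ℝ) + 1) ^ (1 - (α + β)) = ((j : ℝ) + 1) ^ (-β) := by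
      rw [← Real.rpow_add (by positivity)]; ring_nf
    have := hC (l + 1) (j + 1) (by linarith) (by linarith)
    rw [show (j : ℝ) + 1 + 1 = j + 2 by ring, show (l : ℝ) + 1 + 1 = l + 2 by ring] at this
    calc _ ≤ ((j : ℝ) + 1) ^ (α - 1) * ((l : ℝ) + 1) ^ (1 - (α + β)) * Real.log ((j : ℝ) + 2) ^ p := by
          gcongr
      _ = ((j : ℝ) + 1) ^ (α - 1) * (((l : ℝ) + 1) ^ (1 - (α + β)) * Real.log ((j : ℝ) + 2) ^ p) := by
          ring
      _ ≤ ((j : ℝ) + 1) ^ (α - 1) * (C * (((j : ℝ) + 1) ^ (1 - (α + β)) * Real.log ((l : ℝ) + 2) ^ p)) := by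
          gcongr
      _ = C * (((j : ℝ) + 1) ^ (α - 1) * ((j : ℝ) + 1) ^ (1 - (α + β))) * Real.log ((l : ℝ) + 2) ^ p := by
          ring
      _ = _ := by rw [e2]

/-- Cauchy condensation reduces this to `∑ 1 / k^p`. It is the reason for the power `1 + ε` of the
logarithm. -/
lemma summable_one_div_mul_log_rpow {p : ℝ} (hp : 1 < p) :
    Summable fun j : ℕ => 1 / (((j : ℝ) + 1) * Real.log ((j : ℝ) + 2) ^ p) := by
  set f : ℕ → ℝ := fun n => 1 / ((n : ℝ) * Real.log ((n : ℝ) + 1) ^ p) with hf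
  have hlog (n : ℕ) : 0 ≤ Real.log ((n : ℝ) + 1) :=
    Real.log_nonneg (by linarith [(Nat.cast_nonneg n : (0 : ℝ) ≤ n)])
  have hf0 (n : ℕ) : 0 ≤ f n := by have := hlog n; simp only [hf]; positivity
  have hmono : ∀ ⦃m n : ℕ⦄, 0 < m → m ≤ n → f n ≤ f m := by
    intro m n hm hmn
    have hm0 : (0 : ℝ) < m := by exact_mod_cast hm
    have hmn' : (m : ℝ) ≤ n := by exact_mod_cast hmn
    have hlm : 0 < Real.log ((m : ℝ) + 1) := Real.log_pos (by linarith)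
    simp only [hf]
    gcongr
  have hs : Summable f := by
    rw [← summable_condensed_iff_of_nonneg hf0 hmono]
    have hl2 : 0 < Real.log 2 := Real.log_pos (by norm_num)
    have hg : Summable fun k : ℕ => (1 / Real.log 2 ^ p) * (1 / (k : ℝ) ^ p) :=
      (Real.summable_one_div_nat_rpow.2 hp).mul_left _
    rw [← summable_nat_add_iff 1] at hg ⊢
    refine hg.of_nonneg_of_le (fun k => mul_nonneg (by positivity) (hf0 _)) fun k => ?_
    simp only [hf]
    have h2 : (0 : ℝ) < 2 ^ (k + 1) := by positivity
    have hle : ((k + 1 : ℕ) : ℝ) * Real.log 2 ≤ Real.log (((2 ^ (k + 1) : ℕ) : ℝ) + 1) := by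
      rw [← Real.log_pow]
      apply Real.log_le_log h2
      push_cast; linarith
    have hle' := Real.rpow_le_rpow (by positivity) hle (by linarith : 0 ≤ p)
    rw [Real.mul_rpow (by positivity) hl2.le] at hle'
    have hpos : 0 < ((k + 1 : ℕ) : ℝ) ^ p * Real.log 2 ^ p := by positivity
    calc _ = 1 / Real.log (((2 ^ (k + 1) : ℕ) : ℝ) + 1) ^ p := by
          push_cast; field_simp
      _ ≤ 1 / (((k + 1 : ℕ) : ℝ) ^ p * Real.log 2 ^ p) := by gcongr
      _ = _ := by field_simp
  have := (summable_nat_add_iff 1).2 hs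
  refine this.congr fun j => ?_
  simp only [hf]; push_cast; ring_nf

/-- The sum `∑_j (j + 1)^{β - 1} ρ_{max(j, R)}`, where `ρ` is `tailRate β p`. -/
def tailSum (β p : ℝ) (R : ℕ) : ℝ :=
  ∑' j : ℕ, ((j : ℝ) + 1) ^ (β - 1) * tailRate β p (max j R)

section Tail

variable {β p : ℝ} (hβ : β ∈ Ioo (0 : ℝ) 1) (hp : 1 < p)
include hβ hp

lemma tailRate_antitone {i j : ℕ} (hij : i ≤ j) : tailRate β p j ≤ tailRate β p i := by
  have h : (i : ℝ) ≤ j := by exact_mod_cast hij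
  have h1 := log_add_two_pos i
  unfold tailRate
  have h2 : ((j : ℝ) + 1) ^ (-β) ≤ ((i : ℝ) + 1) ^ (-β) :=
    Real.rpow_le_rpow_of_nonpos (by positivity) (by linarith) (by linarith [hβ.1])
  gcongr

lemma tendsto_tailRate : Tendsto (tailRate β p) atTop (𝓝 0) := by
  have h1 : Tendsto (fun j : ℕ => ((j : ℝ) + 1) ^ (-β)) atTop (𝓝 0) :=
    (tendsto_rpow_neg_atTop hβ.1).comp (tendsto_atTop_add_const_right _ _ tendsto_natCast_atTop_atTop)
  have hl2 : 0 < Real.log 2 := Real.log_pos (by norm_num)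
  have h2 : Tendsto (fun j : ℕ => ((j : ℝ) + 1) ^ (-β) / Real.log 2 ^ p) atTop (𝓝 0) := by
    simpa using h1.div_const (Real.log 2 ^ p)
  refine squeeze_zero (fun j => (tailRate_pos β p j).le) (fun j => ?_) h2
  have h3 : Real.log 2 ≤ Real.log ((j : ℝ) + 2) := Real.log_le_log (by norm_num) (by simp)
  unfold tailRate
  gcongr

/-- Since `(β - 1) - β = -1`, the powers combine to `1 / (j+1)`. The majorant does not involve `R`,
as dominated convergence requires. -/
lemma weight_mul_tailRate_le (j R : ℕ) :
    ((j : ℝ) + 1) ^ (β - 1) * tailRate β p (max j R) ≤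
      1 / (((j : ℝ) + 1) * Real.log ((j : ℝ) + 2) ^ p) := by
  have h1 := log_add_two_pos j
  calc _ ≤ ((j : ℝ) + 1) ^ (β - 1) * tailRate β p j := by
        gcongr
        exact tailRate_antitone hβ hp (le_max_left _ _)
    _ = ((j : ℝ) + 1) ^ (β - 1) * ((j : ℝ) + 1) ^ (-β) / Real.log ((j : ℝ) + 2) ^ p := by
        rw [tailRate, mul_div_assoc]
    _ = _ := by
        rw [← Real.rpow_add (by positivity), show β - 1 + -β = -1 by ring, Real.rpow_neg_one]
        field_simp

lemma summable_weight_mul_tailRate (R : ℕ) :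
    Summable fun j : ℕ => ((j : ℝ) + 1) ^ (β - 1) * tailRate β p (max j R) :=
  (summable_one_div_mul_log_rpow hp).of_nonneg_of_le
    (fun j => mul_nonneg (by positivity) (tailRate_pos _ _ _).le)
    fun j => weight_mul_tailRate_le hβ hp j R

lemma sum_le_tailSum (m R : ℕ) :
    ∑ j ∈ Finset.range m, ((j : ℝ) + 1) ^ (β - 1) * tailRate β p (max j R) ≤ tailSum β p R :=
  (summable_weight_mul_tailRate hβ hp R).sum_le_tsum _
    fun j _ => mul_nonneg (by positivity) (tailRate_pos _ _ _).le

lemma tendsto_tailSum : Tendsto (tailSum β p) atTop (𝓝 0) := by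
  have := tendsto_tsum_of_dominated_convergence (β := ℕ) (𝓕 := atTop)
    (f := fun R j : ℕ => ((j : ℝ) + 1) ^ (β - 1) * tailRate β p (max j R)) (g := fun _ => 0)
    (summable_one_div_mul_log_rpow hp)
    (fun j => by
      have h : Tendsto (fun R : ℕ => max j R) atTop atTop :=
        tendsto_atTop_mono (fun R => le_max_right j R) tendsto_id
      simpa using ((tendsto_tailRate hβ hp).comp h).const_mul (((j : ℝ) + 1) ^ (β - 1)))
    (Eventually.of_forall fun R j => by
      rw [Real.norm_eq_abs, abs_of_nonneg (mul_nonneg (by positivity) (tailRate_pos _ _ _).le)]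
      exact weight_mul_tailRate_le hβ hp j R)
  rw [tsum_zero] at this
  exact this

end Tail

/-! ### Weighted sums split at a cut-off index `R` -/

lemma weight_le_one {α : ℝ} (hα : α ∈ Ioo (0 : ℝ) 1) (i : ℕ) : ((i : ℝ) + 1) ^ (α - 1) ≤ 1 :=
  Real.rpow_le_one_of_one_le_of_nonpos (by simp) (by linarith [hα.2])

/-- A weighted sum is small if its first terms are and its tail decays. -/
lemma sum_weight_le {α β p : ℝ} (hα : α ∈ Ioo (0 : ℝ) 1) {d : ℕ → ℝ} {n R : ℕ} {B δ : ℝ} (hδ : 0 ≤ δ)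
    (hd : ∀ i < n, 0 ≤ d i) (h1 : ∀ k, ∑ i ∈ Finset.Ico k n, ((i : ℝ) + 1) ^ (α - 1) * d i ≤ B * tailRate β p k)
    (h2 : ∀ i < n, i < R → d i ≤ δ) :
    ∑ i ∈ Finset.range n, ((i : ℝ) + 1) ^ (α - 1) * d i ≤ δ * R + B * tailRate β p R := by
  calc _ ≤ ∑ i ∈ Finset.range n, ((if i < R then δ else 0) +
        (if R ≤ i then ((i : ℝ) + 1) ^ (α - 1) * d i else 0)) := by
        refine Finset.sum_le_sum fun i hi => ?_
        have hi := Finset.mem_range.1 hi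
        have hw := weight_le_one hα i
        have hw0 : 0 ≤ ((i : ℝ) + 1) ^ (α - 1) := by positivity
        rcases lt_or_ge i R with h | h
        · rw [if_pos h, if_neg (by omega)]
          nlinarith [h2 i hi h, hd i hi]
        · rw [if_neg (by omega), if_pos h]; simp
    _ = ∑ i ∈ Finset.range n, (if i < R then δ else 0) +
        ∑ i ∈ Finset.Ico R n, ((i : ℝ) + 1) ^ (α - 1) * d i := by
        rw [Finset.sum_add_distrib, ← Finset.sum_filter _ (fun i : ℕ => ((i : ℝ) + 1) ^ (α - 1) * d i)]
        congr 2
        ext i; simp; omega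
    _ ≤ _ := by
        refine add_le_add ?_ (h1 R)
        rw [← Finset.sum_filter, Finset.sum_const, nsmul_eq_mul, mul_comm]
        gcongr
        calc _ ≤ (Finset.range R).card := Finset.card_le_card (by intro i; simp)
          _ = R := Finset.card_range R

/-- The two-dimensional analogue of `sum_weight_le`. -/
lemma sum_sum_weight_le {α β p : ℝ} (hα : α ∈ Ioo (0 : ℝ) 1) (hβ : β ∈ Ioo (0 : ℝ) 1) (hp : 1 < p)
    {D : ℕ → ℕ → ℝ} {n m R : ℕ} {B δ : ℝ} (hδ : 0 ≤ δ) (hB : 0 ≤ B)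
    (hD : ∀ i < n, ∀ j < m, 0 ≤ D i j)
    (h1 : ∀ j < m, ∀ k, ∑ i ∈ Finset.Ico k n, ((i : ℝ) + 1) ^ (α - 1) * D i j ≤ B * tailRate β p k)
    (h2 : ∀ i < n, ∀ k, ∑ j ∈ Finset.Ico k m, ((j : ℝ) + 1) ^ (β - 1) * D i j ≤ B * tailRate α p k)
    (h3 : ∀ i < n, ∀ j < m, i < R → j < R → D i j ≤ δ) :
    ∑ i ∈ Finset.range n, ∑ j ∈ Finset.range m,
      ((i : ℝ) + 1) ^ (α - 1) * ((j : ℝ) + 1) ^ (β - 1) * D i j ≤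
      δ * R ^ 2 + B * (tailSum β p R + tailSum α p R) := by
  -- Outside the corner `i, j < R` the larger index is at least `R`. It is summed first, from `max
  -- (smaller index) R` on, so that its tail bound can be paired with the weight of the smaller
  -- index. Counting the diagonal twice is harmless.
  calc _ ≤ ∑ i ∈ Finset.range n, ∑ j ∈ Finset.range m, ((if i < R then if j < R then δ else 0 else 0) +
        ((if max j R ≤ i then ((j : ℝ) + 1) ^ (β - 1) * (((i : ℝ) + 1) ^ (α - 1) * D i j) else 0) +
        (if max i R ≤ j then ((i : ℝ) + 1) ^ (α - 1) * (((j : ℝ) + 1) ^ (β - 1) * D i j) else 0))) := by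
        refine Finset.sum_le_sum fun i hi => Finset.sum_le_sum fun j hj => ?_
        have hi := Finset.mem_range.1 hi
        have hj := Finset.mem_range.1 hj
        have hw := weight_le_one hα i
        have hw0 : 0 ≤ ((i : ℝ) + 1) ^ (α - 1) := by positivity
        have hv := weight_le_one hβ j
        have hv0 : 0 ≤ ((j : ℝ) + 1) ^ (β - 1) := by positivity
        have hD0 := hD i hi j hj
        by_cases hR : i < R ∧ j < R
        · rw [if_pos hR.1, if_pos hR.2, if_neg (by omega), if_neg (by omega), add_zero, add_zero]
          have h := h3 i hi j hj hR.1 hR.2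
          calc _ ≤ 1 * 1 * D i j := by gcongr
            _ ≤ δ := by linarith
        · have p1 : 0 ≤ ((i : ℝ) + 1) ^ (α - 1) * ((j : ℝ) + 1) ^ (β - 1) * D i j := by positivity
          have p0 : (0 : ℝ) ≤ if i < R then if j < R then δ else 0 else 0 := by
            split_ifs <;> simp [hδ]
          rcases le_total j i with hij | hij
          · rw [if_pos (c := max j R ≤ i) (by omega)]
            have : 0 ≤ if max i R ≤ j then ((i : ℝ) + 1) ^ (α - 1) * (((j : ℝ) + 1) ^ (β - 1) * D i j) else 0 := by
              split_ifs
              · positivity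
              · exact le_rfl
            linarith
          · rw [if_pos (c := max i R ≤ j) (by omega)]
            have : 0 ≤ if max j R ≤ i then ((j : ℝ) + 1) ^ (β - 1) * (((i : ℝ) + 1) ^ (α - 1) * D i j) else 0 := by
              split_ifs
              · positivity
              · exact le_rfl
            linarith
    _ ≤ δ * R ^ 2 + (B * tailSum β p R + B * tailSum α p R) := by
        simp only [Finset.sum_add_distrib]
        have hcard (N : ℕ) : ∑ i ∈ Finset.range N, (if i < R then (1 : ℝ) else 0) ≤ R := by
          rw [← Finset.sum_filter, Finset.sum_const, nsmul_eq_mul, mul_one]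
          exact_mod_cast (Finset.card_le_card (t := Finset.range R) (by intro i; simp)).trans_eq
            (Finset.card_range R)
        have hIco (k N : ℕ) (F : ℕ → ℝ) :
            ∑ i ∈ Finset.range N, (if k ≤ i then F i else 0) = ∑ i ∈ Finset.Ico k N, F i := by
          rw [← Finset.sum_filter]
          congr 1
          ext i; simp; omega
        refine add_le_add ?_ (add_le_add ?_ ?_)
        · have : ∑ i ∈ Finset.range n, ∑ j ∈ Finset.range m, (if i < R then if j < R then δ else 0 else 0) =
              δ * ((∑ i ∈ Finset.range n, (if i < R then (1 : ℝ) else 0)) *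
                ∑ j ∈ Finset.range m, (if j < R then (1 : ℝ) else 0)) := by
            rw [Finset.sum_mul_sum, Finset.mul_sum]
            refine Finset.sum_congr rfl fun i _ => ?_
            rw [Finset.mul_sum]
            refine Finset.sum_congr rfl fun j _ => ?_
            split_ifs <;> simp
          rw [this, pow_two]
          refine mul_le_mul_of_nonneg_left (mul_le_mul (hcard n) (hcard m) ?_ (by positivity)) hδ
          exact Finset.sum_nonneg fun _ _ => by split_ifs <;> norm_num
        · rw [Finset.sum_comm]
          calc _ ≤ ∑ j ∈ Finset.range m, B * (((j : ℝ) + 1) ^ (β - 1) * tailRate β p (max j R)) := by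
                refine Finset.sum_le_sum fun j hj => ?_
                rw [hIco, ← Finset.mul_sum, mul_left_comm B]
                gcongr
                exact h1 j (Finset.mem_range.1 hj) _
            _ ≤ _ := by
                rw [← Finset.mul_sum]
                exact mul_le_mul_of_nonneg_left (sum_le_tailSum hβ hp m R) hB
        · calc _ ≤ ∑ i ∈ Finset.range n, B * (((i : ℝ) + 1) ^ (α - 1) * tailRate α p (max i R)) := by
                refine Finset.sum_le_sum fun i hi => ?_
                rw [hIco, ← Finset.mul_sum, mul_left_comm B]
                gcongr
                exact h2 i (Finset.mem_range.1 hi) _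
            _ ≤ _ := by
                rw [← Finset.mul_sum]
                exact mul_le_mul_of_nonneg_left (sum_le_tailSum hα hp n R) hB
    _ = _ := by ring

/-! ### Functionals given by a point evaluation and finitely many increments -/

/-- A point evaluation plus two weighted families of increments. -/
structure IncrementFunctional where
  n : ℕ
  c : ℝ
  τ : ℝ
  coeff : Fin 2 → ℕ → ℝ
  a : Fin 2 → ℕ → ℝ
  b : Fin 2 → ℕ → ℝ

namespace IncrementFunctional

/-- The value of the functional. -/
def eval (L : IncrementFunctional) (ϕ : ℝ → ℝ) : ℝ :=
  L.c * ϕ L.τ + ∑ e, ∑ i ∈ Finset.range L.n, L.coeff e i * (ϕ (L.b e i) - ϕ (L.a e i))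

/-- The coefficients are `O((i + 1)^{α - 1})`, the intervals of each family are consecutive in
`(0, 2π]`, and the `i`-th interval lies in `(0, (i + 2) h]`. -/
structure IsAdmissible (L : IncrementFunctional) (α C h : ℝ) : Prop where
  abs_c_le : |L.c| ≤ C
  τ_pos : 0 < L.τ
  τ_le : L.τ ≤ h
  abs_coeff_le : ∀ e, ∀ i < L.n, |L.coeff e i| ≤ C * ((i : ℝ) + 1) ^ (α - 1)
  a_pos : ∀ e, ∀ i < L.n, 0 < L.a e i
  a_lt_b : ∀ e, ∀ i < L.n, L.a e i < L.b e i
  b_le_two_pi : ∀ e, ∀ i < L.n, L.b e i ≤ 2 * Real.pi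
  b_le : ∀ e, ∀ i < L.n, L.b e i ≤ (i + 2) * h
  b_le_a_succ : ∀ e i, i + 1 < L.n → L.b e i ≤ L.a e (i + 1)

lemma eval_sub (L : IncrementFunctional) (ϕ ψ : ℝ → ℝ) :
    L.eval ϕ - L.eval ψ = L.eval (fun t => ϕ t - ψ t) := by
  simp only [eval, add_sub_add_comm, ← Finset.sum_sub_distrib]
  congr 1
  · ring
  · exact Finset.sum_congr rfl fun e _ => Finset.sum_congr rfl fun i _ => by ring

lemma IsAdmissible.abs_eval_le {L : IncrementFunctional} {α C h : ℝ} (hL : L.IsAdmissible α C h)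
    (ϕ : ℝ → ℝ) : |L.eval ϕ| ≤ C * (|ϕ L.τ| + ∑ e, ∑ i ∈ Finset.range L.n,
      ((i : ℝ) + 1) ^ (α - 1) * |ϕ (L.b e i) - ϕ (L.a e i)|) := by
  rw [eval, mul_add, Finset.mul_sum]
  refine (abs_add_le _ _).trans (add_le_add ?_ ?_)
  · rw [abs_mul]
    exact mul_le_mul_of_nonneg_right hL.abs_c_le (abs_nonneg _)
  · refine (Finset.abs_sum_le_sum_abs _ _).trans (Finset.sum_le_sum fun e _ => ?_)
    rw [Finset.mul_sum]
    refine (Finset.abs_sum_le_sum_abs _ _).trans (Finset.sum_le_sum fun i hi => ?_)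
    rw [abs_mul, ← mul_assoc]
    exact mul_le_mul_of_nonneg_right (hL.abs_coeff_le e i (Finset.mem_range.1 hi)) (abs_nonneg _)

end IncrementFunctional

/-- The weighted sums of increments of `g` over consecutive intervals in `(0, 2π]` are at most `V`. -/
def IncVarLE (lam : ℕ → ℝ) (V : ℝ) (g : ℝ → ℝ) : Prop :=
  ∀ (n : ℕ) (a b : ℕ → ℝ), (∀ i < n, 0 < a i ∧ a i < b i ∧ b i ≤ 2 * Real.pi) →
    (∀ i, i + 1 < n → b i ≤ a (i + 1)) →
    ∑ i ∈ Finset.range n, |g (b i) - g (a i)| / lam (i + 1) ≤ V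

/-- The order of intervals in a `Λ`-variation is free, so a tail may be renumbered from `1`; the
mismatch between weight index and rank is what produces the decay in `k`. -/
lemma sum_Ico_weight_le {α β p W V : ℝ}
    (hW : ∀ j l : ℕ, ((j + l : ℕ) + 1 : ℝ) ^ (α - 1) * powLogSeq (α + β) p (l + 1) ≤ W * tailRate β p j)
    {d : ℕ → ℝ} {n : ℕ} (k : ℕ) (hd : ∀ i < n, 0 ≤ d i) (hW0 : 0 ≤ W)
    (h : ∑ l ∈ Finset.range (n - k), d (k + l) / powLogSeq (α + β) p (l + 1) ≤ V) :
    ∑ i ∈ Finset.Ico k n, ((i : ℝ) + 1) ^ (α - 1) * d i ≤ W * V * tailRate β p k := by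
  rw [Finset.sum_Ico_eq_sum_range]
  have hρ := tailRate_pos β p k
  calc _ ≤ ∑ l ∈ Finset.range (n - k), W * tailRate β p k * (d (k + l) / powLogSeq (α + β) p (l + 1)) := by
        refine Finset.sum_le_sum fun l hl => ?_
        have hl := Finset.mem_range.1 hl
        have hlam := powLogSeq_succ_pos (α + β) p l
        rw [mul_div_assoc', le_div_iff₀ hlam, mul_right_comm]
        exact mul_le_mul_of_nonneg_right (hW k l) (hd _ (by omega))
    _ ≤ W * tailRate β p k * V := by
        rw [← Finset.mul_sum]
        gcongr
    _ = _ := by ring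

lemma IncVarLE.sum_tail_le {lam : ℕ → ℝ} {V : ℝ} {g : ℝ → ℝ} (hg : IncVarLE lam V g)
    {L : IncrementFunctional} {α C h : ℝ} (hL : L.IsAdmissible α C h) (e : Fin 2) (k : ℕ) :
    ∑ l ∈ Finset.range (L.n - k), |g (L.b e (k + l)) - g (L.a e (k + l))| / lam (l + 1) ≤ V :=
  hg (L.n - k) (fun l => L.a e (k + l)) (fun l => L.b e (k + l))
    (fun i hi => ⟨hL.a_pos e _ (by omega), hL.a_lt_b e _ (by omega), hL.b_le_two_pi e _ (by omega)⟩)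
    (fun i hi => by
      have := hL.b_le_a_succ e (k + i) (by omega)
      rwa [add_assoc] at this)

/-- The bound for the tensor product of two admissible functionals. -/
lemma abs_eval_eval_le {α β p W V C h h' δ : ℝ} (hα : α ∈ Ioo (0 : ℝ) 1) (hβ : β ∈ Ioo (0 : ℝ) 1)
    (hp : 1 < p) (hW0 : 0 ≤ W) (hV : 0 ≤ V) (hC : 0 ≤ C) (hδ0 : 0 ≤ δ) (hh : 0 ≤ h) (hh' : 0 ≤ h')
    (hW : ∀ j l : ℕ, ((j + l : ℕ) + 1 : ℝ) ^ (α - 1) * powLogSeq (α + β) p (l + 1) ≤ W * tailRate β p j)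
    (hW' : ∀ j l : ℕ, ((j + l : ℕ) + 1 : ℝ) ^ (β - 1) * powLogSeq (β + α) p (l + 1) ≤ W * tailRate α p j)
    {G : ℝ → ℝ → ℝ} (h1 : ∀ s, IncVarLE (powLogSeq (α + β) p) V (fun t => G t s))
    (h2 : ∀ t, IncVarLE (powLogSeq (α + β) p) V (G t))
    {L L' : IncrementFunctional} (hL : L.IsAdmissible α C h) (hL' : L'.IsAdmissible β C h') (R : ℕ)
    (hG : ∀ t s, 0 < t → t ≤ (R + 1) * h → 0 < s → s ≤ (R + 1) * h' → |G t s| ≤ δ) :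
    |L'.eval fun s => L.eval fun t => G t s| ≤ C ^ 2 * (δ + 2 * (2 * δ * R + W * V * tailRate β p R) +
      2 * (2 * δ * R + W * V * tailRate α p R) +
      4 * (4 * δ * R ^ 2 + 2 * W * V * (tailSum β p R + tailSum α p R))) := by
  rw [add_comm α β] at h2
  -- points of the first `R` intervals lie in the corner
  have hb (e : Fin 2) (i : ℕ) (hi : i < L.n) (hiR : i < R) :
      (0 < L.a e i ∧ L.a e i ≤ (R + 1) * h) ∧ (0 < L.b e i ∧ L.b e i ≤ (R + 1) * h) := by
    have h1 := hL.a_pos e i hi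
    have h2 := hL.a_lt_b e i hi
    have h3 := hL.b_le e i hi
    have h4 : ((i : ℝ) + 2) * h ≤ (R + 1) * h := by
      have : (i : ℝ) + 1 ≤ R := by exact_mod_cast hiR
      exact mul_le_mul_of_nonneg_right (by linarith) hh
    refine ⟨⟨h1, by linarith⟩, by linarith, by linarith⟩
  have hb' (e : Fin 2) (i : ℕ) (hi : i < L'.n) (hiR : i < R) :
      (0 < L'.a e i ∧ L'.a e i ≤ (R + 1) * h') ∧ (0 < L'.b e i ∧ L'.b e i ≤ (R + 1) * h') := by
    have h1 := hL'.a_pos e i hi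
    have h2 := hL'.a_lt_b e i hi
    have h3 := hL'.b_le e i hi
    have h4 : ((i : ℝ) + 2) * h' ≤ (R + 1) * h' := by
      have : (i : ℝ) + 1 ≤ R := by exact_mod_cast hiR
      exact mul_le_mul_of_nonneg_right (by linarith) hh'
    refine ⟨⟨h1, by linarith⟩, by linarith, by linarith⟩
  have hτ : 0 < L.τ ∧ L.τ ≤ (R + 1) * h := ⟨hL.τ_pos, hL.τ_le.trans (by
    have : 0 ≤ (R : ℝ) * h := by positivity
    linarith)⟩
  have hτ' : 0 < L'.τ ∧ L'.τ ≤ (R + 1) * h' := ⟨hL'.τ_pos, hL'.τ_le.trans (by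
    have : 0 ≤ (R : ℝ) * h' := by positivity
    linarith)⟩
  have sub_le {x y : ℝ} (hx : |x| ≤ δ) (hy : |y| ≤ δ) : |x - y| ≤ 2 * δ :=
    (abs_sub x y).trans (by linarith)
  have hWV : 0 ≤ W * V := by positivity
  have S1 (e : Fin 2) : ∑ i ∈ Finset.range L.n,
      ((i : ℝ) + 1) ^ (α - 1) * |G (L.b e i) L'.τ - G (L.a e i) L'.τ| ≤
      2 * δ * R + W * V * tailRate β p R :=
    sum_weight_le hα (by positivity) (fun _ _ => abs_nonneg _)
      (fun k => sum_Ico_weight_le hW k (fun _ _ => abs_nonneg _) hW0 ((h1 L'.τ).sum_tail_le hL e k))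
      (fun i hi hiR => sub_le (hG _ _ (hb e i hi hiR).2.1 (hb e i hi hiR).2.2 hτ'.1 hτ'.2)
        (hG _ _ (hb e i hi hiR).1.1 (hb e i hi hiR).1.2 hτ'.1 hτ'.2))
  have S2 (e : Fin 2) : ∑ j ∈ Finset.range L'.n,
      ((j : ℝ) + 1) ^ (β - 1) * |G L.τ (L'.b e j) - G L.τ (L'.a e j)| ≤
      2 * δ * R + W * V * tailRate α p R :=
    sum_weight_le hβ (by positivity) (fun _ _ => abs_nonneg _)
      (fun k => sum_Ico_weight_le hW' k (fun _ _ => abs_nonneg _) hW0 ((h2 L.τ).sum_tail_le hL' e k))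
      (fun i hi hiR => sub_le (hG _ _ hτ.1 hτ.2 (hb' e i hi hiR).2.1 (hb' e i hi hiR).2.2)
        (hG _ _ hτ.1 hτ.2 (hb' e i hi hiR).1.1 (hb' e i hi hiR).1.2))
  set D : Fin 2 → Fin 2 → ℕ → ℕ → ℝ := fun e e' i j =>
    |(G (L.b e i) (L'.b e' j) - G (L.b e i) (L'.a e' j)) -
      (G (L.a e i) (L'.b e' j) - G (L.a e i) (L'.a e' j))| with hD
  -- A mixed difference is the difference of two increments in the first variable, and also of two
  -- in the second; hence `2WV` for the tails and `4δ` in the corner.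
  have S3 (e e' : Fin 2) : ∑ i ∈ Finset.range L.n, ∑ j ∈ Finset.range L'.n,
      ((i : ℝ) + 1) ^ (α - 1) * ((j : ℝ) + 1) ^ (β - 1) * D e e' i j ≤
      4 * δ * R ^ 2 + 2 * W * V * (tailSum β p R + tailSum α p R) := by
    refine sum_sum_weight_le hα hβ hp (by positivity) (by positivity) (fun _ _ _ _ => abs_nonneg _) ?_ ?_ ?_
    · intro j hj k
      have t1 := sum_Ico_weight_le hW (d := fun i => |G (L.b e i) (L'.b e' j) - G (L.a e i) (L'.b e' j)|) k
        (fun _ _ => abs_nonneg _) hW0 ((h1 (L'.b e' j)).sum_tail_le hL e k)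
      have t2 := sum_Ico_weight_le hW (d := fun i => |G (L.b e i) (L'.a e' j) - G (L.a e i) (L'.a e' j)|) k
        (fun _ _ => abs_nonneg _) hW0 ((h1 (L'.a e' j)).sum_tail_le hL e k)
      calc _ ≤ ∑ i ∈ Finset.Ico k L.n, (((i : ℝ) + 1) ^ (α - 1) * |G (L.b e i) (L'.b e' j) - G (L.a e i) (L'.b e' j)| +
            ((i : ℝ) + 1) ^ (α - 1) * |G (L.b e i) (L'.a e' j) - G (L.a e i) (L'.a e' j)|) := by
            refine Finset.sum_le_sum fun i _ => ?_
            rw [← mul_add]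
            refine mul_le_mul_of_nonneg_left ?_ (by positivity)
            simp only [hD]
            rw [sub_sub_sub_comm]
            exact abs_sub _ _
        _ ≤ _ := by rw [Finset.sum_add_distrib]; linarith
    · intro i hi k
      have t1 := sum_Ico_weight_le hW' (d := fun j => |G (L.b e i) (L'.b e' j) - G (L.b e i) (L'.a e' j)|) k
        (fun _ _ => abs_nonneg _) hW0 ((h2 (L.b e i)).sum_tail_le hL' e' k)
      have t2 := sum_Ico_weight_le hW' (d := fun j => |G (L.a e i) (L'.b e' j) - G (L.a e i) (L'.a e' j)|) k
        (fun _ _ => abs_nonneg _) hW0 ((h2 (L.a e i)).sum_tail_le hL' e' k)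
      calc _ ≤ ∑ j ∈ Finset.Ico k L'.n, (((j : ℝ) + 1) ^ (β - 1) * |G (L.b e i) (L'.b e' j) - G (L.b e i) (L'.a e' j)| +
            ((j : ℝ) + 1) ^ (β - 1) * |G (L.a e i) (L'.b e' j) - G (L.a e i) (L'.a e' j)|) := by
            refine Finset.sum_le_sum fun j _ => ?_
            rw [← mul_add]
            exact mul_le_mul_of_nonneg_left (abs_sub _ _) (by positivity)
        _ ≤ _ := by rw [Finset.sum_add_distrib]; linarith
    · intro i hi j hj hiR hjR
      have c1 := hb e i hi hiR
      have c2 := hb' e' j hj hjR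
      have d1 := sub_le (hG _ _ c1.2.1 c1.2.2 c2.2.1 c2.2.2) (hG _ _ c1.2.1 c1.2.2 c2.1.1 c2.1.2)
      have d2 := sub_le (hG _ _ c1.1.1 c1.1.2 c2.2.1 c2.2.2) (hG _ _ c1.1.1 c1.1.2 c2.1.1 c2.1.2)
      exact (abs_sub _ _).trans (by linarith)
  refine (hL'.abs_eval_le _).trans ?_
  have E1 : |L.eval fun t => G t L'.τ| ≤ C * (δ + 2 * (2 * δ * R + W * V * tailRate β p R)) := by
    refine (hL.abs_eval_le _).trans (mul_le_mul_of_nonneg_left (add_le_add (hG _ _ hτ.1 hτ.2 hτ'.1 hτ'.2) ?_) hC)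
    refine (Finset.sum_le_sum fun e _ => S1 e).trans_eq ?_
    rw [Fin.sum_univ_two]; ring
  have E2 (e' : Fin 2) : ∑ j ∈ Finset.range L'.n, ((j : ℝ) + 1) ^ (β - 1) *
      |(L.eval fun t => G t (L'.b e' j)) - L.eval fun t => G t (L'.a e' j)| ≤
      C * ((2 * δ * R + W * V * tailRate α p R) +
        2 * (4 * δ * R ^ 2 + 2 * W * V * (tailSum β p R + tailSum α p R))) := by
    calc _ ≤ ∑ j ∈ Finset.range L'.n, C * (((j : ℝ) + 1) ^ (β - 1) * |G L.τ (L'.b e' j) - G L.τ (L'.a e' j)| +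
          ∑ e, ∑ i ∈ Finset.range L.n, ((i : ℝ) + 1) ^ (α - 1) * ((j : ℝ) + 1) ^ (β - 1) * D e e' i j) := by
          refine Finset.sum_le_sum fun j _ => ?_
          rw [L.eval_sub]
          refine (mul_le_mul_of_nonneg_left (hL.abs_eval_le _) (by positivity)).trans_eq ?_
          rw [mul_left_comm, mul_add]
          congr 2
          simp only [Finset.mul_sum]
          exact Finset.sum_congr rfl fun e _ => Finset.sum_congr rfl fun i _ => by ring
      _ ≤ _ := by
          rw [← Finset.mul_sum, Finset.sum_add_distrib]
          refine mul_le_mul_of_nonneg_left (add_le_add (S2 e') ?_) hC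
          rw [Finset.sum_comm]
          refine (Finset.sum_le_sum fun e _ => (Finset.sum_comm.trans_le (S3 e e'))).trans_eq ?_
          rw [Fin.sum_univ_two]; ring
  calc _ ≤ C * (C * (δ + 2 * (2 * δ * R + W * V * tailRate β p R)) +
        2 * (C * ((2 * δ * R + W * V * tailRate α p R) +
        2 * (4 * δ * R ^ 2 + 2 * W * V * (tailSum β p R + tailSum α p R))))) := by
        refine mul_le_mul_of_nonneg_left (add_le_add E1 ?_) hC
        refine (Finset.sum_le_sum fun e _ => E2 e).trans_eq ?_
        simp [two_mul]
    _ = _ := by ring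

/-! ### The kernel integral as an average of increment functionals -/

/-- The functional whose average over `u ∈ (0, π / n)` is integration against the kernel. -/
def kernelFunctional (α : ℝ) (n : ℕ) (u v : ℝ) : IncrementFunctional where
  n := n
  c := ∫ x in (0 : ℝ)..Real.pi, cesaroKernel (-α) n x
  τ := Real.pi / n - v
  coeff := ![fun i => if u < v then Real.pi / n * cesaroKernel (-α) n ((i + 1) * (Real.pi / n) - u)
      else -(Real.pi / n * cesaroKernel (-α) n ((i + 1) * (Real.pi / n) - u)),
    fun i => ∫ x in ((i + 1) * (Real.pi / n))..Real.pi, cesaroKernel (-α) n x]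
  a := ![fun i => (i + 1) * (Real.pi / n) - max u v, fun i => (i + 1) * (Real.pi / n) - v]
  b := ![fun i => (i + 1) * (Real.pi / n) - min u v, fun i => (i + 2) * (Real.pi / n) - v]

lemma kernelFunctional_eval (α : ℝ) (n : ℕ) (u v : ℝ) (ϕ : ℝ → ℝ) :
    (kernelFunctional α n u v).eval ϕ =
      (∫ x in (0 : ℝ)..Real.pi, cesaroKernel (-α) n x) * ϕ (Real.pi / n - v) +
      (∑ i ∈ Finset.range n, Real.pi / n * cesaroKernel (-α) n ((i + 1) * (Real.pi / n) - u) *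
        (ϕ ((i + 1) * (Real.pi / n) - u) - ϕ ((i + 1) * (Real.pi / n) - v)) +
      ∑ i ∈ Finset.range n, (∫ x in ((i + 1) * (Real.pi / n))..Real.pi, cesaroKernel (-α) n x) *
        (ϕ ((i + 2) * (Real.pi / n) - v) - ϕ ((i + 1) * (Real.pi / n) - v))) := by
  simp only [IncrementFunctional.eval, kernelFunctional, Fin.sum_univ_two, Matrix.cons_val_zero,
    Matrix.cons_val_one]
  congr 2
  refine Finset.sum_congr rfl fun i _ => ?_
  rcases lt_or_ge u v with h | h
  · rw [if_pos h, max_eq_right h.le, min_eq_left h.le]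
  · rw [if_neg h.not_gt, max_eq_left h, min_eq_right h]; ring

/-- The kernel and its primitive at distance about `i π / n` are `O(n (i+1)^{α-1})` and
`O((i+1)^{α-1})`; the kernel value also carries the cell length. The condition `u ≠ v` makes the
first family of intervals nondegenerate. -/
lemma exists_kernelFunctional_isAdmissible {α : ℝ} (hα : α ∈ Ioo (0 : ℝ) 1) : ∃ C : ℝ, 0 < C ∧
    ∀ n : ℕ, 1 ≤ n → ∀ u ∈ Ioo 0 (Real.pi / n), ∀ v ∈ Ioo 0 (Real.pi / n), u ≠ v →
      (kernelFunctional α n u v).IsAdmissible α C (Real.pi / n) := by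
  obtain ⟨C, hC, hK⟩ := exists_cesaroKernel_bounds hα
  have hpi := Real.pi_pos
  refine ⟨Real.pi / 2 + C + Real.pi * C, by positivity, fun n hn u hu v hv huv => ?_⟩
  have hn0 : (0 : ℝ) < n := by exact_mod_cast hn
  obtain ⟨k1, k2, k3⟩ := hK n hn
  set h := Real.pi / n with hh
  have hh0 : 0 < h := by positivity
  have hnh : n * h = Real.pi := by rw [hh]; field_simp
  have hhpi : h ≤ Real.pi := by
    have : (1 : ℝ) ≤ n := by exact_mod_cast hn
    nlinarith
  have hmax : max u v < h := max_lt hu.2 hv.2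
  have hmin : 0 < min u v := lt_min hu.1 hv.1
  have hmm : min u v < max u v := min_lt_max.2 huv
  have hin {i : ℕ} (hi : i < n) : ((i : ℝ) + 1) * h ≤ Real.pi := by
    rw [← hnh]
    have : (i : ℝ) + 1 ≤ n := by exact_mod_cast hi
    gcongr
  constructor
  · simp only [kernelFunctional]
    rw [integral_cesaroKernel (cesaroNumber_neg_pos hα n).ne', abs_of_pos (by positivity)]
    have : 0 < C + Real.pi * C := by positivity
    linarith
  · simp only [kernelFunctional]; linarith [hv.2]
  · simp only [kernelFunctional]; linarith [hv.1]
  · intro e i hi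
    have hi : i < n := hi
    have hw : 0 ≤ ((i : ℝ) + 1) ^ (α - 1) := by positivity
    fin_cases e
    · have key : h * |cesaroKernel (-α) n ((i + 1) * h - u)| ≤ Real.pi * C * ((i : ℝ) + 1) ^ (α - 1) := by
        -- In the first cell the sample may be arbitrarily near `0`, where only `|K| ≤ C n` is
        -- available. For `i ≥ 1` the scaled sample exceeds `i π ≥ i + 1`.
        rcases Nat.eq_zero_or_pos i with rfl | hi0
        · have := mul_le_mul_of_nonneg_left (k1 (((0 : ℕ) + 1) * h - u)) hh0.le
          refine this.trans_eq ?_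
          rw [mul_left_comm, mul_comm h, hnh]; simp [mul_comm]
        · have hi1 : (1 : ℝ) ≤ i := by exact_mod_cast hi0
          have hge : (i : ℝ) + 1 ≤ n * ((i + 1) * h - u) := by
            have : n * u < Real.pi := by rw [← hnh]; have := hu.2; gcongr
            have e : n * ((i + 1) * h - u) = (i + 1) * Real.pi - n * u := by rw [← hnh]; ring
            rw [e]
            nlinarith [Real.pi_gt_three]
          have := k2 ((i + 1) * h - u) (by linarith [hin hi, hu.1]) (by linarith)
          calc _ ≤ h * (C * n * (n * ((i + 1) * h - u)) ^ (α - 1)) := by gcongr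
            _ = (n * h) * C * (n * ((i + 1) * h - u)) ^ (α - 1) := by ring
            _ ≤ _ := by
                rw [hnh]
                refine mul_le_mul_of_nonneg_left ?_ (by positivity)
                exact Real.rpow_le_rpow_of_nonpos (by positivity) hge (by linarith [hα.2])
      have habs : |(kernelFunctional α n u v).coeff 0 i| = h * |cesaroKernel (-α) n ((i + 1) * h - u)| := by
        simp only [kernelFunctional, Matrix.cons_val_zero]
        split_ifs
        · rw [abs_mul, abs_of_pos hh0]
        · rw [abs_neg, abs_mul, abs_of_pos hh0]
      change |(kernelFunctional α n u v).coeff 0 i| ≤ _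
      rw [habs]
      refine key.trans (mul_le_mul_of_nonneg_right ?_ hw)
      have : 0 < Real.pi / 2 + C := by positivity
      linarith
    · change |∫ x in ((i + 1) * h)..Real.pi, cesaroKernel (-α) n x| ≤ _
      have hge : (i : ℝ) + 1 ≤ n * ((i + 1) * h) := by
        have e : n * ((i + 1) * h) = (i + 1) * Real.pi := by rw [← hnh]; ring
        rw [e]
        nlinarith [Real.pi_gt_three]
      have hi0 : (0 : ℝ) ≤ i := Nat.cast_nonneg i
      refine (k3 _ (hin hi) (by linarith)).trans ?_
      have : (n * (((i : ℝ) + 1) * h)) ^ (α - 1) ≤ ((i : ℝ) + 1) ^ (α - 1) :=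
        Real.rpow_le_rpow_of_nonpos (by positivity) hge (by linarith [hα.2])
      have h0 : 0 < Real.pi / 2 + Real.pi * C := by positivity
      exact mul_le_mul (by linarith) this (by positivity) (by positivity)
  · intro e i hi
    have hi0 : 0 ≤ (i : ℝ) * h := by positivity
    fin_cases e
    · change 0 < (i + 1) * h - max u v
      linarith
    · change 0 < (i + 1) * h - v
      linarith [hv.2]
  · intro e i hi
    fin_cases e
    · change (i + 1) * h - max u v < (i + 1) * h - min u v
      linarith
    · change (i + 1) * h - v < (i + 2) * h - v
      linarith
  · intro e i hi
    have := hin hi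
    fin_cases e
    · change (i + 1) * h - min u v ≤ _
      linarith
    -- For `i = n - 1` this endpoint passes `π` (the corresponding coefficient is zero) but stays
    -- below `π + h ≤ 2π`.
    · change (i + 2) * h - v ≤ _
      linarith [hv.1]
  · intro e i hi
    fin_cases e
    · change (i + 1) * h - min u v ≤ (i + 2) * h
      linarith
    · change (i + 2) * h - v ≤ (i + 2) * h
      linarith [hv.1]
  · intro e i hi
    fin_cases e
    · change (i + 1) * h - min u v ≤ ((i + 1 : ℕ) + 1) * h - max u v
      push_cast
      linarith
    · change (i + 2) * h - v ≤ ((i + 1 : ℕ) + 1) * h - v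
      push_cast
      linarith

/-- On each cell the sample of `ϕ` at distance `v` from the right end is subtracted; the samples are
then summed by parts against the primitive of the kernel. The variable `u` is the distance of the
integration point from the right end of its cell. The offset `v` is free, which later allows bad
null sets to be avoided. -/
lemma integral_mul_cesaroKernel_eq (α : ℝ) {n : ℕ} (hn : 1 ≤ n) (v : ℝ) {ϕ : ℝ → ℝ}
    (hϕ : IntervalIntegrable ϕ volume 0 Real.pi) :
    ∫ t in (0 : ℝ)..Real.pi, ϕ t * cesaroKernel (-α) n t =
      (n / Real.pi) * ∫ u in (0 : ℝ)..(Real.pi / n), (kernelFunctional α n u v).eval ϕ := by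
  have hpi := Real.pi_pos
  have hn0 : (0 : ℝ) < n := by exact_mod_cast hn
  set h := Real.pi / n with hh
  have hh0 : 0 < h := by positivity
  have hnh : n * h = Real.pi := by rw [hh]; field_simp
  set K := cesaroKernel (-α) n with hK
  have hKc : Continuous K := continuous_cesaroKernel _ _
  have hKi (x y : ℝ) : IntervalIntegrable K volume x y := hKc.intervalIntegrable _ _
  set Φ : ℝ → ℝ := fun t => ∫ x in t..Real.pi, K x with hΦ
  have hsub (i : ℕ) (hi : i < n) : uIcc (i * h) ((i + 1) * h) ⊆ uIcc 0 Real.pi := by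
    rw [uIcc_of_le (by nlinarith), uIcc_of_le hpi.le]
    apply Icc_subset_Icc (by positivity)
    rw [← hnh]
    have : (i : ℝ) + 1 ≤ n := by exact_mod_cast hi
    gcongr
  have hϕi (i : ℕ) (hi : i < n) : IntervalIntegrable ϕ volume (i * h) ((i + 1) * h) :=
    hϕ.mono_set (hsub i hi)
  have hϕK (i : ℕ) (hi : i < n) : IntervalIntegrable (fun t => ϕ t * K t) volume (i * h) ((i + 1) * h) :=
    (hϕi i hi).mul_continuousOn hKc.continuousOn
  have hdi (i : ℕ) (hi : i < n) : IntervalIntegrable (fun t => K t * (ϕ t - ϕ ((i + 1) * h - v))) volume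
      (i * h) ((i + 1) * h) :=
    ((hϕi i hi).sub intervalIntegrable_const).continuousOn_mul hKc.continuousOn
  have hsplit : ∫ t in (0 : ℝ)..Real.pi, ϕ t * K t =
      ∑ i ∈ Finset.range n, ∫ t in (i * h)..((i + 1) * h), ϕ t * K t := by
    have := intervalIntegral.sum_integral_adjacent_intervals (f := fun t => ϕ t * K t) (μ := volume)
      (a := fun i : ℕ => (i : ℝ) * h) (n := n) (fun i hi => by simpa using hϕK i hi)
    simp only [Nat.cast_zero, zero_mul, hnh] at this
    rw [← this]
    simp
  have hcell (i : ℕ) (hi : i < n) : ∫ t in (i * h)..((i + 1) * h), ϕ t * K t =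
      (∫ t in (i * h)..((i + 1) * h), K t * (ϕ t - ϕ ((i + 1) * h - v))) +
        ϕ ((i + 1) * h - v) * (Φ (i * h) - Φ ((i + 1) * h)) := by
    have h1 : Φ (i * h) - Φ ((i + 1) * h) = ∫ t in (i * h)..((i + 1) * h), K t := by
      rw [hΦ]
      simp only
      rw [← intervalIntegral.integral_add_adjacent_intervals (hKi (i * h) ((i + 1) * h)) (hKi _ _)]
      ring
    rw [h1, ← intervalIntegral.integral_const_mul, ← intervalIntegral.integral_add (hdi i hi)
      ((hKi _ _).const_mul _)]
    congr 1
    ext t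
    ring
  have hshift (i : ℕ) (F : ℝ → ℝ) : ∫ t in (i * h)..((i + 1) * h), F t =
      ∫ u in (0 : ℝ)..h, F ((i + 1) * h - u) := by
    rw [intervalIntegral.integral_comp_sub_left]
    congr 1 <;> ring
  -- Abel summation; the boundary term at the right end vanishes because `Φ π = 0`.
  have habel : ∑ i ∈ Finset.range n, ϕ ((i + 1) * h - v) * (Φ (i * h) - Φ ((i + 1) * h)) =
      Φ 0 * ϕ (h - v) +
        ∑ i ∈ Finset.range n, Φ ((i + 1) * h) * (ϕ ((i + 2) * h - v) - ϕ ((i + 1) * h - v)) := by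
    rw [← sub_eq_iff_eq_add, ← Finset.sum_sub_distrib]
    have := Finset.sum_range_sub' (fun i : ℕ => Φ (i * h) * ϕ ((i + 1) * h - v)) n
    have hΦn : Φ (n * h) = 0 := by rw [hnh]; simp [hΦ]
    simp only [hΦn, zero_mul, sub_zero, Nat.cast_zero, zero_add, one_mul] at this
    rw [← this]
    refine Finset.sum_congr rfl fun i _ => ?_
    push_cast
    rw [show (i : ℝ) + 1 + 1 = i + 2 by ring]
    ring
  have hdu (i : ℕ) (hi : i < n) : IntervalIntegrable
      (fun u => h * K ((i + 1) * h - u) * (ϕ ((i + 1) * h - u) - ϕ ((i + 1) * h - v))) volume 0 h := by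
    have := ((hdi i hi).comp_sub_left ((i + 1) * h)).symm.const_mul h
    rw [show ((i : ℝ) + 1) * h - (i + 1) * h = 0 by ring, show ((i : ℝ) + 1) * h - i * h = h by ring] at this
    refine this.congr (fun u _ => ?_)
    ring
  rw [hsplit, Finset.sum_congr rfl fun i hi => hcell i (Finset.mem_range.1 hi), Finset.sum_add_distrib, habel]
  have hds : IntervalIntegrable (fun u => ∑ i ∈ Finset.range n,
      h * K ((i + 1) * h - u) * (ϕ ((i + 1) * h - u) - ϕ ((i + 1) * h - v))) volume 0 h := by
    have := IntervalIntegrable.sum (μ := volume) _ fun i hi => hdu i (Finset.mem_range.1 hi)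
    refine this.congr fun u _ => ?_
    simp
  simp only [kernelFunctional_eval, ← hh, ← hK]
  rw [intervalIntegral.integral_add (by simp) (hds.add (by simp)),
    intervalIntegral.integral_add hds (by simp),
    intervalIntegral.integral_finsetSum fun i hi => hdu i (Finset.mem_range.1 hi)]
  simp only [intervalIntegral.integral_const, smul_eq_mul, sub_zero]
  have e1 : (n : ℝ) / Real.pi = 1 / h := by rw [hh]; field_simp
  rw [e1]
  have e2 : ∀ i ∈ Finset.range n, ∫ u in (0 : ℝ)..h, h * K ((i + 1) * h - u) * (ϕ ((i + 1) * h - u) - ϕ ((i + 1) * h - v)) =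
      h * ∫ t in (i * h)..((i + 1) * h), K t * (ϕ t - ϕ ((i + 1) * h - v)) := by
    intro i _
    rw [hshift, ← intervalIntegral.integral_const_mul]
    congr 1; ext u; ring
  rw [Finset.sum_congr rfl e2, ← Finset.mul_sum, ← mul_add, ← mul_add, ← mul_assoc,
    one_div_mul_cancel hh0.ne', one_mul, add_left_comm]

lemma abs_integral_mul_cesaroKernel_le (α : ℝ) {n : ℕ} (hn : 1 ≤ n) (v : ℝ) {ϕ : ℝ → ℝ}
    (hϕ : IntervalIntegrable ϕ volume 0 Real.pi) {B : ℝ}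
    (hB : ∀ᵐ u, u ∈ Ioo 0 (Real.pi / n) → |(kernelFunctional α n u v).eval ϕ| ≤ B) :
    |∫ t in (0 : ℝ)..Real.pi, ϕ t * cesaroKernel (-α) n t| ≤ B := by
  have hpi := Real.pi_pos
  have hn0 : (0 : ℝ) < n := by exact_mod_cast hn
  have hh0 : 0 < Real.pi / n := by positivity
  rw [integral_mul_cesaroKernel_eq α hn v hϕ, abs_mul, abs_of_pos (by positivity)]
  have := intervalIntegral.norm_integral_le_of_norm_le_const_ae (a := 0) (b := Real.pi / n) (C := B)
    (f := fun u => (kernelFunctional α n u v).eval ϕ) (by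
      have hne : ∀ᵐ u : ℝ, u ≠ Real.pi / n := by simp [ae_iff]
      filter_upwards [hB, hne] with u hu hu' hmem
      rw [uIoc_of_le hh0.le] at hmem
      exact hu ⟨hmem.1, lt_of_le_of_ne hmem.2 hu'⟩)
  rw [Real.norm_eq_abs, sub_zero, abs_of_pos hh0] at this
  calc _ ≤ n / Real.pi * (B * (Real.pi / n)) := by gcongr
    _ = B := by field_simp

/-! ### The quadrant estimate -/

lemma IncrementFunctional.IsAdmissible.mono {L : IncrementFunctional} {α C C' h : ℝ}
    (hL : L.IsAdmissible α C h) (hC : C ≤ C') : L.IsAdmissible α C' h :=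
  { hL with
    abs_c_le := hL.abs_c_le.trans hC
    abs_coeff_le := fun e i hi => (hL.abs_coeff_le e i hi).trans
      (mul_le_mul_of_nonneg_right hC (by positivity)) }

lemma IncrementFunctional.intervalIntegrable_eval (L : IncrementFunctional) {G : ℝ → ℝ → ℝ} {x y : ℝ}
    (hτ : IntervalIntegrable (G L.τ) volume x y)
    (ha : ∀ e i, IntervalIntegrable (G (L.a e i)) volume x y)
    (hb : ∀ e i, IntervalIntegrable (G (L.b e i)) volume x y) :
    IntervalIntegrable (fun s => L.eval fun t => G t s) volume x y := by
  have := (hτ.const_mul L.c).add (IntervalIntegrable.sum Finset.univ fun e _ =>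
    IntervalIntegrable.sum (Finset.range L.n) fun i _ => ((hb e i).sub (ha e i)).const_mul (L.coeff e i))
  refine this.congr fun s _ => ?_
  simp [eval, Finset.sum_apply]

lemma IncrementFunctional.eval_integral (L : IncrementFunctional) {G : ℝ → ℝ → ℝ} {x y : ℝ}
    (hτ : IntervalIntegrable (G L.τ) volume x y)
    (ha : ∀ e i, IntervalIntegrable (G (L.a e i)) volume x y)
    (hb : ∀ e i, IntervalIntegrable (G (L.b e i)) volume x y) :
    (L.eval fun t => ∫ s in x..y, G t s) = ∫ s in x..y, L.eval fun t => G t s := by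
  have hd (e : Fin 2) (i : ℕ) : IntervalIntegrable (fun s => L.coeff e i * (G (L.b e i) s - G (L.a e i) s))
      volume x y := ((hb e i).sub (ha e i)).const_mul (L.coeff e i)
  have hs (e : Fin 2) : IntervalIntegrable (fun s => ∑ i ∈ Finset.range L.n,
      L.coeff e i * (G (L.b e i) s - G (L.a e i) s)) volume x y := by
    refine (IntervalIntegrable.sum (Finset.range L.n) fun i _ => hd e i).congr fun s _ => ?_
    simp
  have hss : IntervalIntegrable (fun s => ∑ e, ∑ i ∈ Finset.range L.n,
      L.coeff e i * (G (L.b e i) s - G (L.a e i) s)) volume x y := by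
    refine (IntervalIntegrable.sum Finset.univ fun e _ => hs e).congr fun s _ => ?_
    simp
  simp only [eval]
  rw [intervalIntegral.integral_add (hτ.const_mul L.c) hss, intervalIntegral.integral_const_mul,
    intervalIntegral.integral_finsetSum fun e _ => hs e]
  congr 1
  refine Finset.sum_congr rfl fun e _ => ?_
  rw [intervalIntegral.integral_finsetSum fun i _ => hd e i]
  refine Finset.sum_congr rfl fun i _ => ?_
  rw [intervalIntegral.integral_const_mul, intervalIntegral.integral_sub (hb e i) (ha e i)]

lemma IncrementFunctional.eval_mul_const (L : IncrementFunctional) (ϕ : ℝ → ℝ) (c : ℝ) :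
    (L.eval fun t => ϕ t * c) = L.eval ϕ * c := by
  simp only [eval, add_mul, Finset.sum_mul]
  congr 1
  · ring
  · exact Finset.sum_congr rfl fun e _ => Finset.sum_congr rfl fun i _ => by ring

lemma ae_sub_left {P : ℝ → Prop} (h : ∀ᵐ t, P t) (c : ℝ) : ∀ᵐ v, P (c - v) :=
  (Measure.measurePreserving_sub_left volume c).quasiMeasurePreserving.ae h

/-- `δ` and `R` depend only on the exponents, `V` and `η`, not on `n`, `m` or `G`; all uniformity in
the theorem comes from this order of quantifiers. -/
lemma exists_quadrant_estimate {α β p V η : ℝ} (hα : α ∈ Ioo (0 : ℝ) 1) (hβ : β ∈ Ioo (0 : ℝ) 1)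
    (hαβ : α + β < 1) (hp : 1 < p) (hV : 0 ≤ V) (hη : 0 < η) :
    ∃ δ > 0, ∃ R : ℕ, ∀ n m : ℕ, 1 ≤ n → 1 ≤ m → ∀ G : ℝ → ℝ → ℝ,
      (∀ᵐ t, IntervalIntegrable (G t) volume 0 Real.pi) →
      IntervalIntegrable (fun t => ∫ s in (0 : ℝ)..Real.pi, G t s * cesaroKernel (-β) m s) volume 0 Real.pi →
      (∀ s, IncVarLE (powLogSeq (α + β) p) V (fun t => G t s)) →
      (∀ t, IncVarLE (powLogSeq (α + β) p) V (G t)) →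
      (∀ t s, 0 < t → t ≤ (R + 1) * (Real.pi / n) → 0 < s → s ≤ (R + 1) * (Real.pi / m) → |G t s| ≤ δ) →
      |∫ t in (0 : ℝ)..Real.pi, (∫ s in (0 : ℝ)..Real.pi, G t s * cesaroKernel (-β) m s) *
        cesaroKernel (-α) n t| ≤ η := by
  obtain ⟨C₁, hC₁, hL₁⟩ := exists_kernelFunctional_isAdmissible hα
  obtain ⟨C₂, hC₂, hL₂⟩ := exists_kernelFunctional_isAdmissible hβ
  obtain ⟨W₁, hW₁, hw₁⟩ := exists_weight_mul_powLogSeq_le hα hβ hαβ (by linarith : 0 < p)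
  obtain ⟨W₂, hW₂, hw₂⟩ := exists_weight_mul_powLogSeq_le hβ hα (by linarith) (by linarith : 0 < p)
  set C := max C₁ C₂
  set W := max W₁ W₂
  have hC : 0 < C := lt_max_of_lt_left hC₁
  have hW : 0 < W := lt_max_of_lt_left hW₁
  have hlim : Tendsto (fun R : ℕ => C ^ 2 * (2 * (W * V * tailRate β p R) + 2 * (W * V * tailRate α p R) +
      4 * (2 * W * V * (tailSum β p R + tailSum α p R)))) atTop (𝓝 0) := by
    have := ((((tendsto_tailRate hβ hp).const_mul (W * V)).const_mul 2).add
      (((tendsto_tailRate hα hp).const_mul (W * V)).const_mul 2)).add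
      ((((tendsto_tailSum hβ hp).add (tendsto_tailSum hα hp)).const_mul (2 * W * V)).const_mul 4)
    simpa using this.const_mul (C ^ 2)
  -- `R` is fixed first, making the tails less than `η/2`; then `δ = η / (2Q)` makes the corner
  -- terms, whose total coefficient is `Q`, equal to `η/2`.
  obtain ⟨R, hR⟩ := (hlim.eventually (gt_mem_nhds (half_pos hη))).exists
  set Q : ℝ := C ^ 2 * (1 + 8 * R + 16 * R ^ 2) with hQ
  have hQ0 : 0 < Q := by positivity
  refine ⟨η / 2 / Q, by positivity, R, fun n m hn hm G hGi hΨ h1 h2 hG => ?_⟩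
  have hn0 : (0 : ℝ) < n := by exact_mod_cast hn
  have hm0 : (0 : ℝ) < m := by exact_mod_cast hm
  have hpi := Real.pi_pos
  have hh : 0 < Real.pi / n := by positivity
  have hh' : 0 < Real.pi / m := by positivity
  have hae : ∀ᵐ v, ∀ i : ℕ, IntervalIntegrable (G (((i : ℝ) + 1) * (Real.pi / n) - v)) volume 0 Real.pi :=
    ae_all_iff.2 fun i => ae_sub_left hGi _
  -- Slices `G t` are integrable only for almost every `t`, so `v` is chosen with all its sample
  -- points at good slices; for `u` almost every value suffices.
  obtain ⟨v, hv, hvmem⟩ : ∃ v, (∀ i : ℕ, IntervalIntegrable (G (((i : ℝ) + 1) * (Real.pi / n) - v))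
      volume 0 Real.pi) ∧ v ∈ Ioo 0 (Real.pi / n) := by
    obtain ⟨v, h1, h2⟩ := (Measure.dense_of_ae hae).exists_mem_open isOpen_Ioo (nonempty_Ioo.2 hh)
    exact ⟨v, h1, h2⟩
  refine abs_integral_mul_cesaroKernel_le α hn v hΨ ?_
  have hne : ∀ᵐ u : ℝ, u ≠ v := by simp [ae_iff]
  filter_upwards [hae, hne] with u hu huv humem
  set L := kernelFunctional α n u v with hL
  have hadm : L.IsAdmissible α C (Real.pi / n) :=
    (hL₁ n hn u humem v hvmem huv).mono (le_max_left _ _)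
  have hτ : IntervalIntegrable (G L.τ) volume 0 Real.pi := by
    have := hv 0
    simpa [hL, kernelFunctional] using this
  have hmm (i : ℕ) : IntervalIntegrable (G (((i : ℝ) + 1) * (Real.pi / n) - max u v)) volume 0 Real.pi ∧
      IntervalIntegrable (G (((i : ℝ) + 1) * (Real.pi / n) - min u v)) volume 0 Real.pi := by
    rcases le_total u v with h | h
    · rw [max_eq_right h, min_eq_left h]; exact ⟨hv i, hu i⟩
    · rw [max_eq_left h, min_eq_right h]; exact ⟨hu i, hv i⟩
  have ha (e : Fin 2) (i : ℕ) : IntervalIntegrable (G (L.a e i)) volume 0 Real.pi := by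
    fin_cases e
    · exact (hmm i).1
    · exact hv i
  have hb (e : Fin 2) (i : ℕ) : IntervalIntegrable (G (L.b e i)) volume 0 Real.pi := by
    fin_cases e
    · exact (hmm i).2
    · have := hv (i + 1)
      push_cast at this
      rwa [show (i : ℝ) + 1 + 1 = i + 2 by ring] at this
  have hK := (continuous_cesaroKernel (-β) m).continuousOn (s := uIcc 0 Real.pi)
  rw [L.eval_integral (G := fun t s => G t s * cesaroKernel (-β) m s) (hτ.mul_continuousOn hK)
    (fun e i => (ha e i).mul_continuousOn hK) (fun e i => (hb e i).mul_continuousOn hK)]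
  simp only [L.eval_mul_const]
  -- The inner functional needs no exceptional set beyond `u' ≠ v`, so the midpoint serves as its
  -- offset.
  refine abs_integral_mul_cesaroKernel_le β hm (Real.pi / m / 2) (L.intervalIntegrable_eval hτ ha hb) ?_
  have hne' : ∀ᵐ u' : ℝ, u' ≠ Real.pi / m / 2 := by simp [ae_iff]
  filter_upwards [hne'] with u' hu' humem'
  have hadm' : (kernelFunctional β m u' (Real.pi / m / 2)).IsAdmissible β C (Real.pi / m) :=
    (hL₂ m hm u' humem' _ ⟨by positivity, by linarith⟩ hu').mono (le_max_right _ _)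
  refine (abs_eval_eval_le hα hβ hp hW.le hV hC.le (by positivity : 0 ≤ η / 2 / Q) hh.le hh'.le
    (fun j l => (hw₁ j l).trans (mul_le_mul_of_nonneg_right (le_max_left _ _) (tailRate_pos _ _ _).le))
    (fun j l => (hw₂ j l).trans (mul_le_mul_of_nonneg_right (le_max_right _ _) (tailRate_pos _ _ _).le))
    h1 h2 hadm hadm' R hG).trans ?_
  have e : η / 2 / Q * Q = η / 2 := div_mul_cancel₀ _ hQ0.ne'
  have e2 : C ^ 2 * (η / 2 / Q + 2 * (2 * (η / 2 / Q) * R + W * V * tailRate β p R) +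
      2 * (2 * (η / 2 / Q) * R + W * V * tailRate α p R) +
      4 * (4 * (η / 2 / Q) * R ^ 2 + 2 * W * V * (tailSum β p R + tailSum α p R))) =
      η / 2 / Q * (C ^ 2 * (1 + 8 * R + 16 * R ^ 2)) + C ^ 2 * (2 * (W * V * tailRate β p R) + 2 * (W * V * tailRate α p R) +
      4 * (2 * W * V * (tailSum β p R + tailSum α p R))) := by ring
  rw [e2, ← hQ, e]
  linarith

/-! ### Variation of periodic functions over shifted families of intervals -/

lemma sum_le_of_lambdaVar_le {lam : ℕ → ℝ} {g : ℝ → ℝ} {V : ℝ} (hV : 0 ≤ V)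
    (hlam : ∀ i, 0 < lam (i + 1)) (h : lambdaVar lam g ≤ ENNReal.ofReal V) (n : ℕ) (a b : ℕ → ℝ)
    (ha : ∀ i < n, 0 ≤ a i) (hab : ∀ i < n, a i < b i) (hb : ∀ i < n, b i ≤ 2 * Real.pi)
    (hd : ∀ i < n, ∀ j < n, i ≠ j → b i ≤ a j ∨ b j ≤ a i) :
    ∑ i ∈ Finset.range n, |g (b i) - g (a i)| / lam (i + 1) ≤ V := by
  let E : IntervalCollection :=
    { n := n
      a := fun i => a i
      b := fun i => b i
      zero_le := fun i => ha i i.2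
      lt := fun i => hab i i.2
      le_two_pi := fun i => hb i i.2
      nonoverlapping := fun i j hij => by
        rw [Set.disjoint_left]
        intro x hx hx'
        rcases hd i i.2 j j.2 (fun h => hij (Fin.ext h)) with h | h
        · linarith [hx.2, hx'.1]
        · linarith [hx.1, hx'.2] }
  have h1 : ∑ i : Fin n, ENNReal.ofReal (|g (b i) - g (a i)| / lam ((i : ℕ) + 1)) ≤ ENNReal.ofReal V :=
    (le_iSup (fun E : IntervalCollection => ∑ i : Fin E.n,
      ENNReal.ofReal (|g (E.b i) - g (E.a i)| / lam ((i : ℕ) + 1))) E).trans h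
  rw [← ENNReal.ofReal_sum_of_nonneg fun (i : Fin n) _ => div_nonneg (abs_nonneg _) (hlam (i : ℕ)).le,
    ENNReal.ofReal_le_ofReal_iff hV] at h1
  rwa [Finset.sum_range]

/-- Families in an arbitrary interval of length `2π`; the interval containing a multiple of `2π`
in its interior is split in two. -/
lemma sum_le_of_periodic {lam : ℕ → ℝ} {g : ℝ → ℝ} {V : ℝ} (hV : 0 ≤ V)
    (hlam : ∀ i, 0 < lam (i + 1)) (h : lambdaVar lam g ≤ ENNReal.ofReal V)
    (hg : Function.Periodic g (2 * Real.pi)) (x₀ : ℝ) (n : ℕ) (a b : ℕ → ℝ)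
    (ha : ∀ i < n, x₀ ≤ a i) (hab : ∀ i < n, a i < b i) (hb : ∀ i < n, b i ≤ x₀ + 2 * Real.pi)
    (hd : ∀ i < n, ∀ j < n, i ≠ j → b i ≤ a j ∨ b j ≤ a i) :
    ∑ i ∈ Finset.range n, |g (b i) - g (a i)| / lam (i + 1) ≤ 2 * V := by
  wlog hx : x₀ ∈ Ico 0 (2 * Real.pi) generalizing x₀ a b with H
  · set k := toIcoDiv Real.two_pi_pos 0 x₀
    have h1 := toIcoMod_mem_Ico Real.two_pi_pos 0 x₀
    rw [toIcoMod, zero_add] at h1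
    have := H (x₀ - k • (2 * Real.pi)) (fun i => a i - k • (2 * Real.pi)) (fun i => b i - k • (2 * Real.pi))
      (fun i hi => by linarith [ha i hi]) (fun i hi => by linarith [hab i hi])
      (fun i hi => by linarith [hb i hi])
      (fun i hi j hj hij => (hd i hi j hj hij).imp (fun h => by linarith) (fun h => by linarith)) h1
    simpa only [hg.sub_zsmul_eq] using this
  obtain ⟨hx0, hx1⟩ := hx
  set P := 2 * Real.pi with hP
  -- Two families in `[0, 2π]`, each keeping every interval at its original rank: `t1` carries the
  -- part of the straddling interval left of `2π`, `t2` the part right of it. Their sum dominates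
  -- the given one, hence `2V`.
  have t1 := sum_le_of_lambdaVar_le hV hlam h n (fun i => if P ≤ a i then a i - P else a i)
    (fun i => if P ≤ a i then b i - P else min (b i) P)
    (fun i hi => by have := ha i hi; split_ifs <;> linarith)
    (fun i hi => by
      have := hab i hi
      split_ifs with h
      · linarith
      · exact lt_min this (not_le.1 h))
    (fun i hi => by
      have := hb i hi
      split_ifs
      · linarith
      · exact min_le_right _ _)
    (fun i hi j hj hij => by
      have := hd i hi j hj hij
      have a1 := ha i hi
      have a2 := ha j hj
      have b1 := hb i hi
      have b2 := hb j hj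
      split_ifs
      · exact this.imp (fun h => by linarith) (fun h => by linarith)
      · exact Or.inl (by linarith)
      · exact Or.inr (by linarith)
      · exact this.imp (fun h => (min_le_left _ _).trans h) (fun h => (min_le_left _ _).trans h))
  have t2 := sum_le_of_lambdaVar_le hV hlam h n (fun i => if b i ≤ P then a i else max (a i) P - P)
    (fun i => if b i ≤ P then b i else b i - P)
    (fun i hi => by
      have := ha i hi
      split_ifs
      · linarith
      · linarith [le_max_right (a i) P])
    (fun i hi => by
      have := hab i hi
      split_ifs with h
      · linarith
      · have := max_lt this (not_le.1 h)
        linarith)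
    (fun i hi => by
      have := hb i hi
      split_ifs <;> linarith)
    (fun i hi j hj hij => by
      have := hd i hi j hj hij
      have a1 := ha i hi
      have a2 := ha j hj
      have b1 := hb i hi
      have b2 := hb j hj
      split_ifs
      · exact this
      · exact Or.inr (by linarith)
      · exact Or.inl (by linarith)
      · exact this.imp (fun h => by linarith [le_max_left (a j) P]) (fun h => by linarith [le_max_left (a i) P]))
  refine le_trans ?_ ((add_le_add t1 t2).trans_eq (two_mul V).symm)
  rw [← Finset.sum_add_distrib]
  refine Finset.sum_le_sum fun i hi => ?_
  rw [← add_div]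
  refine div_le_div_of_nonneg_right ?_ (hlam i).le
  have hab' := hab i (Finset.mem_range.1 hi)
  by_cases h1 : P ≤ a i
  · rw [if_pos h1, if_pos h1, hg.sub_eq, hg.sub_eq]
    exact le_add_of_nonneg_right (abs_nonneg _)
  · by_cases h2 : b i ≤ P
    · rw [if_neg h1, if_neg h1, min_eq_left h2]
      exact le_add_of_nonneg_right (abs_nonneg _)
    · rw [if_neg h1, if_neg h1, if_neg h2, if_neg h2, min_eq_right (not_le.1 h2).le,
        max_eq_right (not_le.1 h1).le, hg.sub_eq, sub_self]
      have h0 : g P = g 0 := by simpa using hg 0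
      rw [h0, add_comm]
      exact abs_sub_le _ _ _

lemma le_of_consecutive {n : ℕ} {a b : ℕ → ℝ} (hab : ∀ i < n, a i < b i)
    (hc : ∀ i, i + 1 < n → b i ≤ a (i + 1)) {i j : ℕ} (hij : i < j) (hj : j < n) : b i ≤ a j := by
  induction j with
  | zero => omega
  | succ j ih =>
    rcases Nat.lt_succ_iff_lt_or_eq.1 hij with h | rfl
    · exact ((ih h (by omega)).trans (hab j (by omega)).le).trans (hc j hj)
    · exact hc i hj

lemma incVarLE_add {lam : ℕ → ℝ} {g : ℝ → ℝ} {V : ℝ} (hV : 0 ≤ V)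
    (hlam : ∀ i, 0 < lam (i + 1)) (h : lambdaVar lam g ≤ ENNReal.ofReal V)
    (hg : Function.Periodic g (2 * Real.pi)) (x : ℝ) : IncVarLE lam (2 * V) (fun t => g (x + t)) := by
  intro n a b hab hc
  have hle {i j : ℕ} (hij : i < j) (hj : j < n) : b i ≤ a j :=
    le_of_consecutive (fun i hi => (hab i hi).2.1) hc hij hj
  refine sum_le_of_periodic hV hlam h hg x n (fun i => x + a i) (fun i => x + b i)
    (fun i hi => by linarith [(hab i hi).1]) (fun i hi => by linarith [(hab i hi).2.1])
    (fun i hi => by linarith [(hab i hi).2.2]) (fun i hi j hj hij => ?_)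
  rcases lt_or_gt_of_ne hij with h | h
  · exact Or.inl (by linarith [hle h hj])
  · exact Or.inr (by linarith [hle h hi])

lemma incVarLE_sub {lam : ℕ → ℝ} {g : ℝ → ℝ} {V : ℝ} (hV : 0 ≤ V)
    (hlam : ∀ i, 0 < lam (i + 1)) (h : lambdaVar lam g ≤ ENNReal.ofReal V)
    (hg : Function.Periodic g (2 * Real.pi)) (x : ℝ) : IncVarLE lam (2 * V) (fun t => g (x - t)) := by
  intro n a b hab hc
  have hle {i j : ℕ} (hij : i < j) (hj : j < n) : b i ≤ a j :=
    le_of_consecutive (fun i hi => (hab i hi).2.1) hc hij hj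
  have := sum_le_of_periodic hV hlam h hg (x - 2 * Real.pi) n (fun i => x - b i) (fun i => x - a i)
    (fun i hi => by linarith [(hab i hi).2.2]) (fun i hi => by linarith [(hab i hi).2.1])
    (fun i hi => by linarith [(hab i hi).1]) (fun i hi j hj hij => by
      rcases lt_or_gt_of_ne hij with h | h
      · exact Or.inr (by linarith [hle h hj])
      · exact Or.inl (by linarith [hle h hi]))
  refine le_trans (Finset.sum_le_sum fun i _ => ?_) this
  rw [abs_sub_comm]

lemma IncVarLE.sub_const {lam : ℕ → ℝ} {g : ℝ → ℝ} {V : ℝ} (h : IncVarLE lam V g) (c : ℝ) :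
    IncVarLE lam V (fun t => g t - c) := by
  intro n a b hab hc
  simpa using h n a b hab hc

/-- `x + t` for `e = true` and `x - t` for `e = false`. -/
def dir (e : Bool) (x t : ℝ) : ℝ := if e then x + t else x - t

lemma incVarLE_dir {lam : ℕ → ℝ} {g : ℝ → ℝ} {V : ℝ} (hV : 0 ≤ V)
    (hlam : ∀ i, 0 < lam (i + 1)) (h : lambdaVar lam g ≤ ENNReal.ofReal V)
    (hg : Function.Periodic g (2 * Real.pi)) (e : Bool) (x : ℝ) :
    IncVarLE lam (2 * V) (fun t => g (dir e x t)) := by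
  cases e
  · simpa [dir] using incVarLE_sub hV hlam h hg x
  · simpa [dir] using incVarLE_add hV hlam h hg x

lemma IsBiperiodic.periodic_fst {f : ℝ × ℝ → ℝ} (hf : IsBiperiodic f) (y : ℝ) :
    Function.Periodic (fun x => f (x, y)) (2 * Real.pi) := fun x => (hf x y).1

lemma IsBiperiodic.periodic_snd {f : ℝ × ℝ → ℝ} (hf : IsBiperiodic f) (x : ℝ) :
    Function.Periodic (fun y => f (x, y)) (2 * Real.pi) := fun y => (hf x y).2

lemma MemPLambdaBV.exists_bound {lam : ℕ → ℝ} {f : ℝ × ℝ → ℝ} (hf : IsBiperiodic f)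
    (h : MemPLambdaBV lam f) : ∃ V : ℝ, 0 ≤ V ∧
      (∀ y, lambdaVar lam (fun x => f (x, y)) ≤ ENNReal.ofReal V) ∧
      (∀ x, lambdaVar lam (fun y => f (x, y)) ≤ ENNReal.ofReal V) := by
  have hne : lambdaVar₁ lam f + lambdaVar₂ lam f ≠ ⊤ := h.ne
  refine ⟨(lambdaVar₁ lam f + lambdaVar₂ lam f).toReal, ENNReal.toReal_nonneg, fun y => ?_, fun x => ?_⟩
  · rw [ENNReal.ofReal_toReal hne]
    have hmem := Ico_subset_Icc_self (toIcoMod_mem_Ico Real.two_pi_pos 0 y)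
    rw [zero_add] at hmem
    have hy : (fun x => f (x, y)) = fun x => f (x, toIcoMod Real.two_pi_pos 0 y) := by
      ext x
      exact ((hf.periodic_snd x).sub_zsmul_eq _).symm
    rw [hy]
    exact (le_iSup₂ (f := fun y (_ : y ∈ Icc (0 : ℝ) (2 * Real.pi)) => lambdaVar lam fun x => f (x, y)) _ hmem).trans
      le_self_add
  · rw [ENNReal.ofReal_toReal hne]
    have hmem := Ico_subset_Icc_self (toIcoMod_mem_Ico Real.two_pi_pos 0 x)
    rw [zero_add] at hmem
    have hx : (fun y => f (x, y)) = fun y => f (toIcoMod Real.two_pi_pos 0 x, y) := by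
      ext y
      exact ((hf.periodic_fst y).sub_zsmul_eq _).symm
    rw [hx]
    exact (le_iSup₂ (f := fun x (_ : x ∈ Icc (0 : ℝ) (2 * Real.pi)) => lambdaVar lam fun y => f (x, y)) _ hmem).trans
      le_add_self

/-! ### Integral representation of the Cesàro means -/

lemma sum_exp_eq_dirichletKernel (M : ℕ) (u : ℝ) :
    ∑ k ∈ Finset.Icc (-(M : ℤ)) M, Complex.exp (Complex.I * k * u) = (2 * dirichletKernel M u : ℝ) := by
  induction M with
  | zero => simp [dirichletKernel]
  | succ M ih =>
    have h : Finset.Icc (-((M + 1 : ℕ) : ℤ)) ((M + 1 : ℕ) : ℤ) =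
        insert ((M : ℤ) + 1) (insert (-((M : ℤ) + 1)) (Finset.Icc (-(M : ℤ)) M)) := by
      ext k; simp only [Finset.mem_Icc, Finset.mem_insert]; push_cast; omega
    rw [h, Finset.sum_insert (by simp; omega), Finset.sum_insert (by simp), ih]
    have hd : dirichletKernel (M + 1) u = dirichletKernel M u + Real.cos ((M + 1) * u) := by
      simp [dirichletKernel, Finset.sum_range_succ]; ring
    rw [hd]
    push_cast
    rw [Complex.cos]
    ring_nf

lemma isCompact_square : IsCompact square := isCompact_Icc.prod isCompact_Icc

lemma rectPartialSum_eq {f : ℝ × ℝ → ℝ} (hf : IntegrableOn f square volume) (M N : ℕ) (p : ℝ × ℝ) :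
    rectPartialSum f M N p = (1 / Real.pi ^ 2 * ∫ q in square,
      f q * (dirichletKernel M (p.1 - q.1) * dirichletKernel N (p.2 - q.2)) : ℝ) := by
  have hfC : IntegrableOn (fun q => (f q : ℂ)) square volume := hf.ofReal
  have hint (k l : ℤ) : IntegrableOn (fun q : ℝ × ℝ => (f q : ℂ) *
      (Complex.exp (Complex.I * k * (p.1 - q.1 : ℝ)) * Complex.exp (Complex.I * l * (p.2 - q.2 : ℝ))))
      square volume := by
    refine hfC.mul_continuousOn (Continuous.continuousOn ?_) isCompact_square
    fun_prop
  have h1 (k l : ℤ) : fourierCoeff₂ f k l * Complex.exp (Complex.I * k * p.1) *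
      Complex.exp (Complex.I * l * p.2) = (1 / (4 * (Real.pi : ℂ) ^ 2)) * ∫ q in square, (f q : ℂ) *
      (Complex.exp (Complex.I * k * (p.1 - q.1 : ℝ)) * Complex.exp (Complex.I * l * (p.2 - q.2 : ℝ))) := by
    rw [fourierCoeff₂, mul_assoc, mul_assoc, ← integral_mul_const]
    congr 2
    ext q
    have e1 : Complex.exp (Complex.I * k * (p.1 - q.1 : ℝ)) =
        Complex.exp (-(Complex.I * k * q.1)) * Complex.exp (Complex.I * k * p.1) := by
      rw [← Complex.exp_add]; push_cast; ring_nf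
    have e2 : Complex.exp (Complex.I * l * (p.2 - q.2 : ℝ)) =
        Complex.exp (-(Complex.I * l * q.2)) * Complex.exp (Complex.I * l * p.2) := by
      rw [← Complex.exp_add]; push_cast; ring_nf
    rw [e1, e2]
    ring
  simp only [rectPartialSum, h1, ← Finset.mul_sum]
  rw [Finset.sum_congr rfl fun k _ => (integral_finsetSum _ fun l _ => hint k l).symm,
    ← integral_finsetSum _ fun k _ => integrable_finsetSum _ fun l _ => hint k l]
  simp only [← Finset.mul_sum, ← Finset.sum_mul, sum_exp_eq_dirichletKernel]
  push_cast
  rw [← integral_complex_ofReal, ← integral_const_mul, ← integral_const_mul]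
  congr 1
  ext q
  push_cast
  ring

lemma cesaroMean_eq {f : ℝ × ℝ → ℝ} (hf : IntegrableOn f square volume) (a b : ℝ) (n m : ℕ) (p : ℝ × ℝ) :
    cesaroMean a b f n m p = (1 / Real.pi ^ 2 * ∫ q in square,
      f q * (cesaroKernel a n (p.1 - q.1) * cesaroKernel b m (p.2 - q.2)) : ℝ) := by
  have hint (i j : ℕ) : IntegrableOn (fun q : ℝ × ℝ => f q *
      (dirichletKernel i (p.1 - q.1) * dirichletKernel j (p.2 - q.2))) square volume := by
    refine hf.mul_continuousOn (Continuous.continuousOn ?_) isCompact_square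
    fun_prop
  have hint' (i j : ℕ) := (hint i j).const_mul (cesaroNumber (a - 1) (n - i) * cesaroNumber (b - 1) (m - j))
  have h1 (i j : ℕ) : (cesaroNumber (a - 1) (n - i) : ℂ) * (cesaroNumber (b - 1) (m - j) : ℂ) *
      rectPartialSum f i j p = ((1 / Real.pi ^ 2 * ∫ q in square,
        cesaroNumber (a - 1) (n - i) * cesaroNumber (b - 1) (m - j) * (f q *
      (dirichletKernel i (p.1 - q.1) * dirichletKernel j (p.2 - q.2))) : ℝ) : ℂ) := by
    rw [rectPartialSum_eq hf, integral_const_mul]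
    push_cast
    ring
  simp only [cesaroMean, h1, ← Complex.ofReal_sum]
  rw [Finset.sum_congr rfl fun i _ => (Finset.mul_sum _ _ _).symm, ← Finset.mul_sum,
    Finset.sum_congr rfl fun i _ => (integral_finsetSum _ fun j _ => hint' i j).symm,
    ← integral_finsetSum _ fun k _ => integrable_finsetSum _ fun l _ => hint' k l]
  norm_cast
  rw [← mul_assoc, mul_comm (1 / cesaroNumber a n * _), mul_assoc, ← integral_const_mul]
  congr 2
  ext q
  rw [cesaroKernel, cesaroKernel, div_mul_div_comm, div_mul_div_comm, Finset.sum_mul_sum]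
  simp only [Finset.mul_sum, mul_div_assoc', Finset.sum_div]
  refine Finset.sum_congr rfl fun i _ => Finset.sum_congr rfl fun j _ => ?_
  ring

/-! ### Folding to the four quadrants -/

lemma integral_periodic_mul_even {ϕ K : ℝ → ℝ} (hϕ : Function.Periodic ϕ (2 * Real.pi))
    (hϕi : IntervalIntegrable ϕ volume 0 (2 * Real.pi)) (hK : Function.Periodic K (2 * Real.pi))
    (hKc : Continuous K) (hKe : ∀ t, K (-t) = K t) (x : ℝ) :
    ∫ t in (0 : ℝ)..(2 * Real.pi), ϕ t * K (x - t) =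
      ∑ e, ∫ t in (0 : ℝ)..Real.pi, ϕ (dir e x t) * K t := by
  have hper : Function.Periodic (fun t => ϕ t * K (x - t)) (2 * Real.pi) := by
    intro t
    simp only
    rw [hϕ t, show x - (t + 2 * Real.pi) = x - t - 2 * Real.pi by ring, hK.sub_eq]
  have hi (u v : ℝ) : IntervalIntegrable (fun t => ϕ t * K (x - t)) volume u v :=
    (hϕ.intervalIntegrable₀ Real.two_pi_pos.ne' hϕi u v).mul_continuousOn
      (Continuous.continuousOn (by fun_prop))
  have h0 := hper.intervalIntegral_add_eq 0 (x - Real.pi)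
  rw [zero_add, show x - Real.pi + 2 * Real.pi = x + Real.pi by ring] at h0
  rw [h0, ← intervalIntegral.integral_add_adjacent_intervals (hi (x - Real.pi) x) (hi x _),
    Fintype.sum_bool, add_comm]
  congr 1
  · have := intervalIntegral.integral_comp_add_left (a := 0) (b := Real.pi) (fun t => ϕ t * K (x - t)) x
    rw [add_zero] at this
    rw [← this]
    refine intervalIntegral.integral_congr fun t _ => ?_
    simp only [dir, if_true]
    rw [← hKe t]; ring_nf
  · have := intervalIntegral.integral_comp_sub_left (a := 0) (b := Real.pi) (fun t => ϕ t * K (x - t)) x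
    rw [sub_zero] at this
    rw [← this]
    refine intervalIntegral.integral_congr fun t _ => ?_
    simp [dir]

lemma measurePreserving_dir (e : Bool) (x : ℝ) : MeasurePreserving (dir e x) volume volume := by
  cases e
  · have : dir false x = fun t => x - t := by ext; simp [dir]
    rw [this]; exact Measure.measurePreserving_sub_left volume x
  · have : dir true x = fun t => x + t := by ext; simp [dir]
    rw [this]; exact measurePreserving_add_left volume x

lemma measurableEmbedding_dir (e : Bool) (x : ℝ) : MeasurableEmbedding (dir e x) := by
  cases e
  · have : dir false x = MeasurableEquiv.subLeft x := by ext; simp [dir]; rfl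
    rw [this]; exact (MeasurableEquiv.subLeft x).measurableEmbedding
  · have : dir true x = MeasurableEquiv.addLeft x := by ext; simp [dir]
    rw [this]; exact (MeasurableEquiv.addLeft x).measurableEmbedding

@[fun_prop]
lemma continuous_dir (e : Bool) (x : ℝ) : Continuous (dir e x) := by
  cases e
  · have : dir false x = fun t => x - t := by ext; simp [dir]
    rw [this]; fun_prop
  · have : dir true x = fun t => x + t := by ext; simp [dir]
    rw [this]; fun_prop

lemma intervalIntegrable_comp_dir {ϕ : ℝ → ℝ} (h : ∀ a b, IntervalIntegrable ϕ volume a b) (e : Bool)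
    (x a b : ℝ) : IntervalIntegrable (fun t => ϕ (dir e x t)) volume a b := by
  cases e
  · have := (h (x - a) (x - b)).comp_sub_left x
    simpa [dir] using this
  · have := (h (x + a) (x + b)).comp_add_left x
    simpa [dir] using this

section Periodic

variable {f : ℝ × ℝ → ℝ} (hf : IsBiperiodic f) (hfi : IntegrableOn f square volume)
include hf hfi

lemma IsBiperiodic.integrableOn_isCompact {k : Set (ℝ × ℝ)} (hk : IsCompact k) :
    IntegrableOn f k volume := by
  obtain ⟨r, hr⟩ := hk.isBounded.subset_closedBall 0
  obtain ⟨N, hN⟩ := exists_nat_gt (r / (2 * Real.pi))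
  rw [div_lt_iff₀ Real.two_pi_pos] at hN
  have hcell (c : ℤ × ℤ) : IntegrableOn f ((fun q : ℝ × ℝ =>
      q - (c.1 * (2 * Real.pi), c.2 * (2 * Real.pi))) ⁻¹' square) volume := by
    have hmp := measurePreserving_sub_right (volume : Measure (ℝ × ℝ))
      ((c.1 * (2 * Real.pi), c.2 * (2 * Real.pi)) : ℝ × ℝ)
    have := (hmp.integrableOn_comp_preimage (measurableEmbedding_subRight _) (f := f) (s := square)).2 hfi
    have e : f ∘ (fun q : ℝ × ℝ => q - (c.1 * (2 * Real.pi), c.2 * (2 * Real.pi))) = f := by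
      ext ⟨x, y⟩
      have h1 := (hf.periodic_fst (y - c.2 * (2 * Real.pi))).sub_int_mul_eq c.1 (x := x)
      have h2 := (hf.periodic_snd x).sub_int_mul_eq c.2 (x := y)
      exact h1.trans h2
    rwa [e] at this
  have hun := (integrableOn_finset_iUnion (μ := volume) (f := f)
    (s := Finset.Icc (-(N : ℤ)) N ×ˢ Finset.Icc (-(N : ℤ)) N)).2 fun c _ => hcell c
  refine hun.mono_set fun q hq => ?_
  have hq' := hr hq
  rw [mem_closedBall_zero_iff, Prod.norm_def, max_le_iff, Real.norm_eq_abs, Real.norm_eq_abs] at hq'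
  have key (t : ℝ) (ht : |t| ≤ r) : ⌊t / (2 * Real.pi)⌋ ∈ Finset.Icc (-(N : ℤ)) N ∧
      t - ⌊t / (2 * Real.pi)⌋ * (2 * Real.pi) ∈ Icc 0 (2 * Real.pi) := by
    have h1 := Int.floor_le (t / (2 * Real.pi))
    have h2 := (Int.lt_floor_add_one (t / (2 * Real.pi))).le
    rw [le_div_iff₀ Real.two_pi_pos] at h1
    rw [div_le_iff₀ Real.two_pi_pos] at h2
    refine ⟨Finset.mem_Icc.2 ⟨Int.le_floor.2 ?_, Int.cast_le.1 ((Int.floor_le _).trans ?_)⟩, by linarith, by linarith⟩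
    · rw [le_div_iff₀ Real.two_pi_pos]; push_cast; linarith [(abs_le.1 ht).1]
    · rw [div_le_iff₀ Real.two_pi_pos]; push_cast; linarith [(abs_le.1 ht).2]
  obtain ⟨a1, a2⟩ := key q.1 hq'.1
  obtain ⟨b1, b2⟩ := key q.2 hq'.2
  simp only [mem_iUnion]
  exact ⟨(⌊q.1 / (2 * Real.pi)⌋, ⌊q.2 / (2 * Real.pi)⌋), Finset.mem_product.2 ⟨a1, b1⟩, ⟨a2, b2⟩⟩

lemma IsBiperiodic.integrable_comp_dir (e e' : Bool) (x y a b c d : ℝ) :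
    Integrable (fun q : ℝ × ℝ => f (dir e x q.1, dir e' y q.2))
      ((volume.restrict (Ioc a b)).prod (volume.restrict (Ioc c d))) := by
  rw [Measure.prod_restrict]
  have hmp := (measurePreserving_dir e x).prod (measurePreserving_dir e' y)
  have hme := (measurableEmbedding_dir e x).prodMap (measurableEmbedding_dir e' y)
  have hc : Continuous (Prod.map (dir e x) (dir e' y)) := by fun_prop
  have hk := hf.integrableOn_isCompact hfi (((isCompact_Icc (a := a) (b := b)).prod
    (isCompact_Icc (a := c) (b := d))).image hc)
  have := (hmp.integrableOn_comp_preimage hme (f := f)).2 hk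
  exact this.mono_set ((Set.prod_mono Ioc_subset_Icc_self Ioc_subset_Icc_self).trans (subset_preimage_image _ _))

/-- Fubini on each of countably many strips of width `2π`; periodicity then extends integrability of
the slice from one period to all intervals. -/
lemma IsBiperiodic.ae_intervalIntegrable :
    ∀ᵐ t, ∀ a b, IntervalIntegrable (fun s => f (t, s)) volume a b := by
  have h1 (k : ℤ) : ∀ᵐ t, t ∈ Ioc (k * (2 * Real.pi)) (k * (2 * Real.pi) + 2 * Real.pi) →
      ∀ a b, IntervalIntegrable (fun s => f (t, s)) volume a b := by
    have := (hf.integrable_comp_dir hfi true true 0 0 (k * (2 * Real.pi)) (k * (2 * Real.pi) + 2 * Real.pi) 0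
      (2 * Real.pi)).prod_right_ae
    rw [ae_restrict_iff' measurableSet_Ioc] at this
    filter_upwards [this] with t ht hmem
    refine (hf.periodic_snd t).intervalIntegrable₀ Real.two_pi_pos.ne' ?_
    rw [intervalIntegrable_iff_integrableOn_Ioc_of_le Real.two_pi_pos.le]
    have h := ht hmem
    simp only [dir, if_true, zero_add] at h
    exact h
  filter_upwards [ae_all_iff.2 h1] with t ht
  have hm := toIocMod_mem_Ioc Real.two_pi_pos 0 t
  rw [toIocMod, zero_add, zsmul_eq_mul] at hm
  exact ht (toIocDiv Real.two_pi_pos 0 t) ⟨by linarith [hm.1], by linarith [hm.2]⟩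

lemma IsBiperiodic.ae_intervalIntegrable_dir (e e' : Bool) (x y : ℝ) :
    ∀ᵐ t, ∀ a b, IntervalIntegrable (fun s => f (dir e x t, dir e' y s)) volume a b := by
  filter_upwards [(measurePreserving_dir e x).quasiMeasurePreserving.ae (hf.ae_intervalIntegrable hfi)]
    with t ht a b
  exact intervalIntegrable_comp_dir ht e' y a b

lemma IsBiperiodic.intervalIntegrable_integral (e e' : Bool) (x y a b : ℝ) (hab : a ≤ b) {K : ℝ → ℝ}
    (hK : Continuous K) :
    IntervalIntegrable (fun t => ∫ s in (0 : ℝ)..Real.pi, f (dir e x t, dir e' y s) * K s) volume a b := by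
  rw [intervalIntegrable_iff_integrableOn_Ioc_of_le hab]
  simp only [intervalIntegral.integral_of_le Real.pi_pos.le]
  have h := hf.integrable_comp_dir hfi e e' x y a b 0 Real.pi
  obtain ⟨C, hC⟩ := (isCompact_Icc (a := (0 : ℝ)) (b := Real.pi)).exists_bound_of_continuousOn hK.continuousOn
  have h2 : Integrable (fun q : ℝ × ℝ => f (dir e x q.1, dir e' y q.2) * K q.2)
      ((volume.restrict (Ioc a b)).prod (volume.restrict (Ioc 0 Real.pi))) := by
    refine h.mul_bdd (c := C) (by fun_prop) ?_
    rw [Measure.prod_restrict, ae_restrict_iff' (measurableSet_Ioc.prod measurableSet_Ioc)]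
    exact Eventually.of_forall fun q hq => hC _ (Ioc_subset_Icc_self hq.2)
  exact h2.integral_prod_left

lemma cesaroMean_eq_sum_quadrants (a b : ℝ) (n m : ℕ) (x y : ℝ) :
    cesaroMean a b f n m (x, y) = (1 / Real.pi ^ 2 * ∑ e, ∑ e', ∫ t in (0 : ℝ)..Real.pi,
      (∫ s in (0 : ℝ)..Real.pi, f (dir e x t, dir e' y s) * cesaroKernel b m s) *
        cesaroKernel a n t : ℝ) := by
  rw [cesaroMean_eq hfi]
  congr 2
  have hint : IntegrableOn (fun q : ℝ × ℝ => f q *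
      (cesaroKernel a n (x - q.1) * cesaroKernel b m (y - q.2))) square (volume.prod volume) := by
    refine hfi.mul_continuousOn (Continuous.continuousOn ?_) isCompact_square
    fun_prop
  have h1 := setIntegral_prod _ hint
  have hΨ (e' : Bool) : IntervalIntegrable (fun t => ∫ s in (0 : ℝ)..Real.pi,
      f (t, dir e' y s) * cesaroKernel b m s) volume 0 (2 * Real.pi) := by
    have := hf.intervalIntegrable_integral hfi true e' 0 y 0 (2 * Real.pi) Real.two_pi_pos.le
      (continuous_cesaroKernel b m)
    simpa [dir] using this
  calc _ = ∫ t in (0 : ℝ)..(2 * Real.pi), ∫ s in (0 : ℝ)..(2 * Real.pi), f (t, s) *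
      (cesaroKernel a n (x - t) * cesaroKernel b m (y - s)) := by
        rw [intervalIntegral.integral_of_le Real.two_pi_pos.le, ← integral_Icc_eq_integral_Ioc]
        simp only [intervalIntegral.integral_of_le Real.two_pi_pos.le, ← integral_Icc_eq_integral_Ioc]
        exact h1
    _ = ∫ t in (0 : ℝ)..(2 * Real.pi), ∑ e', (∫ s in (0 : ℝ)..Real.pi,
        f (t, dir e' y s) * cesaroKernel b m s) * cesaroKernel a n (x - t) := by
        refine intervalIntegral.integral_congr_ae ?_
        filter_upwards [hf.ae_intervalIntegrable hfi] with t ht _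
        rw [← Finset.sum_mul, ← integral_periodic_mul_even (hf.periodic_snd t) (ht _ _)
          (cesaroKernel_periodic b m) (continuous_cesaroKernel b m) (cesaroKernel_neg b m) y,
          ← intervalIntegral.integral_mul_const]
        congr 1
        ext s
        ring
    _ = ∑ e', ∑ e, ∫ t in (0 : ℝ)..Real.pi, (∫ s in (0 : ℝ)..Real.pi,
        f (dir e x t, dir e' y s) * cesaroKernel b m s) * cesaroKernel a n t := by
        rw [intervalIntegral.integral_finsetSum fun e' _ =>
          (hΨ e').mul_continuousOn (Continuous.continuousOn (by fun_prop))]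
        refine Finset.sum_congr rfl fun e' _ => ?_
        refine integral_periodic_mul_even (ϕ := fun t => ∫ s in (0 : ℝ)..Real.pi,
          f (t, dir e' y s) * cesaroKernel b m s) (fun t => ?_) (hΨ e')
          (cesaroKernel_periodic a n) (continuous_cesaroKernel a n) (cesaroKernel_neg a n) x
        simp only [(hf _ _).1]
    _ = _ := Finset.sum_comm

end Periodic

/-! ### Convergence -/

lemma eventually_corner_lt {r : ℝ} (hr : 0 < r) (R : ℕ) : ∀ᶠ n : ℕ in atTop,
    1 ≤ n ∧ ((R : ℝ) + 1) * (Real.pi / n) < r := by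
  have : Tendsto (fun n : ℕ => ((R : ℝ) + 1) * (Real.pi / n)) atTop (𝓝 0) := by
    simpa using (tendsto_const_div_atTop_nhds_zero_nat Real.pi).const_mul ((R : ℝ) + 1)
  exact (eventually_ge_atTop 1).and (this.eventually (gt_mem_nhds hr))

section Convergence

variable {α β p : ℝ} (hα : α ∈ Ioo (0 : ℝ) 1) (hβ : β ∈ Ioo (0 : ℝ) 1) (hαβ : α + β < 1) (hp : 1 < p)
  {f : ℝ × ℝ → ℝ} (hf : IsBiperiodic f) (hfi : IntegrableOn f square volume)
  (hfv : MemPLambdaBV (powLogSeq (α + β) p) f)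
include hα hβ hαβ hp hf hfi hfv

/-- The two kernels have product mass `π²/4` on each quadrant, so subtracting the constant `ℓ e e'`
there removes the expected limit. The point `(x, y)` is quantified after `δ` and `R`. -/
lemma exists_cesaroMean_estimate {η : ℝ} (hη : 0 < η) : ∃ δ > 0, ∃ R : ℕ, ∀ n m : ℕ, 1 ≤ n → 1 ≤ m →
    ∀ (x y : ℝ) (ℓ : Bool → Bool → ℝ), (∀ e e' t s, 0 < t → t ≤ (R + 1) * (Real.pi / n) → 0 < s →
      s ≤ (R + 1) * (Real.pi / m) → |f (dir e x t, dir e' y s) - ℓ e e'| ≤ δ) →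
    ‖cesaroMean (-α) (-β) f n m (x, y) - ((1 / 4 * ∑ e, ∑ e', ℓ e e' : ℝ) : ℂ)‖ ≤ η := by
  obtain ⟨V, hV, hV1, hV2⟩ := hfv.exists_bound hf
  have hpi := Real.pi_pos
  obtain ⟨δ, hδ, R, hR⟩ := exists_quadrant_estimate hα hβ hαβ hp (by positivity : 0 ≤ 2 * V)
    (by positivity : 0 < η * Real.pi ^ 2 / 4)
  refine ⟨δ, hδ, R, fun n m hn hm x y ℓ hℓ => ?_⟩
  have hlam := fun i => powLogSeq_succ_pos (α + β) p i
  have hKm : Continuous (cesaroKernel (-β) m) := continuous_cesaroKernel _ _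
  have hKn : Continuous (cesaroKernel (-α) n) := continuous_cesaroKernel _ _
  have hIm : ∫ s in (0 : ℝ)..Real.pi, cesaroKernel (-β) m s = Real.pi / 2 :=
    integral_cesaroKernel (cesaroNumber_neg_pos hβ m).ne'
  have hIn : ∫ s in (0 : ℝ)..Real.pi, cesaroKernel (-α) n s = Real.pi / 2 :=
    integral_cesaroKernel (cesaroNumber_neg_pos hα n).ne'
  have hslice (e e' : Bool) := hf.ae_intervalIntegrable_dir hfi e e' x y
  have hinner (e e' : Bool) : ∀ᵐ t, ∫ s in (0 : ℝ)..Real.pi,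
      (f (dir e x t, dir e' y s) - ℓ e e') * cesaroKernel (-β) m s =
      (∫ s in (0 : ℝ)..Real.pi, f (dir e x t, dir e' y s) * cesaroKernel (-β) m s) - ℓ e e' * (Real.pi / 2) := by
    filter_upwards [hslice e e'] with t ht
    rw [← hIm, ← intervalIntegral.integral_const_mul, ← intervalIntegral.integral_sub
      ((ht _ _).mul_continuousOn hKm.continuousOn) ((hKm.intervalIntegrable _ _).const_mul _)]
    congr 1
    ext s; ring
  have hΨ (e e' : Bool) := hf.intervalIntegrable_integral hfi e e' x y 0 Real.pi hpi.le hKm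
  have hΨ' (e e' : Bool) : IntervalIntegrable (fun t => ∫ s in (0 : ℝ)..Real.pi,
      (f (dir e x t, dir e' y s) - ℓ e e') * cesaroKernel (-β) m s) volume 0 Real.pi := by
    refine ((hΨ e e').sub (intervalIntegrable_const (c := ℓ e e' * (Real.pi / 2)))).congr_ae ?_
    filter_upwards [ae_restrict_of_ae (hinner e e')] with t ht
    exact ht.symm
  have hquad (e e' : Bool) := hR n m hn hm (fun t s => f (dir e x t, dir e' y s) - ℓ e e')
    (by filter_upwards [hslice e e'] with t ht using (ht _ _).sub intervalIntegrable_const) (hΨ' e e')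
    (fun s => (incVarLE_dir hV hlam (hV1 (dir e' y s)) (hf.periodic_fst _) e x).sub_const _)
    (fun t => (incVarLE_dir hV hlam (hV2 (dir e x t)) (hf.periodic_snd _) e' y).sub_const _)
    (hℓ e e')
  have houter (e e' : Bool) : ∫ t in (0 : ℝ)..Real.pi, (∫ s in (0 : ℝ)..Real.pi,
      f (dir e x t, dir e' y s) * cesaroKernel (-β) m s) * cesaroKernel (-α) n t =
      (∫ t in (0 : ℝ)..Real.pi, (∫ s in (0 : ℝ)..Real.pi,
        (f (dir e x t, dir e' y s) - ℓ e e') * cesaroKernel (-β) m s) * cesaroKernel (-α) n t) +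
      ℓ e e' * (Real.pi ^ 2 / 4) := by
    have h1 : ℓ e e' * (Real.pi ^ 2 / 4) =
        ∫ t in (0 : ℝ)..Real.pi, ℓ e e' * (Real.pi / 2) * cesaroKernel (-α) n t := by
      rw [intervalIntegral.integral_const_mul, hIn]; ring
    rw [h1, ← intervalIntegral.integral_add ((hΨ' e e').mul_continuousOn hKn.continuousOn)
      ((hKn.intervalIntegrable _ _).const_mul _)]
    refine intervalIntegral.integral_congr_ae ?_
    filter_upwards [hinner e e'] with t ht _
    rw [ht]; ring
  rw [cesaroMean_eq_sum_quadrants hf hfi, ← Complex.ofReal_sub, Complex.norm_real, Real.norm_eq_abs]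
  simp only [houter, Finset.sum_add_distrib, ← Finset.sum_mul]
  rw [mul_add, show ∀ X S : ℝ, 1 / Real.pi ^ 2 * X + 1 / Real.pi ^ 2 * (S * (Real.pi ^ 2 / 4)) - 1 / 4 * S =
    X / Real.pi ^ 2 by intro X S; field_simp; ring, abs_div, abs_of_pos (by positivity : 0 < Real.pi ^ 2),
    div_le_iff₀ (by positivity)]
  calc _ ≤ ∑ e : Bool, ∑ e' : Bool, η * Real.pi ^ 2 / 4 :=
        (Finset.abs_sum_le_sum_abs _ _).trans (Finset.sum_le_sum fun e _ =>
          (Finset.abs_sum_le_sum_abs _ _).trans (Finset.sum_le_sum fun e' _ => hquad e e'))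
    _ = _ := by simp; ring

lemma tendsto_cesaroMean {x y pp pm mp mm : ℝ} (h : HasQuadrantLimits f x y pp pm mp mm) :
    Tendsto (fun N : ℕ × ℕ => cesaroMean (-α) (-β) f N.1 N.2 (x, y))
      (atTop ×ˢ atTop) (𝓝 (((1 / 4 : ℝ) * (pp + pm + mp + mm) : ℝ) : ℂ)) := by
  rw [Metric.tendsto_nhds]
  intro η hη
  obtain ⟨δ, hδ, R, hR⟩ := exists_cesaroMean_estimate hα hβ hαβ hp hf hfi hfv (half_pos hη)
  set ℓ : Bool → Bool → ℝ := fun e e' => if e then (if e' then pp else pm) else (if e' then mp else mm)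
  have hdir (x : ℝ) : Tendsto (dir true x) (𝓝[>] 0) (𝓝[>] x) ∧ Tendsto (dir false x) (𝓝[>] 0) (𝓝[<] x) := by
    constructor
    · refine tendsto_nhdsWithin_iff.2 ⟨?_, ?_⟩
      · have := ((continuous_dir true x).tendsto 0).mono_left (nhdsWithin_le_nhds (s := Ioi 0))
        simpa [dir] using this
      · filter_upwards [self_mem_nhdsWithin] with t ht
        simpa [dir] using ht
    · refine tendsto_nhdsWithin_iff.2 ⟨?_, ?_⟩
      · have := ((continuous_dir false x).tendsto 0).mono_left (nhdsWithin_le_nhds (s := Ioi 0))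
        simpa [dir] using this
      · filter_upwards [self_mem_nhdsWithin] with t ht
        simpa [dir] using ht
  have hlim (e e' : Bool) : Tendsto (fun q : ℝ × ℝ => f (dir e x q.1, dir e' y q.2))
      (𝓝[>] 0 ×ˢ 𝓝[>] 0) (𝓝 (ℓ e e')) := by
    obtain ⟨h1, h2, h3, h4⟩ := h
    cases e <;> cases e'
    · exact h4.comp ((hdir x).2.prodMap (hdir y).2)
    · exact h3.comp ((hdir x).2.prodMap (hdir y).1)
    · exact h2.comp ((hdir x).1.prodMap (hdir y).2)
    · exact h1.comp ((hdir x).1.prodMap (hdir y).1)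
  have hev : ∀ᶠ q : ℝ × ℝ in 𝓝[>] 0 ×ˢ 𝓝[>] 0, ∀ e e' : Bool, |f (dir e x q.1, dir e' y q.2) - ℓ e e'| ≤ δ := by
    refine eventually_all.2 fun e => eventually_all.2 fun e' => ?_
    filter_upwards [(Metric.tendsto_nhds.1 (hlim e e')) δ hδ] with q hq
    rw [Real.dist_eq] at hq
    exact hq.le
  obtain ⟨P, hP, Q, hQ, hPQ⟩ := eventually_prod_iff.1 hev
  obtain ⟨r, hr0, hr⟩ := mem_nhdsGT_iff_exists_Ioo_subset.1 (hP.and hQ)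
  have hr0 : 0 < r := hr0
  filter_upwards [(eventually_corner_lt hr0 R).prod_mk
    (eventually_corner_lt hr0 R)] with N hN
  rw [dist_eq_norm]
  have hsum : pp + pm + mp + mm = ∑ e, ∑ e', ℓ e e' := by
    simp [ℓ]; ring
  rw [hsum]
  refine (hR N.1 N.2 hN.1.1 hN.2.1 x y ℓ fun e e' t s ht ht' hs hs' => ?_).trans_lt (half_lt_self hη)
  exact hPQ (hr ⟨ht, ht'.trans_lt hN.1.2⟩).1 (hr ⟨hs, hs'.trans_lt hN.2.2⟩).2 e e'

lemma tendstoUniformlyOn_cesaroMean {K : Set (ℝ × ℝ)} (hK : IsCompact K) (hc : ∀ q ∈ K, ContinuousAt f q) :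
    TendstoUniformlyOn (fun (N : ℕ × ℕ) (q : ℝ × ℝ) => cesaroMean (-α) (-β) f N.1 N.2 q)
      (fun q => (f q : ℂ)) (atTop ×ˢ atTop) K := by
  rw [Metric.tendstoUniformlyOn_iff]
  intro η hη
  obtain ⟨δ, hδ, R, hR⟩ := exists_cesaroMean_estimate hα hβ hαβ hp hf hfi hfv (half_pos hη)
  -- Only one of the two compared points has to lie in `K`, which matters because the sampled
  -- neighbours may leave `K`.
  have hu := hK.uniformContinuousAt_of_continuousAt f hc (Metric.dist_mem_uniformity hδ)
  obtain ⟨r, hr0, hr⟩ := Metric.mem_uniformity_dist.1 hu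
  filter_upwards [(eventually_corner_lt hr0 R).prod_mk
    (eventually_corner_lt hr0 R)] with N hN q hq
  obtain ⟨x, y⟩ := q
  rw [dist_comm, dist_eq_norm]
  have hsum : f (x, y) = 1 / 4 * ∑ e : Bool, ∑ e' : Bool, f (x, y) := by simp; ring
  rw [hsum]
  refine (hR N.1 N.2 hN.1.1 hN.2.1 x y (fun _ _ => f (x, y)) fun e e' t s ht ht' hs hs' => ?_).trans_lt
    (half_lt_self hη)
  have hd (e : Bool) (x t : ℝ) (ht : 0 < t) (htr : t < r) : dist x (dir e x t) < r := by
    rw [Real.dist_eq]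
    cases e <;> simp [dir, abs_of_pos ht, htr]
  have := @hr (x, y) (dir e x t, dir e' y s) (by
    rw [Prod.dist_eq]
    exact max_lt (hd e x t ht (ht'.trans_lt hN.1.2)) (hd e' y s hs (hs'.trans_lt hN.2.2))) hq
  rw [← Real.dist_eq, dist_comm]
  exact (le_of_lt this)

end Convergence

/-! ### Test functions adapted to the kernel -/

/-- The projection onto `[p, q]`. -/
def clamp (p q t : ℝ) : ℝ := max p (min t q)

/-- A bump on `[T, 2T]` oscillating with the phase of the kernel of order `-α`. -/
def wave (α : ℝ) (N : ℕ) (T t : ℝ) : ℝ :=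
  (clamp T (2 * T) t - T) * (2 * T - clamp T (2 * T) t) / T ^ 2 *
    Real.sin (kernelPhase α N (clamp T (2 * T) t))

lemma clamp_mem {p q : ℝ} (h : p ≤ q) (t : ℝ) : clamp p q t ∈ Icc p q :=
  ⟨le_max_left _ _, max_le h (min_le_right _ _)⟩

lemma clamp_of_mem {p q t : ℝ} (h : t ∈ Icc p q) : clamp p q t = t := by
  rw [clamp, min_eq_left h.2, max_eq_right h.1]

lemma clamp_of_le {p q t : ℝ} (h : t ≤ p) : clamp p q t = p :=
  max_eq_left ((min_le_left _ _).trans h)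

lemma clamp_of_ge {p q t : ℝ} (hpq : p ≤ q) (h : q ≤ t) : clamp p q t = q := by
  rw [clamp, min_eq_right h, max_eq_right hpq]

@[fun_prop]
lemma continuous_clamp (p q : ℝ) : Continuous (clamp p q) := by unfold clamp; fun_prop

@[fun_prop]
lemma continuous_wave (α : ℝ) (N : ℕ) (T : ℝ) : Continuous (wave α N T) := by
  unfold wave kernelPhase; fun_prop

lemma bump_bounds {T t : ℝ} (hT : 0 < T) (ht : t ∈ Icc T (2 * T)) :
    0 ≤ (t - T) * (2 * T - t) / T ^ 2 ∧ (t - T) * (2 * T - t) / T ^ 2 ≤ 1 := by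
  have h1 : 0 ≤ t - T := by linarith [ht.1]
  have h2 : 0 ≤ 2 * T - t := by linarith [ht.2]
  refine ⟨by positivity, ?_⟩
  rw [div_le_one (by positivity)]
  nlinarith

lemma abs_wave_le (α : ℝ) (N : ℕ) {T : ℝ} (hT : 0 < T) (t : ℝ) : |wave α N T t| ≤ 1 := by
  obtain ⟨h1, h2⟩ := bump_bounds hT (clamp_mem (by linarith : T ≤ 2 * T) t)
  rw [wave, abs_mul, abs_of_nonneg h1]
  exact mul_le_one₀ h2 (abs_nonneg _) (Real.abs_sin_le_one _)

lemma wave_of_le (α : ℝ) (N : ℕ) {T t : ℝ} (h : t ≤ T) : wave α N T t = 0 := by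
  rw [wave, clamp_of_le h]; simp

lemma wave_of_ge (α : ℝ) (N : ℕ) {T t : ℝ} (hT : 0 ≤ T) (h : 2 * T ≤ t) : wave α N T t = 0 := by
  rw [wave, clamp_of_ge (by linarith) h]; simp

lemma abs_sin_sub_sin_le (x y : ℝ) : |Real.sin x - Real.sin y| ≤ |x - y| := by
  rw [Real.sin_sub_sin, abs_mul, abs_mul, abs_two]
  have h1 := Real.abs_sin_le_abs (x := (x - y) / 2)
  have h2 := Real.abs_cos_le_one ((x + y) / 2)
  have h3 : |(x - y) / 2| = |x - y| / 2 := by rw [abs_div, abs_two]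
  calc _ ≤ 2 * (|x - y| / 2) * 1 := by rw [← h3]; gcongr
    _ = _ := by ring

/-- The bump has slope at most `1/T` and the sine at most the frequency. Stating this through
`clamp` lets increments over disjoint intervals be added up. -/
lemma abs_wave_sub_le (α : ℝ) (N : ℕ) {T : ℝ} (hT : 0 < T) (hM : 0 ≤ kernelFreq α N) (t t' : ℝ) :
    |wave α N T t - wave α N T t'| ≤
      (1 / T + kernelFreq α N) * |clamp T (2 * T) t - clamp T (2 * T) t'| := by
  have hc := clamp_mem (by linarith : T ≤ 2 * T) t
  have hc' := clamp_mem (by linarith : T ≤ 2 * T) t'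
  simp only [wave]
  set c := clamp T (2 * T) t
  set c' := clamp T (2 * T) t'
  obtain ⟨h1, h2⟩ := bump_bounds hT hc
  have e : (c - T) * (2 * T - c) / T ^ 2 * Real.sin (kernelPhase α N c) -
      (c' - T) * (2 * T - c') / T ^ 2 * Real.sin (kernelPhase α N c') =
      (c - T) * (2 * T - c) / T ^ 2 * (Real.sin (kernelPhase α N c) - Real.sin (kernelPhase α N c')) +
      (3 * T - c - c') / T * (c - c') / T * Real.sin (kernelPhase α N c') := by
    field_simp; ring
  have hs := abs_sin_sub_sin_le (kernelPhase α N c) (kernelPhase α N c')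
  have hp : kernelPhase α N c - kernelPhase α N c' = kernelFreq α N * (c - c') := by
    simp only [kernelPhase]; ring
  rw [hp, abs_mul, abs_of_nonneg hM] at hs
  have hq : |(3 * T - c - c') / T| ≤ 1 := by
    rw [abs_div, abs_of_pos hT, div_le_one hT, abs_le]
    constructor <;> linarith [hc.1, hc.2, hc'.1, hc'.2]
  have hs' := Real.abs_sin_le_one (kernelPhase α N c')
  rw [e]
  refine (abs_add_le _ _).trans ?_
  rw [abs_mul, abs_mul, abs_div _ T, abs_mul, abs_of_nonneg h1, abs_of_pos hT]
  calc _ ≤ 1 * (kernelFreq α N * |c - c'|) + 1 * |c - c'| / T * 1 := by gcongr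
    _ = _ := by ring

lemma integral_bump {T : ℝ} (hT : 0 < T) :
    ∫ t in T..(2 * T), (t - T) * (2 * T - t) / T ^ 2 = T / 6 := by
  have h : ∀ t ∈ uIcc T (2 * T), HasDerivAt (fun t => (-(t ^ 3) / 3 + 3 * T * t ^ 2 / 2 - 2 * T ^ 2 * t) / T ^ 2)
      ((t - T) * (2 * T - t) / T ^ 2) t := by
    intro t _
    have h1 := ((((hasDerivAt_pow 3 t).neg.div_const 3).add
      (((hasDerivAt_pow 2 t).const_mul (3 * T)).div_const 2)).sub
        ((hasDerivAt_id t).const_mul (2 * T ^ 2))).div_const (T ^ 2)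
    refine h1.congr_deriv ?_
    push_cast
    field_simp
    ring
  rw [intervalIntegral.integral_eq_sub_of_hasDerivAt h (Continuous.intervalIntegrable (by fun_prop) _ _)]
  field_simp
  ring

/-- With `θ` the common phase, `sin θ · Im (e^{iθ} S) = (Re S - Re (e^{2iθ} S)) / 2`: a
nonoscillating main term and a term of doubled frequency. -/
lemma wave_mul_cesaroKernel {α : ℝ} (N : ℕ) {T t : ℝ} (ht : t ∈ Icc T (2 * T)) (htπ : t ∈ Ioc 0 Real.pi) :
    wave α N T t * cesaroKernel (-α) N t = ((t - T) * (2 * T - t) / T ^ 2 * (kernelAmplitude α N t).re -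
      (Complex.exp ((2 * kernelFreq α N * t + α * Real.pi : ℝ) * Complex.I) *
        (((t - T) * (2 * T - t) / T ^ 2 : ℝ) * kernelAmplitude α N t)).re) / (2 * cesaroNumber (-α) N) := by
  rw [wave, clamp_of_mem ht, cesaroKernel_eq_im N htπ]
  set b := (t - T) * (2 * T - t) / T ^ 2
  set S := kernelAmplitude α N t
  set θ := kernelPhase α N t with hθ
  have e : 2 * kernelFreq α N * t + α * Real.pi = 2 * θ := by rw [hθ, kernelPhase]; ring
  rw [e, mul_left_comm, Complex.re_ofReal_mul, Complex.mul_im, Complex.mul_re, Complex.exp_ofReal_mul_I_re,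
    Complex.exp_ofReal_mul_I_im, Complex.exp_ofReal_mul_I_re, Complex.exp_ofReal_mul_I_im,
    Real.cos_two_mul, Real.sin_two_mul]
  have h := Real.sin_sq_add_cos_sq θ
  rcases eq_or_ne (cesaroNumber (-α) N) 0 with h0 | h0
  · simp [h0]
  field_simp
  linear_combination 2 * b * S.re * h

/-- The test functions correlate with the kernel. -/
lemma exists_integral_wave_ge {α : ℝ} (hα : α ∈ Ioo (0 : ℝ) 1) : ∃ k₁ : ℕ, ∀ k m : ℕ, k₁ ≤ k → k ≤ m →
    ((2 : ℝ) ^ k) ^ α / 192 ≤ ∫ t in (0 : ℝ)..Real.pi, wave α (2 ^ m) (2 ^ k / 2 ^ m) t *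
      cesaroKernel (-α) (2 ^ m) t := by
  have hlim : Tendsto (fun k : ℕ => 12 * ((2 : ℝ) ^ k) ^ (-α)) atTop (𝓝 0) := by
    have := (tendsto_rpow_neg_atTop hα.1).comp (tendsto_pow_atTop_atTop_of_one_lt (one_lt_two (α := ℝ)))
    simpa using this.const_mul 12
  obtain ⟨k₀, hk₀⟩ := eventually_atTop.1 (hlim.eventually (ge_mem_nhds one_pos))
  -- `k₀` puts `[T, 2T]` in the range of `re_kernelAmplitude_ge`; `2^11 = 2048` exceeds `39 · 96 / 2
  -- = 1872`, which makes the oscillating term at most half of the main one.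
  refine ⟨max k₀ 11, fun k m hk hkm => ?_⟩
  have hkk₀ := hk₀ k (le_of_max_le_left hk)
  have hk11 : (2048 : ℝ) ≤ 2 ^ k := by
    calc (2048 : ℝ) = 2 ^ 11 := by norm_num
      _ ≤ 2 ^ k := pow_le_pow_right₀ one_le_two (le_of_max_le_right hk)
  set T : ℝ := 2 ^ k / 2 ^ m with hT
  have hT0 : 0 < T := by positivity
  have hT1 : T ≤ 1 := by
    rw [hT, div_le_one (by positivity)]
    exact pow_le_pow_right₀ one_le_two hkm
  have hNT : ((2 ^ m : ℕ) : ℝ) * T = 2 ^ k := by rw [hT]; push_cast; field_simp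
  set N : ℕ := 2 ^ m with hN
  have hN0 : (0 : ℝ) < N := by rw [hN]; positivity
  have hpi := Real.pi_gt_three
  have hM := kernelFreq_ge hα N
  have hM0 : 0 < kernelFreq α N := hN0.trans_le hM
  have hA := cesaroNumber_neg_pos hα N
  have hα0 := hα.1
  have h1α : 0 < 1 - α := by linarith [hα.2]
  have hsub : ∀ x ∈ Icc T (2 * T), x ∈ Ioc 0 Real.pi := fun x hx =>
    ⟨hT0.trans_le hx.1, by linarith [hx.2]⟩
  have hbig : ∀ x ∈ Icc T (2 * T), (2 : ℝ) ^ k ≤ ((N : ℝ) + 1) * x := fun x hx => by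
    rw [← hNT]
    nlinarith [hx.1]
  have hone : ∀ x ∈ Icc T (2 * T), 1 ≤ ((N : ℝ) + 1) * x := fun x hx => by linarith [hbig x hx]
  set b : ℝ → ℝ := fun t => (t - T) * (2 * T - t) / T ^ 2 with hb
  set S := kernelAmplitude α N with hS
  have hSc : ContinuousOn S (Icc T (2 * T)) := fun x hx =>
    (hasDerivAt_kernelAmplitude hα N (hsub x hx) (hone x hx)).1.continuousAt.continuousWithinAt
  -- reduce to `[T, 2T]`
  have hc : Continuous fun t => wave α N T t * cesaroKernel (-α) N t := by fun_prop
  have hred : ∫ t in (0 : ℝ)..Real.pi, wave α N T t * cesaroKernel (-α) N t =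
      ∫ t in T..(2 * T), wave α N T t * cesaroKernel (-α) N t := by
    rw [← intervalIntegral.integral_add_adjacent_intervals (hc.intervalIntegrable 0 T) (hc.intervalIntegrable T _),
      ← intervalIntegral.integral_add_adjacent_intervals (hc.intervalIntegrable T (2 * T)) (hc.intervalIntegrable _ _)]
    have z1 : ∫ t in (0 : ℝ)..T, wave α N T t * cesaroKernel (-α) N t = 0 := by
      refine (intervalIntegral.integral_congr (g := fun _ => 0) fun t ht => ?_).trans intervalIntegral.integral_zero
      rw [uIcc_of_le hT0.le] at ht
      simp [wave_of_le α N ht.2]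
    have z2 : ∫ t in (2 * T)..Real.pi, wave α N T t * cesaroKernel (-α) N t = 0 := by
      refine (intervalIntegral.integral_congr (g := fun _ => 0) fun t ht => ?_).trans intervalIntegral.integral_zero
      rw [uIcc_of_le (by linarith)] at ht
      simp [wave_of_ge α N hT0.le ht.1]
    rw [z1, z2]; ring
  have hbc : Continuous b := by fun_prop
  have hreI : IntervalIntegrable (fun t => b t * (S t).re) volume T (2 * T) := by
    apply ContinuousOn.intervalIntegrable
    rw [uIcc_of_le (by linarith)]
    exact hbc.continuousOn.mul (Complex.continuous_re.comp_continuousOn hSc)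
  have hexI : IntervalIntegrable (fun t : ℝ => Complex.exp ((2 * kernelFreq α N * t + α * Real.pi : ℝ) * Complex.I) *
        ((b t : ℝ) * S t)) volume T (2 * T) := by
    apply ContinuousOn.intervalIntegrable
    rw [uIcc_of_le (by linarith)]
    refine ContinuousOn.mul (Continuous.continuousOn (by fun_prop)) (ContinuousOn.mul ?_ hSc)
    exact (Complex.continuous_ofReal.comp hbc).continuousOn
  have hexI' : IntervalIntegrable (fun t : ℝ => (Complex.exp ((2 * kernelFreq α N * t + α * Real.pi : ℝ) * Complex.I) *
        ((b t : ℝ) * S t)).re) volume T (2 * T) := ⟨hexI.1.re, hexI.2.re⟩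
  have hsplit : ∫ t in T..(2 * T), wave α N T t * cesaroKernel (-α) N t =
      ((∫ t in T..(2 * T), b t * (S t).re) - Complex.re (∫ t in T..(2 * T),
        Complex.exp ((2 * kernelFreq α N * t + α * Real.pi : ℝ) * Complex.I) * ((b t : ℝ) * S t))) /
        (2 * cesaroNumber (-α) N) := by
    have hre := ContinuousLinearMap.intervalIntegral_comp_comm Complex.reCLM hexI
    simp only [Complex.reCLM_apply] at hre
    rw [← hre, ← intervalIntegral.integral_sub hreI hexI', ← intervalIntegral.integral_div]
    refine intervalIntegral.integral_congr fun t ht => ?_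
    rw [uIcc_of_le (by linarith)] at ht
    exact wave_mul_cesaroKernel N ht (hsub t ht)
  have hmain : T ^ α / 48 ≤ ∫ t in T..(2 * T), b t * (S t).re := by
    have h1 : ∫ t in T..(2 * T), b t * (1 / 4 * (2 * T) ^ (α - 1)) ≤ ∫ t in T..(2 * T), b t * (S t).re := by
      refine intervalIntegral.integral_mono_on (by linarith) (Continuous.intervalIntegrable (by fun_prop) _ _) hreI
        fun t ht => mul_le_mul_of_nonneg_left ?_ (bump_bounds hT0 ht).1
      have ht0 := (hsub t ht).1
      refine le_trans ?_ (re_kernelAmplitude_ge hα N (hsub t ht) ?_)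
      · gcongr ?_ * ?_
        exact Real.rpow_le_rpow_of_nonpos ht0 ht.2 (by linarith)
      · refine le_trans ?_ hkk₀
        gcongr ?_ * ?_
        exact Real.rpow_le_rpow_of_nonpos (by positivity) (hbig t ht) (by linarith)
    rw [intervalIntegral.integral_mul_const, integral_bump hT0] at h1
    refine le_trans ?_ h1
    have h2 : (2 : ℝ) ^ (-1 : ℝ) ≤ 2 ^ (α - 1) := Real.rpow_le_rpow_of_exponent_le (by norm_num) (by linarith)
    rw [Real.rpow_neg_one] at h2
    rw [Real.mul_rpow (by norm_num) hT0.le, Real.rpow_sub_one hT0.ne']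
    have h3 : 0 < T ^ α := by positivity
    have e : T / 6 * (1 / 4 * (2 ^ (α - 1) * (T ^ α / T))) = T ^ α / 24 * 2 ^ (α - 1) := by
      field_simp; norm_num
    rw [e]
    nlinarith
  have hosc : ‖∫ t in T..(2 * T), Complex.exp ((2 * kernelFreq α N * t + α * Real.pi : ℝ) * Complex.I) *
      ((b t : ℝ) * S t)‖ ≤ T ^ α / 96 := by
    have hbd (x : ℝ) : HasDerivAt (fun t => ((b t : ℝ) : ℂ)) ((3 * T - 2 * x) / T ^ 2 : ℝ) x := by
      have : HasDerivAt b ((3 * T - 2 * x) / T ^ 2) x := by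
        have h := (((hasDerivAt_id x).sub_const T).mul ((hasDerivAt_id x).const_sub (2 * T))).div_const (T ^ 2)
        refine h.congr_deriv ?_
        simp only [id]
        ring
      exact this.ofReal_comp
    -- `39 = 15 + 24`: slope of the bump times the amplitude, plus bump times the derivative of the
    -- amplitude. The endpoint terms vanish with the bump.
    have key := norm_integral_exp_mul_le (S := fun t => (b t : ℂ) * S t) (M := 2 * kernelFreq α N)
      (γ := α * Real.pi) (t := T) (T := 2 * T) (B := fun x => -(39 * T ^ (α - 2) * x))
      (B' := fun _ => -(39 * T ^ (α - 2) * 1)) (by positivity) (by linarith)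
      (fun x hx => (hbd x).mul (hasDerivAt_kernelAmplitude hα N (hsub x hx) (hone x hx)).1)
      (fun x hx => ((hasDerivAt_id x).const_mul _).neg)
      (fun x hx => by
        have hx0 := (hsub x hx).1
        have s1 := norm_kernelAmplitude_le hα N (hsub x hx) (hone x hx)
        have s2 := (hasDerivAt_kernelAmplitude hα N (hsub x hx) (hone x hx)).2
        have r1 : x ^ (α - 1) ≤ T ^ (α - 1) := Real.rpow_le_rpow_of_nonpos hT0 hx.1 (by linarith)
        have r2 : x ^ (α - 2) ≤ T ^ (α - 2) := Real.rpow_le_rpow_of_nonpos hT0 hx.1 (by linarith)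
        have r3 : T ^ (α - 2) = T ^ (α - 1) / T := by
          rw [← Real.rpow_sub_one hT0.ne']; ring_nf
        obtain ⟨b1, b2⟩ := bump_bounds hT0 hx
        have b3 : |(3 * T - 2 * x) / T ^ 2| ≤ 1 / T := by
          rw [abs_div, abs_of_pos (by positivity : 0 < T ^ 2), div_le_div_iff₀ (by positivity) hT0]
          have : |3 * T - 2 * x| ≤ T := by
            rw [abs_le]; constructor <;> linarith [hx.1, hx.2]
          nlinarith
        rw [neg_neg, mul_one]
        refine (norm_add_le _ _).trans ?_
        rw [norm_mul, norm_mul, Complex.norm_real, Complex.norm_real, Real.norm_eq_abs, Real.norm_eq_abs,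
          abs_of_nonneg b1]
        calc _ ≤ 1 / T * (15 * T ^ (α - 1)) + 1 * (24 * T ^ (α - 2)) := by
              gcongr
              · exact s1.trans (by gcongr)
              · exact s2.trans (by gcongr)
          _ = _ := by rw [r3]; ring)
    refine key.trans ?_
    have z1 : b T = 0 := by simp [hb]
    have z2 : b (2 * T) = 0 := by simp [hb]
    simp only [z1, z2, Complex.ofReal_zero, zero_mul, norm_zero, zero_add]
    have e : -(39 * T ^ (α - 2) * T) - -(39 * T ^ (α - 2) * (2 * T)) = 39 * T ^ α / T := by
      have : T ^ (α - 2) = T ^ α / T ^ 2 := by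
        rw [Real.rpow_sub hT0, Real.rpow_two]
      rw [this]; field_simp; ring
    rw [e, div_div, div_le_div_iff₀ (by positivity) (by norm_num)]
    have h3 : 0 < T ^ α := by positivity
    have h4 : 2048 ≤ T * kernelFreq α N := by
      calc (2048 : ℝ) ≤ N * T := by rw [hNT]; exact hk11
        _ ≤ _ := by rw [mul_comm]; gcongr
    nlinarith
  rw [hred, hsplit, le_div_iff₀ (by positivity)]
  have hre := (Complex.re_le_norm _).trans hosc
  have hAle : cesaroNumber (-α) N ≤ (N : ℝ) ^ (-α) := (cesaroNumber_neg_le hα N).trans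
    (Real.rpow_le_rpow_of_nonpos hN0 (by linarith) (by linarith))
  have hfin : ((2 : ℝ) ^ k) ^ α * (N : ℝ) ^ (-α) = T ^ α := by
    rw [← hNT, Real.mul_rpow hN0.le hT0.le, mul_right_comm, ← Real.rpow_add hN0]
    simp
  calc _ = ((2 : ℝ) ^ k) ^ α * cesaroNumber (-α) N / 96 := by ring
    _ ≤ ((2 : ℝ) ^ k) ^ α * (N : ℝ) ^ (-α) / 96 := by gcongr
    _ = T ^ α / 48 - T ^ α / 96 := by rw [hfin]; ring
    _ ≤ _ := by linarith

/-! ### Variation of the test functions -/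

lemma sum_rpow_sub_one_le {s : ℝ} (hs : s ∈ Ioo (0 : ℝ) 1) (Q : ℕ) :
    ∑ i ∈ Finset.range Q, ((i : ℝ) + 1) ^ (s - 1) ≤ (Q : ℝ) ^ s / s := by
  induction Q with
  | zero => simp [Real.zero_rpow hs.1.ne']
  | succ k ih =>
    rw [Finset.sum_range_succ]
    have hk : (0 : ℝ) < (k : ℝ) + 1 := by positivity
    have h := rpow_one_add_le_one_add_mul_self (s := -(1 / ((k : ℝ) + 1))) (p := s)
      (by rw [neg_le_neg_iff, div_le_one hk]; linarith [(Nat.cast_nonneg k : (0 : ℝ) ≤ k)]) hs.1.le hs.2.le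
    have e : (1 : ℝ) + -(1 / ((k : ℝ) + 1)) = k / (k + 1) := by field_simp; ring
    rw [e, Real.div_rpow (by positivity) hk.le, div_le_iff₀ (by positivity)] at h
    rw [Real.rpow_sub_one hk.ne']
    have hs0 := hs.1
    rw [le_div_iff₀ hs0] at ih ⊢
    push_cast
    have e2 : (1 + s * -(1 / ((k : ℝ) + 1))) * ((k : ℝ) + 1) ^ s =
      ((k : ℝ) + 1) ^ s - ((k : ℝ) + 1) ^ s / (k + 1) * s := by ring
    linarith

/-- Increments at most `D` with total at most `DQ` do no worse, up to a constant, than `Q`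
increments `D` at the first ranks. Ranks up to `Q` use the bound `D`; beyond `Q` the almost
decreasing weight is replaced by its value at `Q` and the total is used. -/
lemma exists_sum_div_powLogSeq_le {s : ℝ} (hs : s ∈ Ioo (0 : ℝ) 1) : ∃ C : ℝ, 0 ≤ C ∧
    ∀ (n : ℕ) (d : ℕ → ℝ) (D : ℝ) (Q : ℕ), 1 ≤ Q → (∀ i, 0 ≤ d i) → (∀ i < n, d i ≤ D) → 0 ≤ D →
      ∑ i ∈ Finset.range n, d i ≤ D * Q →
      ∑ i ∈ Finset.range n, d i / powLogSeq s 1 (i + 1) ≤ C * (D * (Real.log (Q + 1) * (Q : ℝ) ^ s)) := by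
  have hs0 := hs.1
  have hκ : 0 < 1 - s := by linarith [hs.2]
  have hlog2 : 0 < Real.log 2 := Real.log_pos one_lt_two
  refine ⟨1 / s + (1 + 1 / ((1 - s) * Real.log 2)), by positivity, fun n d D Q hQ hd hdD hD hsum => ?_⟩
  set K : ℝ := 1 + 1 / ((1 - s) * Real.log 2)
  have hK : 0 ≤ K := by positivity
  have hQ1 : (1 : ℝ) ≤ Q := by exact_mod_cast hQ
  have hQ0 : (0 : ℝ) < Q := by linarith
  have hL : 0 ≤ Real.log ((Q : ℝ) + 1) := Real.log_nonneg (by linarith)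
  set L := Real.log ((Q : ℝ) + 1)
  have hpt : ∀ i ∈ Finset.range n, d i / powLogSeq s 1 (i + 1) ≤
      L * (D * (if i < Q then ((i : ℝ) + 1) ^ (s - 1) else 0) + K * (Q : ℝ) ^ (s - 1) * d i) := by
    intro i hi
    have hi0 : (0 : ℝ) < (i : ℝ) + 1 := by positivity
    have e : d i / powLogSeq s 1 (i + 1) = d i * (Real.log ((i : ℝ) + 1 + 1) * ((i : ℝ) + 1) ^ (s - 1)) := by
      rw [powLogSeq, Real.rpow_one]
      push_cast
      rw [← neg_sub, Real.rpow_neg hi0.le]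
      field_simp
    rw [e]
    have hdi := hd i
    split_ifs with h
    · have h1 : Real.log ((i : ℝ) + 1 + 1) ≤ L :=
        Real.log_le_log (by positivity) (by
          have : ((i + 1 : ℕ) : ℝ) ≤ Q := by exact_mod_cast h
          push_cast at this; linarith)
      have := hdD i (Finset.mem_range.1 hi)
      calc d i * (Real.log ((i : ℝ) + 1 + 1) * ((i : ℝ) + 1) ^ (s - 1))
          ≤ D * (L * ((i : ℝ) + 1) ^ (s - 1)) := by
            have := Real.log_nonneg (by linarith : (1 : ℝ) ≤ (i : ℝ) + 1 + 1)
            gcongr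
        _ = L * (D * ((i : ℝ) + 1) ^ (s - 1) + 0) := by ring
        _ ≤ _ := by gcongr; positivity
    · have h1 := log_add_one_le_mul_rpow hκ hQ1 (y := (i : ℝ) + 1) (by
        have : (Q : ℝ) ≤ i := by exact_mod_cast not_lt.1 h
        linarith)
      have e2 : (((i : ℝ) + 1) / Q) ^ (1 - s) * ((i : ℝ) + 1) ^ (s - 1) = (Q : ℝ) ^ (s - 1) := by
        rw [Real.div_rpow hi0.le hQ0.le, div_mul_eq_mul_div, ← Real.rpow_add hi0, ← neg_sub 1 s,
          Real.rpow_neg hQ0.le]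
        simp
      calc d i * (Real.log ((i : ℝ) + 1 + 1) * ((i : ℝ) + 1) ^ (s - 1))
          ≤ d i * (K * (((i : ℝ) + 1) / Q) ^ (1 - s) * L * ((i : ℝ) + 1) ^ (s - 1)) := by gcongr
        _ = d i * (K * ((((i : ℝ) + 1) / Q) ^ (1 - s) * ((i : ℝ) + 1) ^ (s - 1)) * L) := by ring
        _ = _ := by rw [e2]; ring
  refine (Finset.sum_le_sum hpt).trans ?_
  rw [← Finset.mul_sum, Finset.sum_add_distrib, ← Finset.mul_sum, ← Finset.mul_sum]
  have h1 : ∑ i ∈ Finset.range n, (if i < Q then ((i : ℝ) + 1) ^ (s - 1) else 0) ≤ (Q : ℝ) ^ s / s := by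
    rw [← Finset.sum_filter]
    refine (Finset.sum_le_sum_of_subset_of_nonneg (fun i hi => ?_) fun i _ _ => by positivity).trans
      (sum_rpow_sub_one_le hs Q)
    exact Finset.mem_range.2 (Finset.mem_filter.1 hi).2
  have e3 : (Q : ℝ) ^ (s - 1) * Q = (Q : ℝ) ^ s := by rw [Real.rpow_sub_one hQ0.ne']; field_simp
  calc _ ≤ L * (D * ((Q : ℝ) ^ s / s) + K * (Q : ℝ) ^ (s - 1) * (D * Q)) := by gcongr
    _ = L * (D * ((Q : ℝ) ^ s / s) + K * D * ((Q : ℝ) ^ (s - 1) * Q)) := by ring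
    _ = _ := by rw [e3]; ring

/-! ### Increments of clamped and folded coordinates over nonoverlapping intervals -/

lemma clamp_mono {p q : ℝ} : Monotone (clamp p q) := fun _ _ h =>
  max_le_max le_rfl (min_le_min h le_rfl)

lemma clamp_sub_clamp {p q a b : ℝ} (hpq : p ≤ q) (hab : a ≤ b) :
    clamp p q b - clamp p q a = volume.real (Ioo a b ∩ Ioo p q) := by
  rw [Ioo_inter_Ioo, Real.volume_real_Ioo, clamp, clamp]
  grind

lemma IntervalCollection.sum_clamp_le (E : IntervalCollection) {p q : ℝ} (hpq : p ≤ q) :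
    ∑ i, (clamp p q (E.b i) - clamp p q (E.a i)) ≤ q - p := by
  have h : ∑ i, (clamp p q (E.b i) - clamp p q (E.a i)) =
      volume.real (⋃ i ∈ (Finset.univ : Finset (Fin E.n)), (Ioo (E.a i) (E.b i) ∩ Ioo p q)) := by
    rw [measureReal_biUnion_finset (fun i _ j _ hij => (E.nonoverlapping i j hij).mono inter_subset_left
      inter_subset_left) (fun i _ => measurableSet_Ioo.inter measurableSet_Ioo)
      (fun i _ => ((measure_mono inter_subset_right).trans_lt measure_Ioo_lt_top).ne)]
    exact Finset.sum_congr rfl fun i _ => clamp_sub_clamp hpq (E.lt i).le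
  rw [h]
  refine (measureReal_mono (s₂ := Ioo p q) (by simp) measure_Ioo_lt_top.ne).trans ?_
  rw [Real.volume_real_Ioo_of_le hpq]

/-- The even `2π`-periodic function which is the identity on `[0, π]`. -/
def fold (x : ℝ) : ℝ := Real.arccos (Real.cos x)

@[fun_prop]
lemma continuous_fold : Continuous fold := Real.continuous_arccos.comp Real.continuous_cos

lemma fold_add_two_pi (x : ℝ) : fold (x + 2 * Real.pi) = fold x := by simp [fold]

lemma fold_neg (x : ℝ) : fold (-x) = fold x := by simp [fold]

lemma fold_of_mem {x : ℝ} (h : x ∈ Icc 0 Real.pi) : fold x = x := Real.arccos_cos h.1 h.2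

lemma fold_of_ge {x : ℝ} (h : x ∈ Icc Real.pi (2 * Real.pi)) : fold x = 2 * Real.pi - x := by
  rw [← fold_of_mem (x := 2 * Real.pi - x) ⟨by linarith [h.2], by linarith [h.1]⟩, fold, fold, Real.cos_two_pi_sub]

/-- The folded coordinate crosses `[T, 2T]` once upwards and once downwards, at the mirror image; `T
≤ 1` keeps the two crossings on opposite sides of `π`. -/
lemma clamp_fold {T x : ℝ} (hT : 0 ≤ T) (hT1 : T ≤ 1) (hx : x ∈ Icc 0 (2 * Real.pi)) :
    clamp T (2 * T) (fold x) = clamp T (2 * T) x - clamp (2 * Real.pi - 2 * T) (2 * Real.pi - T) x +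
      (2 * Real.pi - 2 * T) := by
  have hpi := Real.pi_gt_three
  rcases le_total x Real.pi with h | h
  · rw [fold_of_mem ⟨hx.1, h⟩, clamp_of_le (p := 2 * Real.pi - 2 * T) (by linarith)]
    ring
  · rw [fold_of_ge ⟨h, hx.2⟩, clamp_of_ge (t := x) (by linarith) (by linarith)]
    simp only [clamp]
    grind

lemma IntervalCollection.sum_abs_clamp_fold_le (E : IntervalCollection) {T : ℝ} (hT : 0 ≤ T) (hT1 : T ≤ 1) :
    ∑ i, |clamp T (2 * T) (fold (E.b i)) - clamp T (2 * T) (fold (E.a i))| ≤ 2 * T := by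
  have h : ∀ i ∈ Finset.univ, |clamp T (2 * T) (fold (E.b i)) - clamp T (2 * T) (fold (E.a i))| ≤
      (clamp T (2 * T) (E.b i) - clamp T (2 * T) (E.a i)) +
      (clamp (2 * Real.pi - 2 * T) (2 * Real.pi - T) (E.b i) -
        clamp (2 * Real.pi - 2 * T) (2 * Real.pi - T) (E.a i)) := by
    intro i _
    have hab := (E.lt i).le
    rw [clamp_fold hT hT1 ⟨(E.zero_le i).trans hab, E.le_two_pi i⟩,
      clamp_fold hT hT1 ⟨E.zero_le i, hab.trans (E.le_two_pi i)⟩]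
    have h1 := clamp_mono (p := T) (q := 2 * T) hab
    have h2 := clamp_mono (p := 2 * Real.pi - 2 * T) (q := 2 * Real.pi - T) hab
    rw [abs_le]
    constructor <;> linarith
  refine (Finset.sum_le_sum h).trans ?_
  rw [Finset.sum_add_distrib]
  have h1 := E.sum_clamp_le (p := T) (q := 2 * T) (by linarith)
  have h2 := E.sum_clamp_le (p := 2 * Real.pi - 2 * T) (q := 2 * Real.pi - T) (by linarith)
  linarith

lemma kernelFreq_le {α : ℝ} (hα : α ∈ Ioo (0 : ℝ) 1) (N : ℕ) : kernelFreq α N ≤ N + 1 := by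
  rw [kernelFreq]; linarith [hα.1, hα.2]

/-- The coefficient of the wave at the scale `2 ^ k`. -/
def waveCoeff (s : ℝ) (k : ℕ) : ℝ := 1 / (k * ((2 : ℝ) ^ k) ^ s)

lemma waveCoeff_nonneg (s : ℝ) (k : ℕ) : 0 ≤ waveCoeff s k := by unfold waveCoeff; positivity

lemma waveCoeff_le_one {s : ℝ} (hs : 0 ≤ s) {k : ℕ} (hk : 1 ≤ k) : waveCoeff s k ≤ 1 := by
  have h1 : (1 : ℝ) ≤ k := by exact_mod_cast hk
  have h2 : (1 : ℝ) ≤ ((2 : ℝ) ^ k) ^ s := Real.one_le_rpow (one_le_pow₀ one_le_two) hs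
  rw [waveCoeff, div_le_one (by positivity)]
  nlinarith

/-- A wave at scale `2^k` has height at most `1` and total variation `O(2^k)`, so its `Λ`-variation
is `O(k 2^{ks})`, which `waveCoeff` cancels. The bound does not depend on `k` or `m`. -/
lemma exists_sum_wave_le {s : ℝ} (hs : s ∈ Ioo (0 : ℝ) 1) : ∃ C : ℝ, 0 ≤ C ∧
    ∀ α ∈ Ioo (0 : ℝ) 1, ∀ k m : ℕ, 1 ≤ k → k ≤ m → ∀ c : ℝ, |c| ≤ 1 → ∀ E : IntervalCollection,
      ∑ i : Fin E.n, |waveCoeff s k * c * wave α (2 ^ m) (2 ^ k / 2 ^ m) (fold (E.b i)) -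
        waveCoeff s k * c * wave α (2 ^ m) (2 ^ k / 2 ^ m) (fold (E.a i))| / powLogSeq s 1 (i + 1) ≤ C := by
  obtain ⟨C, hC, H⟩ := exists_sum_div_powLogSeq_le hs
  refine ⟨12 * C, by positivity, fun α hα k m hk hkm c hc E => ?_⟩
  have hs0 := hs.1
  have hk1 : (1 : ℝ) ≤ k := by exact_mod_cast hk
  have h2k : (2 : ℝ) ≤ 2 ^ k := by simpa using pow_le_pow_right₀ (one_le_two (α := ℝ)) hk
  set T : ℝ := 2 ^ k / 2 ^ m with hT
  have hT0 : 0 < T := by positivity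
  have hT1 : T ≤ 1 := by
    rw [hT, div_le_one (by positivity)]
    exact pow_le_pow_right₀ one_le_two hkm
  have hM := kernelFreq_le hα (2 ^ m)
  have hM0 : 0 ≤ kernelFreq α (2 ^ m) := (Nat.cast_nonneg _).trans (kernelFreq_ge hα (2 ^ m))
  have hMT : kernelFreq α (2 ^ m) * T ≤ 2 ^ k + 1 := by
    calc _ ≤ (((2 ^ m : ℕ) : ℝ) + 1) * T := by gcongr
      _ = 2 ^ k + T := by rw [hT]; push_cast; field_simp
      _ ≤ _ := by linarith
  set τ := waveCoeff s k
  have hτ : 0 ≤ τ := waveCoeff_nonneg s k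
  set w := fun x => wave α (2 ^ m) T (fold x) with hw
  have hscale (x y : ℝ) : |τ * c * w x - τ * c * w y| ≤ τ * |w x - w y| := by
    rw [← mul_sub, abs_mul, abs_mul, abs_of_nonneg hτ, mul_assoc]
    gcongr
    exact mul_le_of_le_one_left (abs_nonneg _) hc
  have hd1 (x y : ℝ) : |τ * c * w x - τ * c * w y| ≤ 2 * τ := by
    refine (hscale x y).trans ?_
    have h1 := abs_wave_le α (2 ^ m) hT0 (fold x)
    have h2 := abs_wave_le α (2 ^ m) hT0 (fold y)
    have h3 : |w x - w y| ≤ 2 := (abs_sub _ _).trans (by linarith)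
    nlinarith
  -- The Lipschitz bound gives `τ (2^{k+1} + 4)`, which is at most `2τ · 2^{k+1}` because `k ≥ 1`.
  have hsum : ∑ i : Fin E.n, |τ * c * w (E.b i) - τ * c * w (E.a i)| ≤ 2 * τ * (2 ^ (k + 1) : ℕ) := by
    calc _ ≤ ∑ i : Fin E.n, τ * ((1 / T + kernelFreq α (2 ^ m)) *
          |clamp T (2 * T) (fold (E.b i)) - clamp T (2 * T) (fold (E.a i))|) :=
          Finset.sum_le_sum fun i _ => (hscale _ _).trans (by
            gcongr
            exact abs_wave_sub_le α (2 ^ m) hT0 hM0 _ _)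
      _ ≤ τ * ((1 / T + kernelFreq α (2 ^ m)) * (2 * T)) := by
          rw [← Finset.mul_sum, ← Finset.mul_sum]
          gcongr
          exact E.sum_abs_clamp_fold_le hT0.le hT1
      _ = τ * (2 + 2 * (kernelFreq α (2 ^ m) * T)) := by field_simp
      _ ≤ τ * (2 + 2 * (2 ^ k + 1)) := by gcongr
      _ ≤ _ := by
          push_cast
          rw [pow_succ]
          nlinarith
  set d : ℕ → ℝ := fun i => if h : i < E.n then |τ * c * w (E.b ⟨i, h⟩) - τ * c * w (E.a ⟨i, h⟩)| else 0 with hd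
  have hdi (i : Fin E.n) : |τ * c * w (E.b i) - τ * c * w (E.a i)| = d i := by simp [hd]
  have key := H E.n d (2 * τ) (2 ^ (k + 1)) Nat.one_le_two_pow
    (fun i => by simp only [hd]; split_ifs <;> simp)
    (fun i hi => by simp only [hd, dif_pos hi]; exact hd1 _ _) (by positivity)
    (by
      rw [← Fin.sum_univ_eq_sum_range]
      simpa only [← hdi] using hsum)
  rw [← Fin.sum_univ_eq_sum_range (fun i => d i / powLogSeq s 1 (i + 1))] at key
  change ∑ i : Fin E.n, |τ * c * w (E.b i) - τ * c * w (E.a i)| / powLogSeq s 1 (i + 1) ≤ _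
  simp only [hdi]
  refine key.trans ?_
  have hlog : Real.log (((2 ^ (k + 1) : ℕ) : ℝ) + 1) ≤ 3 * k := by
    have h1 : ((2 ^ (k + 1) : ℕ) : ℝ) + 1 ≤ 2 ^ (k + 2) := by
      push_cast
      have : (1 : ℝ) ≤ 2 ^ (k + 1) := one_le_pow₀ one_le_two
      rw [pow_succ 2 (k + 1)]
      linarith
    have h2 := Real.log_le_log (by positivity) h1
    rw [Real.log_pow] at h2
    have h3 : Real.log 2 ≤ 1 := by linarith [Real.log_two_lt_d9]
    push_cast at h2 ⊢
    nlinarith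
  have hpow : (((2 ^ (k + 1) : ℕ) : ℝ)) ^ s ≤ 2 * ((2 : ℝ) ^ k) ^ s := by
    push_cast
    rw [pow_succ, Real.mul_rpow (by positivity) (by norm_num), mul_comm]
    gcongr
    calc (2 : ℝ) ^ s ≤ 2 ^ (1 : ℝ) := Real.rpow_le_rpow_of_exponent_le one_le_two hs.2.le
      _ = 2 := Real.rpow_one 2
  have hτe : τ * (k * ((2 : ℝ) ^ k) ^ s) = 1 := one_div_mul_cancel (by positivity)
  calc _ ≤ C * (2 * τ * (3 * k * (2 * ((2 : ℝ) ^ k) ^ s))) := by gcongr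
    _ = 12 * C * (τ * (k * ((2 : ℝ) ^ k) ^ s)) := by ring
    _ = 12 * C := by rw [hτe, mul_one]

/-- A superposition of product waves on the dyadic squares `[2 ^ k / 2 ^ m, 2 ^ (k + 1) / 2 ^ m]²`. -/
def waveSum (α β : ℝ) (k₁ m : ℕ) (q : ℝ × ℝ) : ℝ :=
  ∑ k ∈ Finset.Ico k₁ (m + 1), waveCoeff (α + β) k *
    (wave α (2 ^ m) (2 ^ k / 2 ^ m) (fold q.1) * wave β (2 ^ m) (2 ^ k / 2 ^ m) (fold q.2))

lemma continuous_waveSum (α β : ℝ) (k₁ m : ℕ) : Continuous (waveSum α β k₁ m) := by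
  unfold waveSum
  refine continuous_finsetSum _ fun k _ => ?_
  have h1 := (continuous_wave α (2 ^ m) (2 ^ k / 2 ^ m)).comp (continuous_fold.comp continuous_fst)
    (X := ℝ × ℝ)
  have h2 := (continuous_wave β (2 ^ m) (2 ^ k / 2 ^ m)).comp (continuous_fold.comp continuous_snd)
    (X := ℝ × ℝ)
  exact (h1.mul h2).const_mul _

lemma isBiperiodic_waveSum (α β : ℝ) (k₁ m : ℕ) : IsBiperiodic (waveSum α β k₁ m) := fun x y => by
  simp only [waveSum, fold_add_two_pi, and_self]

lemma waveSum_swap (α β : ℝ) (k₁ m : ℕ) (x y : ℝ) : waveSum α β k₁ m (x, y) = waveSum β α k₁ m (y, x) := by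
  simp only [waveSum, add_comm α β]
  exact Finset.sum_congr rfl fun k _ => by ring

lemma eq_of_wave_ne_zero {α : ℝ} {m k l : ℕ} {t : ℝ} (hk : wave α (2 ^ m) (2 ^ k / 2 ^ m) t ≠ 0)
    (hl : wave α (2 ^ m) (2 ^ l / 2 ^ m) t ≠ 0) : k = l := by
  have key : ∀ i j : ℕ, wave α (2 ^ m) (2 ^ i / 2 ^ m) t ≠ 0 → wave α (2 ^ m) (2 ^ j / 2 ^ m) t ≠ 0 → i ≤ j := by
    intro i j hi hj
    by_contra! h
    have h1 : (2 : ℝ) ^ i / 2 ^ m < t := by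
      by_contra! h'
      exact hi (wave_of_le _ _ h')
    have h2 : t < 2 * (2 ^ j / 2 ^ m) := by
      by_contra! h'
      exact hj (wave_of_ge _ _ (by positivity) h')
    have h3 : (2 : ℝ) ^ (j + 1) / 2 ^ m ≤ 2 ^ i / 2 ^ m := by
      gcongr
      · exact one_le_two
      · exact h
    rw [pow_succ] at h3
    have : 2 * ((2 : ℝ) ^ j / 2 ^ m) = 2 ^ j * 2 / 2 ^ m := by ring
    linarith
  exact le_antisymm (key k l hk hl) (key l k hl hk)

/-- On each horizontal line at most one wave survives. -/
lemma exists_waveSum_slice (α β : ℝ) {k₁ m : ℕ} (y : ℝ) : (∀ x, waveSum α β k₁ m (x, y) = 0) ∨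
    ∃ k c, k₁ ≤ k ∧ k ≤ m ∧ |c| ≤ 1 ∧ ∀ x, waveSum α β k₁ m (x, y) =
      waveCoeff (α + β) k * c * wave α (2 ^ m) (2 ^ k / 2 ^ m) (fold x) := by
  by_cases h : ∃ k ∈ Finset.Ico k₁ (m + 1), wave β (2 ^ m) (2 ^ k / 2 ^ m) (fold y) ≠ 0
  · obtain ⟨k, hk, hky⟩ := h
    have hk' := Finset.mem_Ico.1 hk
    refine Or.inr ⟨k, wave β (2 ^ m) (2 ^ k / 2 ^ m) (fold y), hk'.1, by omega, abs_wave_le β _ (by positivity) _, fun x => ?_⟩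
    rw [waveSum, Finset.sum_eq_single_of_mem k hk fun l _ hlk => ?_]
    · ring
    · have : wave β (2 ^ m) (2 ^ l / 2 ^ m) (fold y) = 0 := by
        by_contra hl
        exact hlk (eq_of_wave_ne_zero hl hky)
      simp only [this, mul_zero]
  · push Not at h
    exact Or.inl fun x => Finset.sum_eq_zero fun k hk => by simp only [h k hk, mul_zero]

lemma abs_waveSum_le {α β : ℝ} (hα : 0 ≤ α) (hβ : 0 ≤ β) {k₁ : ℕ} (hk₁ : 1 ≤ k₁) (m : ℕ) (q : ℝ × ℝ) :
    |waveSum α β k₁ m q| ≤ 1 := by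
  obtain ⟨x, y⟩ := q
  rcases exists_waveSum_slice α β (k₁ := k₁) (m := m) y with h | ⟨k, c, hk, -, hc, h⟩
  · simp [h]
  · rw [h, abs_mul, abs_mul, abs_of_nonneg (waveCoeff_nonneg _ _)]
    exact mul_le_one₀ (mul_le_one₀ (waveCoeff_le_one (add_nonneg hα hβ) (hk₁.trans hk)) (abs_nonneg _) hc)
      (abs_nonneg _) (abs_wave_le α _ (by positivity) _)

lemma exists_waveSum_variation_le {α β : ℝ} (hα : α ∈ Ioo (0 : ℝ) 1) (hβ : β ∈ Ioo (0 : ℝ) 1)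
    (hαβ : α + β < 1) : ∃ V : ℝ, 0 ≤ V ∧ ∀ k₁ m : ℕ, 1 ≤ k₁ → ∀ (E : IntervalCollection) (z : ℝ),
      (∑ i : Fin E.n, |waveSum α β k₁ m (E.b i, z) - waveSum α β k₁ m (E.a i, z)| /
        powLogSeq (α + β) 1 (i + 1) ≤ V) ∧
      ∑ i : Fin E.n, |waveSum α β k₁ m (z, E.b i) - waveSum α β k₁ m (z, E.a i)| /
        powLogSeq (α + β) 1 (i + 1) ≤ V := by
  obtain ⟨V, hV, H⟩ := exists_sum_wave_le (s := α + β) ⟨add_pos hα.1 hβ.1, hαβ⟩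
  refine ⟨V, hV, fun k₁ m hk₁ E z => ⟨?_, ?_⟩⟩
  · rcases exists_waveSum_slice α β (k₁ := k₁) (m := m) z with h | ⟨k, c, hk, hkm, hc, h⟩
    · simpa [h] using hV
    · simp only [h]
      exact H α hα k m (hk₁.trans hk) hkm c hc E
  · simp only [waveSum_swap α β]
    rcases exists_waveSum_slice β α (k₁ := k₁) (m := m) z with h | ⟨k, c, hk, hkm, hc, h⟩
    · simpa [h] using hV
    · simp only [h, add_comm β α]
      exact H β hβ k m (hk₁.trans hk) hkm c hc E

/-- `fold` makes the function even in each variable, so the four quadrants agree at the origin, and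
each product wave separates the double integral. -/
lemma cesaroMean_waveSum (α β : ℝ) (k₁ m : ℕ) :
    cesaroMean (-α) (-β) (waveSum α β k₁ m) (2 ^ m) (2 ^ m) (0, 0) =
      (4 / Real.pi ^ 2 * ∑ k ∈ Finset.Ico k₁ (m + 1), waveCoeff (α + β) k *
        ((∫ t in (0 : ℝ)..Real.pi, wave α (2 ^ m) (2 ^ k / 2 ^ m) t * cesaroKernel (-α) (2 ^ m) t) *
          ∫ t in (0 : ℝ)..Real.pi, wave β (2 ^ m) (2 ^ k / 2 ^ m) t * cesaroKernel (-β) (2 ^ m) t) : ℝ) := by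
  rw [cesaroMean_eq_sum_quadrants (isBiperiodic_waveSum α β k₁ m)
    ((continuous_waveSum α β k₁ m).continuousOn.integrableOn_compact isCompact_square)]
  have hdir (e : Bool) {t : ℝ} (ht : t ∈ uIcc 0 Real.pi) : fold (dir e 0 t) = t := by
    rw [uIcc_of_le Real.pi_pos.le] at ht
    cases e <;> simp [dir, fold_neg, fold_of_mem ht]
  have hquad (e e' : Bool) : ∫ t in (0 : ℝ)..Real.pi, (∫ s in (0 : ℝ)..Real.pi,
      waveSum α β k₁ m (dir e 0 t, dir e' 0 s) * cesaroKernel (-β) (2 ^ m) s) * cesaroKernel (-α) (2 ^ m) t =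
      ∑ k ∈ Finset.Ico k₁ (m + 1), waveCoeff (α + β) k *
        ((∫ t in (0 : ℝ)..Real.pi, wave α (2 ^ m) (2 ^ k / 2 ^ m) t * cesaroKernel (-α) (2 ^ m) t) *
          ∫ t in (0 : ℝ)..Real.pi, wave β (2 ^ m) (2 ^ k / 2 ^ m) t * cesaroKernel (-β) (2 ^ m) t) := by
    have hinner {t : ℝ} (ht : t ∈ uIcc 0 Real.pi) : ∫ s in (0 : ℝ)..Real.pi,
        waveSum α β k₁ m (dir e 0 t, dir e' 0 s) * cesaroKernel (-β) (2 ^ m) s =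
        ∑ k ∈ Finset.Ico k₁ (m + 1), waveCoeff (α + β) k * (wave α (2 ^ m) (2 ^ k / 2 ^ m) t *
          ∫ t in (0 : ℝ)..Real.pi, wave β (2 ^ m) (2 ^ k / 2 ^ m) t * cesaroKernel (-β) (2 ^ m) t) := by
      simp only [← intervalIntegral.integral_const_mul]
      rw [← intervalIntegral.integral_finsetSum fun k _ => Continuous.intervalIntegrable (by fun_prop) _ _]
      refine intervalIntegral.integral_congr fun s hs => ?_
      simp only [waveSum, hdir _ ht, hdir _ hs, Finset.sum_mul]
      exact Finset.sum_congr rfl fun k _ => by ring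
    calc _ = ∫ t in (0 : ℝ)..Real.pi, ∑ k ∈ Finset.Ico k₁ (m + 1), waveCoeff (α + β) k *
          ((∫ t in (0 : ℝ)..Real.pi, wave β (2 ^ m) (2 ^ k / 2 ^ m) t * cesaroKernel (-β) (2 ^ m) t) *
          (wave α (2 ^ m) (2 ^ k / 2 ^ m) t * cesaroKernel (-α) (2 ^ m) t)) := by
          refine intervalIntegral.integral_congr fun t ht => ?_
          simp only [hinner ht, Finset.sum_mul]
          exact Finset.sum_congr rfl fun k _ => by ring
      _ = _ := by
          rw [intervalIntegral.integral_finsetSum fun k _ => Continuous.intervalIntegrable (by fun_prop) _ _]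
          refine Finset.sum_congr rfl fun k _ => ?_
          rw [intervalIntegral.integral_const_mul, intervalIntegral.integral_const_mul]
          ring
  simp only [hquad, Fintype.sum_bool]
  congr 1
  ring

/-- The correlations `2^{kα}` and `2^{kβ}` cancel the power in `waveCoeff` and leave `1/k`, so the
mean grows like a harmonic sum over `k ≤ m`. -/
lemma exists_waveSum_cesaroMean_gt {α β : ℝ} (hα : α ∈ Ioo (0 : ℝ) 1) (hβ : β ∈ Ioo (0 : ℝ) 1) :
    ∃ k₁ : ℕ, 1 ≤ k₁ ∧ ∀ C : ℝ, ∃ m,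
      C < ‖cesaroMean (-α) (-β) (waveSum α β k₁ m) (2 ^ m) (2 ^ m) (0, 0)‖ := by
  obtain ⟨k₁, h₁⟩ := exists_integral_wave_ge hα
  obtain ⟨k₂, h₂⟩ := exists_integral_wave_ge hβ
  refine ⟨max 1 (max k₁ k₂), le_max_left _ _, fun C => ?_⟩
  set k₀ := max 1 (max k₁ k₂)
  have hharm : Tendsto (fun m : ℕ => ∑ k ∈ Finset.Ico k₀ (m + 1), (1 : ℝ) / k) atTop atTop := by
    have h := (Real.tendsto_sum_range_one_div_nat_succ_atTop.comp (tendsto_id : Tendsto id atTop (atTop : Filter ℕ)))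
    have h2 := tendsto_atTop_add_const_right _ (-(∑ k ∈ Finset.range k₀, (1 : ℝ) / k)) h
    refine tendsto_atTop_mono' _ ?_ h2
    filter_upwards [eventually_ge_atTop k₀] with m hm
    have e : ∑ i ∈ Finset.range m, (1 : ℝ) / (i + 1) = ∑ k ∈ Finset.range (m + 1), (1 : ℝ) / k := by
      rw [Finset.sum_range_succ']; simp
    simp only [Function.comp, id]
    rw [e, Finset.sum_Ico_eq_sub _ (by omega)]
    linarith
  obtain ⟨m, hm⟩ := (hharm.const_mul_atTop (by positivity : (0 : ℝ) < 4 / Real.pi ^ 2 * (1 / 192 ^ 2))).eventually_gt_atTop C |>.exists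
  refine ⟨m, hm.trans_le ?_⟩
  rw [cesaroMean_waveSum, Complex.norm_real]
  refine le_trans ?_ (le_abs_self _)
  rw [mul_assoc]
  gcongr
  rw [Finset.mul_sum]
  refine Finset.sum_le_sum fun k hk => ?_
  have hk' := Finset.mem_Ico.1 hk
  have hk0 : (0 : ℝ) < k := by
    have : 1 ≤ k := (le_max_left _ _).trans hk'.1
    exact_mod_cast this
  have i1 := h₁ k m ((le_max_left _ _).trans ((le_max_right _ _).trans hk'.1)) (by omega)
  have i2 := h₂ k m ((le_max_right _ _).trans ((le_max_right _ _).trans hk'.1)) (by omega)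
  calc 1 / 192 ^ 2 * (1 / (k : ℝ)) = waveCoeff (α + β) k *
        (((2 : ℝ) ^ k) ^ α / 192 * (((2 : ℝ) ^ k) ^ β / 192)) := by
        rw [waveCoeff, Real.rpow_add (by positivity)]
        field_simp
    _ ≤ _ := by
        have := waveCoeff_nonneg (α + β) k
        have := i1.trans' (by positivity)
        gcongr

/-! ### Condensation of singularities -/

section Superposition

variable {g : ℕ → ℝ × ℝ → ℝ} (hgc : ∀ m, Continuous (g m)) (hg1 : ∀ m q, |g m q| ≤ 1)
  {c : ℕ → ℝ} (hc : Summable fun m => |c m|)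
include hg1

lemma abs_superposition_le (c : ℕ → ℝ) (m : ℕ) (q : ℝ × ℝ) : |c m * g m q| ≤ |c m| := by
  rw [abs_mul]
  exact mul_le_of_le_one_right (abs_nonneg _) (hg1 m q)

include hc

lemma summable_superposition (q : ℝ × ℝ) : Summable fun m => c m * g m q :=
  Summable.of_norm_bounded hc fun m => abs_superposition_le hg1 c m q

include hgc in
lemma continuous_superposition : Continuous fun q => ∑' m, c m * g m q :=
  continuous_tsum (fun m => (hgc m).const_mul _) hc fun m q => abs_superposition_le hg1 c m q

lemma sum_superposition_le {lam : ℕ → ℝ} (hlam : ∀ i, 0 < lam (i + 1)) {V : ℝ} {n : ℕ}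
    (u v : Fin n → ℝ × ℝ) (hV : ∀ m, ∑ i : Fin n, |g m (u i) - g m (v i)| / lam (i + 1) ≤ V) :
    ∑ i : Fin n, |(∑' m, c m * g m (u i)) - ∑' m, c m * g m (v i)| / lam (i + 1) ≤ (∑' m, |c m|) * V := by
  have hsum (i : Fin n) : Summable fun m => |c m| * (|g m (u i) - g m (v i)| / lam (i + 1)) := by
    refine Summable.of_nonneg_of_le (fun m => by have := hlam i; positivity)
      (fun m => mul_le_mul_of_nonneg_left ?_ (abs_nonneg _)) (hc.mul_right (2 / lam (i + 1)))
    have := hlam i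
    gcongr
    exact (abs_sub _ _).trans (by linarith [hg1 m (u i), hg1 m (v i)])
  have hterm (i : Fin n) : |(∑' m, c m * g m (u i)) - ∑' m, c m * g m (v i)| / lam (i + 1) ≤
      ∑' m, |c m| * (|g m (u i) - g m (v i)| / lam (i + 1)) := by
    have hl := hlam i
    have h1 : Summable fun m => ‖c m * g m (u i) - c m * g m (v i)‖ := by
      refine ((hsum i).mul_right (lam (i + 1))).congr fun m => ?_
      rw [← mul_sub, Real.norm_eq_abs, abs_mul]
      field_simp
    rw [← (summable_superposition hg1 hc _).tsum_sub (summable_superposition hg1 hc _), div_le_iff₀ hl,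
      ← tsum_mul_right]
    refine (norm_tsum_le_tsum_norm h1).trans (le_of_eq (tsum_congr fun m => ?_))
    rw [← mul_sub, Real.norm_eq_abs, abs_mul]
    field_simp
  refine (Finset.sum_le_sum fun i _ => hterm i).trans ?_
  rw [← Summable.tsum_finsetSum fun i _ => hsum i, ← tsum_mul_right]
  refine Summable.tsum_le_tsum (fun m => ?_) (summable_sum fun i _ => hsum i) (hc.mul_right V)
  rw [← Finset.mul_sum]
  exact mul_le_mul_of_nonneg_left (hV m) (abs_nonneg _)

lemma memPLambdaBV_superposition {lam : ℕ → ℝ} (hlam : ∀ i, 0 < lam (i + 1)) {V : ℝ}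
    (hV : ∀ (m : ℕ) (E : IntervalCollection) (z : ℝ),
      (∑ i : Fin E.n, |g m (E.b i, z) - g m (E.a i, z)| / lam (i + 1) ≤ V) ∧
      ∑ i : Fin E.n, |g m (z, E.b i) - g m (z, E.a i)| / lam (i + 1) ≤ V) :
    MemPLambdaBV lam fun q => ∑' m, c m * g m q := by
  refine ENNReal.add_lt_top.2 ⟨?_, ?_⟩
  · refine (iSup₂_le fun z _ => iSup_le fun E => ?_).trans_lt (ENNReal.ofReal_lt_top (r := (∑' m, |c m|) * V))
    rw [← ENNReal.ofReal_sum_of_nonneg fun (i : Fin E.n) _ => div_nonneg (abs_nonneg _) (hlam i).le]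
    exact ENNReal.ofReal_le_ofReal (sum_superposition_le hg1 hc hlam (fun i => (E.b i, z))
      (fun i => (E.a i, z)) fun m => (hV m E z).1)
  · refine (iSup₂_le fun z _ => iSup_le fun E => ?_).trans_lt (ENNReal.ofReal_lt_top (r := (∑' m, |c m|) * V))
    rw [← ENNReal.ofReal_sum_of_nonneg fun (i : Fin E.n) _ => div_nonneg (abs_nonneg _) (hlam i).le]
    exact ENNReal.ofReal_le_ofReal (sum_superposition_le hg1 hc hlam (fun i => (z, E.b i))
      (fun i => (z, E.a i)) fun m => (hV m E z).2)

include hgc in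
lemma integral_superposition {K : ℝ × ℝ → ℝ} (hK : Continuous K) :
    ∫ q in square, (∑' m, c m * g m q) * K q = ∑' m, c m * ∫ q in square, g m q * K q := by
  have hint (m : ℕ) : IntegrableOn (fun q => c m * (g m q * K q)) square volume :=
    (((hgc m).mul hK).const_mul (c m)).continuousOn.integrableOn_compact isCompact_square
  have hsum : Summable fun m => ∫ q in square, ‖c m * (g m q * K q)‖ := by
    refine Summable.of_nonneg_of_le (fun m => integral_nonneg fun q => norm_nonneg _) (fun m => ?_)
      (hc.mul_right (∫ q in square, |K q|))
    rw [← integral_const_mul]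
    refine integral_mono (hint m).norm
      ((hK.abs.const_mul (|c m|)).continuousOn.integrableOn_compact isCompact_square) fun q => ?_
    simp only [Real.norm_eq_abs, abs_mul]
    exact mul_le_mul_of_nonneg_left (mul_le_of_le_one_left (abs_nonneg _) (hg1 m q)) (abs_nonneg _)
  have h := hasSum_integral_of_summable_integral_norm hint hsum
  simp only [integral_const_mul] at h
  rw [h.tsum_eq]
  refine integral_congr_ae (Eventually.of_forall fun q => ?_)
  simp only [← tsum_mul_right, mul_assoc]

end Superposition

/-! ### Uniform boundedness on `ℓ¹` and the divergent function -/

lemma summable_abs_lp (c : lp (fun _ : ℕ => ℝ) 1) : HasSum (fun m => |c m|) ‖c‖ := by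
  simpa using lp.hasSum_norm (p := 1) (by simp) c

/-- If functionals `c ↦ ∑ c m * A N m` with bounded coefficients are pointwise bounded on `ℓ¹`, then their
coefficients are uniformly bounded. -/
lemma exists_coeff_bound {A : ℕ → ℕ → ℝ} (hA : ∀ N, ∃ B, ∀ m, |A N m| ≤ B)
    (h : ∀ c : ℕ → ℝ, Summable (fun m => |c m|) → ∃ C, ∀ N, |∑' m, c m * A N m| ≤ C) :
    ∃ C, ∀ N m, |A N m| ≤ C := by
  choose B hB using hA
  have hs (N : ℕ) (c : lp (fun _ : ℕ => ℝ) 1) : Summable fun m => |c m| * |A N m| :=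
    Summable.of_nonneg_of_le (fun m => by positivity) (fun m => mul_le_mul_of_nonneg_left (hB N m) (abs_nonneg _))
      ((summable_abs_lp c).summable.mul_right (B N))
  have hs' (N : ℕ) (c : lp (fun _ : ℕ => ℝ) 1) : Summable fun m => c m * A N m :=
    Summable.of_norm (by simpa only [norm_mul, Real.norm_eq_abs] using hs N c)
  let L (N : ℕ) : lp (fun _ : ℕ => ℝ) 1 →ₗ[ℝ] ℝ :=
    { toFun := fun c => ∑' m, c m * A N m
      map_add' := fun c d => by
        rw [← (hs' N c).tsum_add (hs' N d)]
        exact tsum_congr fun m => by simp [add_mul]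
      map_smul' := fun r c => by
        rw [RingHom.id_apply, smul_eq_mul, ← tsum_mul_left]
        exact tsum_congr fun m => by simp [mul_assoc] }
  let T (N : ℕ) : lp (fun _ : ℕ => ℝ) 1 →L[ℝ] ℝ := (L N).mkContinuous (B N) fun c => by
    have h1 : Summable fun m => ‖c m * A N m‖ := by
      simpa only [norm_mul, Real.norm_eq_abs] using hs N c
    refine (norm_tsum_le_tsum_norm h1).trans ?_
    rw [← (summable_abs_lp c).tsum_eq, ← tsum_mul_left]
    refine Summable.tsum_le_tsum (fun m => ?_) h1 ((summable_abs_lp c).summable.mul_left _)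
    rw [norm_mul, mul_comm]
    exact mul_le_mul_of_nonneg_right (hB N m) (abs_nonneg _)
  obtain ⟨C, hC⟩ := banach_steinhaus (g := T) fun c => by
    obtain ⟨C, hC⟩ := h c (summable_abs_lp c).summable
    exact ⟨C, fun N => hC N⟩
  refine ⟨C, fun N m => ?_⟩
  -- Unit vectors recover the coefficients from the uniform bound on operator norms.
  have e : T N (lp.single 1 m 1) = A N m := by
    change ∑' l, (lp.single 1 m (1 : ℝ) : lp (fun _ : ℕ => ℝ) 1) l * A N l = A N m
    rw [tsum_eq_single m fun l hl => by simp [hl]]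
    simp
  have h1 := (T N).le_opNorm (lp.single 1 m 1)
  rw [e, lp.norm_single (by simp), norm_one, mul_one] at h1
  exact h1.trans (hC N)

/-- Condensation of singularities for the diagonal Cesàro means at the origin. -/
theorem exists_superposition_divergent {g : ℕ → ℝ × ℝ → ℝ} (hgc : ∀ m, Continuous (g m))
    (hg1 : ∀ m q, |g m q| ≤ 1) (a b : ℝ)
    (hunb : ∀ C : ℝ, ∃ N m, C < ‖cesaroMean a b (g m) N N (0, 0)‖) :
    ∃ c : ℕ → ℝ, Summable (fun m => |c m|) ∧
      ¬ ∃ L : ℂ, Tendsto (fun N : ℕ => cesaroMean a b (fun q => ∑' m, c m * g m q) N N (0, 0)) atTop (𝓝 L) := by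
  by_contra! hcon
  let K (N : ℕ) (q : ℝ × ℝ) : ℝ := cesaroKernel a N (0 - q.1) * cesaroKernel b N (0 - q.2)
  have hK (N : ℕ) : Continuous (K N) := by fun_prop
  let A (N m : ℕ) : ℝ := ∫ q in square, g m q * K N q
  have hA (N : ℕ) : ∃ B, ∀ m, |A N m| ≤ B := by
    refine ⟨∫ q in square, |K N q|, fun m =>
      (norm_integral_le_integral_norm (fun q => g m q * K N q)).trans ?_⟩
    refine integral_mono (((hgc m).mul (hK N)).norm.continuousOn.integrableOn_compact isCompact_square)
      ((hK N).abs.continuousOn.integrableOn_compact isCompact_square) fun q => ?_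
    simp only [Real.norm_eq_abs, abs_mul]
    exact mul_le_of_le_one_left (abs_nonneg _) (hg1 m q)
  have hpi : 0 < 1 / Real.pi ^ 2 := by positivity
  -- If the means converged for every `c` in `ℓ¹`, they would be bounded for every `c`; the mean of
  -- the superposition is `∑ c m * A N m` up to the factor `1/π²`, so the `A N m` would be uniformly
  -- bounded, against `hunb`.
  obtain ⟨C, hC⟩ := exists_coeff_bound hA fun c hc => by
    obtain ⟨L, hL⟩ := hcon c hc
    obtain ⟨C, hC⟩ := (Metric.isBounded_range_of_tendsto _ hL).exists_norm_le
    refine ⟨C / (1 / Real.pi ^ 2), fun N => ?_⟩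
    have h1 := hC _ (mem_range_self N)
    rw [cesaroMean_eq ((continuous_superposition hgc hg1 hc).continuousOn.integrableOn_compact isCompact_square),
      Complex.norm_real, norm_mul, Real.norm_of_nonneg hpi.le, integral_superposition hgc hg1 hc (hK N)] at h1
    rwa [le_div_iff₀ hpi, mul_comm]
  obtain ⟨N, m, hNm⟩ := hunb (1 / Real.pi ^ 2 * C)
  rw [cesaroMean_eq ((hgc m).continuousOn.integrableOn_compact isCompact_square), Complex.norm_real, norm_mul,
    Real.norm_of_nonneg hpi.le] at hNm
  exact absurd (lt_of_mul_lt_mul_left hNm hpi.le) (hC N m).not_gt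

theorem exists_continuous_divergent {α β : ℝ} (hα : α ∈ Ioo (0 : ℝ) 1) (hβ : β ∈ Ioo (0 : ℝ) 1)
    (hαβ : α + β < 1) : ∃ f : ℝ × ℝ → ℝ, IsBiperiodic f ∧ Continuous f ∧
      MemPLambdaBV (powLogSeq (α + β) 1) f ∧
      ¬ ∃ L : ℂ, Tendsto (fun N : ℕ => cesaroMean (-α) (-β) f N N (0, 0)) atTop (𝓝 L) := by
  obtain ⟨k₁, hk₁, hbig⟩ := exists_waveSum_cesaroMean_gt hα hβ
  obtain ⟨V, -, hV⟩ := exists_waveSum_variation_le hα hβ hαβ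
  have hg1 := abs_waveSum_le hα.1.le hβ.1.le hk₁
  have hgc := continuous_waveSum α β k₁
  obtain ⟨c, hc, hdiv⟩ := exists_superposition_divergent hgc hg1 (-α) (-β)
    fun C => (hbig C).imp' (2 ^ ·) fun m hm => ⟨m, hm⟩
  refine ⟨_, fun x y => ?_, continuous_superposition hgc hg1 hc, memPLambdaBV_superposition hg1 hc
    (powLogSeq_succ_pos (α + β) 1) fun m E z => hV k₁ m hk₁ E z, hdiv⟩
  simp only [(isBiperiodic_waveSum α β k₁ _ x y).1, (isBiperiodic_waveSum α β k₁ _ x y).2, and_self]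

end CesaroNeg

end

theorem corollary1 (α β : ℝ) (hα : α ∈ Ioo (0 : ℝ) 1) (hβ : β ∈ Ioo (0 : ℝ) 1)
    (hαβ : α + β < 1) :
    (∀ (ε : ℝ) (_ : 0 < ε) (f : ℝ × ℝ → ℝ) (_ : CesaroNeg.IsBiperiodic f)
        (_ : IntegrableOn f CesaroNeg.square volume)
        (_ : CesaroNeg.MemPLambdaBV
          (fun n : ℕ => (n : ℝ) ^ (1 - (α + β)) / Real.log ((n : ℝ) + 1) ^ (1 + ε)) f),
      (∀ x y pp pm mp mm : ℝ, CesaroNeg.HasQuadrantLimits f x y pp pm mp mm →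
        Tendsto (fun N : ℕ × ℕ => CesaroNeg.cesaroMean (-α) (-β) f N.1 N.2 (x, y))
          (atTop ×ˢ atTop) (𝓝 (((1 / 4 : ℝ) * (pp + pm + mp + mm) : ℝ) : ℂ))) ∧
      (∀ K : Set (ℝ × ℝ), IsCompact K → (∀ p ∈ K, ContinuousAt f p) →
        TendstoUniformlyOn
          (fun (N : ℕ × ℕ) (p : ℝ × ℝ) => CesaroNeg.cesaroMean (-α) (-β) f N.1 N.2 p)
          (fun p => (f p : ℂ)) (atTop ×ˢ atTop) K)) ∧
    (∃ f : ℝ × ℝ → ℝ, CesaroNeg.IsBiperiodic f ∧ Continuous f ∧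
      CesaroNeg.MemPLambdaBV
        (fun n : ℕ => (n : ℝ) ^ (1 - (α + β)) / Real.log ((n : ℝ) + 1)) f ∧
      ¬ ∃ L : ℂ, Tendsto (fun N : ℕ => CesaroNeg.cesaroMean (-α) (-β) f N N (0, 0))
        atTop (𝓝 L)) := by
  refine ⟨fun ε hε f hf hfi hfv => ⟨fun x y pp pm mp mm h => ?_, fun K hK hc => ?_⟩, ?_⟩
  · exact CesaroNeg.tendsto_cesaroMean hα hβ hαβ (by linarith) hf hfi hfv h
  · exact CesaroNeg.tendstoUniformlyOn_cesaroMean hα hβ hαβ (by linarith) hf hfi hfv hK hc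
  · have e : CesaroNeg.powLogSeq (α + β) 1 =
        fun n : ℕ => (n : ℝ) ^ (1 - (α + β)) / Real.log ((n : ℝ) + 1) := by
      funext n
      rw [CesaroNeg.powLogSeq, Real.rpow_one]
    rw [← e]
    exact CesaroNeg.exists_continuous_divergent hα hβ hαβ
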